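/- **Setting.** A (finite) spherical framework $(G,p)$ on $\mathbb S^2$ is a finite simple graph $G=(V,E)$ with a map $p:V\to\mathbb S^2\subset\mathbb R^3$ whose image linearly spans $\mathbb R^3$. Let $\Gamma$ be a group, $\theta:\Gamma\to\mathrm{Aut}(G)$ an action that is free on $V$, and $\tau:\Gamma\to O(\mathbb R^3)$ a homomorphism. $(G,p)$ is $\Gamma$-symmetric (with respect to $\theta,\tau$) if $\tau(\gamma)p(i)=p(\theta(\gamma)i)$ for all $\gamma\in\Gamma$, $i\in V$. An infinitesimal motion is a map $u:V\to\mathbb R^3$ with $\langle p_i,u_j\rangle+\langle p_j,u_i\rangle=0$ for $\{i,j\}\in E$ and $\langle p_i,u_i\rangle=0$ for $i\in V$; it is trivial if $u_i=Ap_i$ for all $i$ for some skew-symmetric matrix $A$, and $\Gamma$-symmetric if $\tau(\gamma)u_i=u_{\theta(\gamma)i}$ for all $\gamma,i$. $(G,p)$ is forced $\Gamma$-symmetric infinitesimally rigid if every $\Gamma$-symmetric infinitesimal motion is trivial. **Double cover.** Let $(G,p)$ be $\Gamma$-symmetric with $-\mathrm{id}\notin\tau(\Gamma)$. A $\Gamma'$-symmetric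 framework $(G',p')$ (with respect to $\theta',\tau'$) is the double cover framework of $(G,p)$ if $(G',p')$ is the disjoint union of $(G,p)$ and its antipodal copy $(G,-p)$, and there are a homomorphism $j:\Gamma\to\Gamma'$ and an element $\iota\in\Gamma'$ with $\Gamma'=j(\Gamma)\cup\iota j(\Gamma)$ such that $j(\gamma)$ acts on each of the two copies as $\gamma$ does and $\tau'(j(\gamma))=\tau(\gamma)$, while $\iota$ interchanges corresponding vertices of the two copies and $\tau'(\iota)=-\mathrm{id}$. For subgroups $\mathcal G,\mathcal H$ of $O(\mathbb R^3)$ write $\mathcal G\twoheadrightarrow\mathcal H$ if there are a $\Gamma$-symmetric framework with $\tau$ injective, $\tau(\Gamma)=\mathcal G$, $-\mathrm{id}\notin\mathcal G$, and a $\Gamma'$-symmetric double cover framework of it with $\tau'$ injective and $\tau'(\Gamma')=\mathcal H$. **Groups.** Let $C_n$ be the rotation by $2\pi/n$ about the $z$-axis, $s_h$ the reflection in $z=0$, $s_a$ the reflection in the plane through the $z$-axis and $(\cos a,\sin a,0)$, and $C_2'$ the half-turn about the $x$-axis. Put $\mathcal C_s=\langle s_h\rangle$, $\mathcal C_i=\langle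 -\mathrm{id}\rangle$, $\mathcal C_n=\langle C_n\rangle$, $\mathcal C_{nv}=\langle C_n,s_{\pi/2}\rangle$, $\mathcal C_{nh}=\langle C_n,s_h\rangle$, $\mathcal D_n=\langle C_n,C_2'\rangle$, $\mathcal D_{nh}=\langle C_n,C_2',s_h\rangle$, $\mathcal D_{nd}=\langle C_n,C_2',s_{\pi/(2n)}\rangle$, $\mathcal S_{2n}=\langle s_hC_{2n}\rangle$ for $n\ge1$. Let $\mathcal T_d,\mathcal O_h,\mathcal I_h$ be the groups of all orthogonal maps preserving, respectively, the regular tetrahedron with vertices $(1,1,1),(1,-1,-1),(-1,1,-1),(-1,-1,1)$, the regular octahedron with vertices $\pm e_1,\pm e_2,\pm e_3$, and the regular icosahedron with vertices $(0,\pm1,\pm\varphi),(\pm1,\pm\varphi,0),(\pm\varphi,0,\pm1)$, where $\varphi=(1+\sqrt5)/2$; let $\mathcal T,\mathcal O,\mathcal I$ be their subgroups of rotations, and $\mathcal T_h=\langle\mathcal T,s_h\rangle$. **Theorem.** Consider the following list, where $n\ge1$: $\mathcal C_1\twoheadrightarrow\mathcal C_i$; $\mathcal C_s\twoheadrightarrow\mathcal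 C_{2h}$; $\mathcal C_n\twoheadrightarrow\mathcal S_{2n}$ ($n$ odd); $\mathcal C_n\twoheadrightarrow\mathcal C_{nh}$ ($n$ even); $\mathcal C_{nv}\twoheadrightarrow\mathcal D_{nd}$ ($n$ odd); $\mathcal C_{nv}\twoheadrightarrow\mathcal D_{nh}$ ($n$ even); $\mathcal C_{nh}\twoheadrightarrow\mathcal C_{2nh}$ ($n$ odd); $\mathcal S_{2n}\twoheadrightarrow\mathcal C_{2nh}$ ($n$ even); $\mathcal D_n\twoheadrightarrow\mathcal D_{nd}$ ($n$ odd); $\mathcal D_n\twoheadrightarrow\mathcal D_{nh}$ ($n$ even); $\mathcal D_{nh}\twoheadrightarrow\mathcal D_{2nh}$ ($n$ odd); $\mathcal D_{nd}\twoheadrightarrow\mathcal D_{2nh}$ ($n$ even); $\mathcal T\twoheadrightarrow\mathcal T_h$; $\mathcal T_d\twoheadrightarrow\mathcal O_h$; $\mathcal O\twoheadrightarrow\mathcal O_h$; $\mathcal I\twoheadrightarrow\mathcal I_h$. 1. For subgroups $\mathcal G,\mathcal H$ of $O(\mathbb R^3)$, $\mathcal G\twoheadrightarrow\mathcal H$ holds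 if and only if the pair $(\mathcal G,\mathcal H)$ is, up to conjugation of both groups by one common element of $O(\mathbb R^3)$, one of the pairs in the list. 2. Every $\Gamma$-symmetric framework on $\mathbb S^2$ with $-\mathrm{id}\notin\tau(\Gamma)$ has a $\Gamma'$-symmetric double cover framework, with $\Gamma'=\Gamma\times\mathbb Z_2$. 3. Let $(G,p)$ be a $\Gamma$-symmetric framework on $\mathbb S^2$ with $-\mathrm{id}\notin\tau(\Gamma)$, and let $(G',p')$ be a $\Gamma'$-symmetric double cover framework of $(G,p)$ with respect to $\theta',\tau'$. Then $\tau(\Gamma)\twoheadrightarrow\tau'(\Gamma')$, and this pairing is one of those in the list, up to a common conjugation. Moreover, $(G,p)$ is forced $\Gamma$-symmetric infinitesimally rigid if and only if $(G',p')$ is forced $\Gamma'$-symmetric infinitesimally rigid. -/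

import Mathlib

open scoped Matrix

/-! ### The orthogonal group of `ℝ³` and the symmetry groups in Schoenflies notation -/

/-- The orthogonal group `O(ℝ³)`; `g : O3` acts on vectors by `(g : Matrix _ _ ℝ) *ᵥ v`. -/
abbrev O3 : Type := Matrix.orthogonalGroup (Fin 3) ℝ

/-- The inversion `x ↦ -x`. -/
def inversion : O3 :=
  ⟨-1, by rw [Matrix.mem_orthogonalGroup_iff]; simp⟩

/-- The rotation about the `z`-axis by the angle `a`. -/
noncomputable def rotZ (a : ℝ) : O3 :=
  ⟨!![Real.cos a, -Real.sin a, 0; Real.sin a, Real.cos a, 0; 0, 0, 1], by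
    rw [Matrix.mem_orthogonalGroup_iff]
    have h := Real.sin_sq_add_cos_sq a
    ext i j
    fin_cases i <;> fin_cases j <;>
      simp [Matrix.mul_apply, Fin.sum_univ_three] <;> nlinarith [h]⟩

/-- The reflection in the horizontal plane `z = 0`. -/
def reflZ : O3 :=
  ⟨!![1, 0, 0; 0, 1, 0; 0, 0, -1], by
    rw [Matrix.mem_orthogonalGroup_iff]
    ext i j
    fin_cases i <;> fin_cases j <;>
      simp [Matrix.mul_apply, Fin.sum_univ_three]⟩

/-- The half-turn about the `x`-axis. -/
def halfTurnX : O3 :=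
  ⟨!![1, 0, 0; 0, -1, 0; 0, 0, -1], by
    rw [Matrix.mem_orthogonalGroup_iff]
    ext i j
    fin_cases i <;> fin_cases j <;>
      simp [Matrix.mul_apply, Fin.sum_univ_three]⟩

/-- The reflection in the vertical plane spanned by the `z`-axis and `(cos a, sin a, 0)`. -/
noncomputable def reflVert (a : ℝ) : O3 :=
  ⟨!![Real.cos (2 * a), Real.sin (2 * a), 0; Real.sin (2 * a), -Real.cos (2 * a), 0; 0, 0, 1], by
    rw [Matrix.mem_orthogonalGroup_iff]
    have h := Real.sin_sq_add_cos_sq (2 * a)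
    ext i j
    fin_cases i <;> fin_cases j <;>
      simp [Matrix.mul_apply, Fin.sum_univ_three] <;> nlinarith [h]⟩

/-- The group of all orthogonal maps that map the set `S` onto itself. -/
def setSymmetries (S : Set (Fin 3 → ℝ)) : Subgroup O3 where
  carrier := {g | ∀ v, (g : Matrix (Fin 3) (Fin 3) ℝ) *ᵥ v ∈ S ↔ v ∈ S}
  one_mem' := by intro v; simp
  mul_mem' := by
    intro a b ha hb v
    rw [Submonoid.coe_mul, ← Matrix.mulVec_mulVec, ha, hb]
  inv_mem' := by
    intro a ha v
    rw [← ha, Matrix.mulVec_mulVec, ← Submonoid.coe_mul, mul_inv_cancel]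
    simp

/-- The rotation group `SO(ℝ³)`, as a subgroup of `O(ℝ³)`. -/
def rotations : Subgroup O3 :=
  (Matrix.detMonoidHom.comp (Matrix.orthogonalGroup (Fin 3) ℝ).subtype).ker

/-- The vertices of a regular tetrahedron centred at the origin. -/
def tetrahedron : Set (Fin 3 → ℝ) :=
  {![1, 1, 1], ![1, -1, -1], ![-1, 1, -1], ![-1, -1, 1]}

/-- The vertices of a regular octahedron centred at the origin. -/
def octahedron : Set (Fin 3 → ℝ) :=
  {![1, 0, 0], ![-1, 0, 0], ![0, 1, 0], ![0, -1, 0], ![0, 0, 1], ![0, 0, -1]}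

/-- The twelve vertices `(0, ±1, ±φ)`, `(±1, ±φ, 0)`, `(±φ, 0, ±1)` of a regular icosahedron
centred at the origin, where `φ` is the golden ratio. -/
noncomputable def icosahedron : Set (Fin 3 → ℝ) :=
  {v | ∃ a b : ℝ, (a = 1 ∨ a = -1) ∧ (b = Real.goldenRatio ∨ b = -Real.goldenRatio) ∧
    (v = ![0, a, b] ∨ v = ![a, b, 0] ∨ v = ![b, 0, a])}

/-- The Schoenflies symbols of the finite symmetry groups in dimension `3`.  The argument is the
subscript, so that `S m` is `𝒮_m`, which is used for even `m` only. -/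
inductive Schoenflies : Type
  | Cs
  | Ci
  | C (n : ℕ)
  | Cv (n : ℕ)
  | Ch (n : ℕ)
  | D (n : ℕ)
  | Dh (n : ℕ)
  | Dd (n : ℕ)
  | S (m : ℕ)
  | T
  | Td
  | Th
  | O
  | Oh
  | I
  | Ih

/-- The group with the given Schoenflies symbol, in a standard position: the main axis is the
`z`-axis, the horizontal half-turn axis of the dihedral groups is the `x`-axis, and the vertical
mirror of `𝒞_{nv}` is the plane `x = 0`.  Subscripts are meant to be positive. -/
noncomputable def Schoenflies.group : Schoenflies → Subgroup O3
  | .Cs => Subgroup.closure {reflZ}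
  | .Ci => Subgroup.closure {inversion}
  | .C n => Subgroup.closure {rotZ (2 * Real.pi / n)}
  | .Cv n => Subgroup.closure {rotZ (2 * Real.pi / n), reflVert (Real.pi / 2)}
  | .Ch n => Subgroup.closure {rotZ (2 * Real.pi / n), reflZ}
  | .D n => Subgroup.closure {rotZ (2 * Real.pi / n), halfTurnX}
  | .Dh n => Subgroup.closure {rotZ (2 * Real.pi / n), halfTurnX, reflZ}
  | .Dd n => Subgroup.closure
      {rotZ (2 * Real.pi / n), halfTurnX, reflVert (Real.pi / (2 * n))}
  | .S m => Subgroup.closure {reflZ * rotZ (2 * Real.pi / m)}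
  | .T => setSymmetries tetrahedron ⊓ rotations
  | .Td => setSymmetries tetrahedron
  | .Th => (setSymmetries tetrahedron ⊓ rotations) ⊔ Subgroup.closure {reflZ}
  | .O => setSymmetries octahedron ⊓ rotations
  | .Oh => setSymmetries octahedron
  | .I => setSymmetries icosahedron ⊓ rotations
  | .Ih => setSymmetries icosahedron

/-- The list of pairings `𝒢 ↠ ℋ` of Schoenflies symbols. -/
inductive ListedPairing : Schoenflies → Schoenflies → Prop
  | C1_Ci : ListedPairing (.C 1) .Ci
  | Cs_C2h : ListedPairing .Cs (.Ch 2)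
  | C_odd (n : ℕ) (hn : Odd n) : ListedPairing (.C n) (.S (2 * n))
  | C_even (n : ℕ) (h0 : 0 < n) (hn : Even n) : ListedPairing (.C n) (.Ch n)
  | Cv_odd (n : ℕ) (hn : Odd n) : ListedPairing (.Cv n) (.Dd n)
  | Cv_even (n : ℕ) (h0 : 0 < n) (hn : Even n) : ListedPairing (.Cv n) (.Dh n)
  | Ch_odd (n : ℕ) (hn : Odd n) : ListedPairing (.Ch n) (.Ch (2 * n))
  | S_even (n : ℕ) (h0 : 0 < n) (hn : Even n) : ListedPairing (.S (2 * n)) (.Ch (2 * n))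
  | D_odd (n : ℕ) (hn : Odd n) : ListedPairing (.D n) (.Dd n)
  | D_even (n : ℕ) (h0 : 0 < n) (hn : Even n) : ListedPairing (.D n) (.Dh n)
  | Dh_odd (n : ℕ) (hn : Odd n) : ListedPairing (.Dh n) (.Dh (2 * n))
  | Dd_even (n : ℕ) (h0 : 0 < n) (hn : Even n) : ListedPairing (.Dd n) (.Dh (2 * n))
  | T_Th : ListedPairing .T .Th
  | Td_Oh : ListedPairing .Td .Oh
  | O_Oh : ListedPairing .O .Oh
  | I_Ih : ListedPairing .I .Ih

/-- The pair of groups `(𝒢, ℋ)` is one of the listed pairings, up to one common orthogonal change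
of coordinates. -/
def IsListedPairing (𝒢 ℋ : Subgroup O3) : Prop :=
  ∃ s t : Schoenflies, ListedPairing s t ∧ ∃ g : O3,
    𝒢 = s.group.map (MulAut.conj g).toMonoidHom ∧
    ℋ = t.group.map (MulAut.conj g).toMonoidHom

/-! ### Symmetric frameworks on the sphere -/

/-- A `Γ`-symmetric framework on `𝕊²` with vertex set `V`, with respect to an action `θ` of `Γ` on
the graph that is free on the vertices, and to `τ : Γ → O(ℝ³)`.  The points span `ℝ³`. -/
structure SymFramework (V Γ : Type*) [Group Γ] where
  graph : SimpleGraph V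
  θ : Γ →* (graph ≃g graph)
  θ_free : ∀ (γ : Γ) (i : V), θ γ i = i → γ = 1
  τ : Γ →* O3
  p : V → Fin 3 → ℝ
  mem_sphere : ∀ i, p i ⬝ᵥ p i = 1
  span_eq_top : Submodule.span ℝ (Set.range p) = ⊤
  symmetric : ∀ (γ : Γ) (i : V), (τ γ : Matrix (Fin 3) (Fin 3) ℝ) *ᵥ p i = p (θ γ i)

namespace SymFramework

variable {V Γ : Type*} [Group Γ]

/-- Infinitesimal motions of a spherical framework. -/
def IsInfinitesimalMotion (F : SymFramework V Γ) (u : V → Fin 3 → ℝ) : Prop :=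
  (∀ i j, F.graph.Adj i j → F.p i ⬝ᵥ u j + F.p j ⬝ᵥ u i = 0) ∧ ∀ i, F.p i ⬝ᵥ u i = 0

/-- An assignment of velocities is trivial if it is induced by an infinitesimal rotation of `ℝ³`,
i.e. by a skew-symmetric matrix. -/
def IsTrivialMotion (F : SymFramework V Γ) (u : V → Fin 3 → ℝ) : Prop :=
  ∃ A : Matrix (Fin 3) (Fin 3) ℝ, Aᵀ = -A ∧ ∀ i, u i = A *ᵥ F.p i

/-- Velocities with the same symmetry as the framework. -/
def IsSymmetricMotion (F : SymFramework V Γ) (u : V → Fin 3 → ℝ) : Prop :=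
  ∀ (γ : Γ) (i : V), (F.τ γ : Matrix (Fin 3) (Fin 3) ℝ) *ᵥ u i = u (F.θ γ i)

/-- Forced `Γ`-symmetric infinitesimal rigidity. -/
def ForcedRigid (F : SymFramework V Γ) : Prop :=
  ∀ u : V → Fin 3 → ℝ, F.IsInfinitesimalMotion u → F.IsSymmetricMotion u → F.IsTrivialMotion u

/-- The symmetry group `τ(Γ)` does not contain the inversion. -/
def InversionFree (F : SymFramework V Γ) : Prop :=
  inversion ∉ F.τ.range

end SymFramework

/-- `F'` is the double cover of `F`: the framework `(G', p')` is the disjoint union of `(G, p)` and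
its antipodal copy `(G, -p)`, and `Γ'` consists of (a copy of) `Γ`, acting on both copies as before,
together with the products of its elements with one element `ι`, which interchanges corresponding
vertices of the two copies and acts on `ℝ³` as the inversion. -/
def IsDoubleCover {V Γ Γ' : Type*} [Group Γ] [Group Γ']
    (F : SymFramework V Γ) (F' : SymFramework (V ⊕ V) Γ') : Prop :=
  F'.graph = F.graph.sum F.graph ∧
  (∀ i, F'.p (Sum.inl i) = F.p i) ∧
  (∀ i, F'.p (Sum.inr i) = -F.p i) ∧
  ∃ (j : Γ →* Γ') (ι : Γ'),
    (∀ γ i, F'.θ (j γ) (Sum.inl i) = Sum.inl (F.θ γ i)) ∧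
    (∀ γ i, F'.θ (j γ) (Sum.inr i) = Sum.inr (F.θ γ i)) ∧
    (∀ γ, F'.τ (j γ) = F.τ γ) ∧
    (∀ i, F'.θ ι (Sum.inl i) = Sum.inr i) ∧
    (∀ i, F'.θ ι (Sum.inr i) = Sum.inl i) ∧
    F'.τ ι = inversion ∧
    ∀ g : Γ', ∃ γ, g = j γ ∨ g = ι * j γ

/-- The relation `𝒢 ↠ ℋ` for subgroups of `O(ℝ³)`: there are abstract groups `Γ ≅ 𝒢` and `Γ' ≅ ℋ`,
and a finite `Γ`-symmetric framework with `τ(Γ) = 𝒢`, where `𝒢` does not contain the inversion,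
which has a `Γ'`-symmetric double cover with `τ'(Γ') = ℋ`. -/
def DoubleCoverPairing (𝒢 ℋ : Subgroup O3) : Prop :=
  ∃ (V Γ Γ' : Type) (_ : Finite V) (_ : Group Γ) (_ : Group Γ')
    (F : SymFramework V Γ) (F' : SymFramework (V ⊕ V) Γ'),
    Function.Injective F.τ ∧ F.τ.range = 𝒢 ∧ F.InversionFree ∧
    Function.Injective F'.τ ∧ F'.τ.range = ℋ ∧ IsDoubleCover F F'

/-! ### The action of the orthogonal group on `ℝ³` -/

/-! In a double cover `Γ' = j(Γ) ∪ ι j(Γ)` and `ι` acts as `-1`, so the image of `τ'` is `G ∪ -G`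
for `G = τ(Γ)`; this group is `withInversion G`. A free action on a finite nonempty vertex set makes
`G` finite. Conversely, a finite `G` without `-1` acts on the edgeless `orbitFramework G`, whose
`doubleCover` realizes `G ∪ -G`. So the pairing relation is a statement about groups only
(`doubleCoverPairing_iff`). What remains is to classify the finite `G` avoiding `-1`, and to check
for each row of the list that the second group is generated by the first and `-1`
(`ListedPairing.properties`).

For the classification put `K = (G ∪ -G) ∩ SO(3)`. Since `-1 ∉ G`, exactly one of `k`, `-k` lies in
`G` for each `k ∈ K`, so `G` amounts to `K` together with a sign character. Up to conjugation `K` is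
`C_n`, `D_n`, `T`, `O` or `I`, and the possible signs of generators are run through: a negative
rotation generator forces `n` to be even and gives `S`, `Ch`, `Dh` or `Dd`, a negative half-turn
gives `Cv`, `O` has one nontrivial sign character (giving `Td`), and `T` and `I` have none.
`eq_of_le_of_le_withInversion` turns signs of generators into an equality of groups.

The finite rotation groups are found by counting poles. Burnside's formula yields a pole whose
stabilizer order `n` satisfies `|K| = n`, `|K| = 2n`, or `(|K|, n)` is `(12, 3)`, `(24, 4)` or `(60,
5)` (`exists_pole`). With this pole moved to the north, its stabilizer is `C_n` and acts freely on
the orbit points off the axis. In the polyhedral cases this determines the heights of these points,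
hence the inner products; the orbit is identified with the vertices of a regular solid, and a
comparison of orders identifies `K` (`conjSubgroup_eq_of_orbit`).

Rigidity transfers because invariance under `ι` forces opposite velocities on antipodal points:
symmetric motions of the framework and of its cover correspond, and the same skew matrix certifies
triviality on both sides (`IsDoubleCover.forcedRigid_iff`). -/

theorem O3.smul_def (g : O3) (v : Fin 3 → ℝ) :
    g • v = (g : Matrix (Fin 3) (Fin 3) ℝ) *ᵥ v := rfl

/-- The `z`-axis. -/
def zAxis : Fin 3 → ℝ := ![0, 0, 1]

theorem O3.neg_smul (g : O3) (v : Fin 3 → ℝ) : (-g) • v = -(g • v) := by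
  change (-(g : Matrix (Fin 3) (Fin 3) ℝ)) *ᵥ v = -((g : Matrix (Fin 3) (Fin 3) ℝ) *ᵥ v)
  exact Matrix.neg_mulVec _ _

theorem O3.dotProduct_smul_smul (g : O3) (v w : Fin 3 → ℝ) :
    (g • v) ⬝ᵥ (g • w) = v ⬝ᵥ w := by
  rw [O3.smul_def, O3.smul_def, Matrix.dotProduct_mulVec, Matrix.vecMul_mulVec,
    (Matrix.mem_orthogonalGroup_iff' _ _).1 g.2, Matrix.vecMul_one]

theorem O3.eq_of_smul_eq {g h : O3} (H : ∀ v : Fin 3 → ℝ, g • v = h • v) : g = h := by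
  apply Subtype.ext
  ext i j
  have := congrFun (H (Pi.single j 1)) i
  simpa [O3.smul_def] using this

theorem inversion_eq : inversion = -1 := rfl

theorem mem_rotations {g : O3} :
    g ∈ rotations ↔ (g : Matrix (Fin 3) (Fin 3) ℝ).det = 1 := Iff.rfl

theorem O3.det_eq (g : O3) :
    (g : Matrix (Fin 3) (Fin 3) ℝ).det = 1 ∨ (g : Matrix (Fin 3) (Fin 3) ℝ).det = -1 := by
  have h := congrArg Matrix.det ((Matrix.mem_orthogonalGroup_iff' _ _).1 g.2)
  rw [Matrix.det_mul, Matrix.det_transpose, Matrix.det_one] at h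
  exact mul_self_eq_one_iff.1 h

theorem O3.det_neg (g : O3) : ((-g : O3) : Matrix (Fin 3) (Fin 3) ℝ).det =
    -(g : Matrix (Fin 3) (Fin 3) ℝ).det := by
  change (-(g : Matrix (Fin 3) (Fin 3) ℝ)).det = _
  rw [Matrix.det_neg]
  norm_num

/-- The dimension is odd, so `-1` has determinant `-1` and `O(3) = SO(3) × {±1}`. Every group is
compared with a group of rotations through this splitting. -/
theorem mem_or_neg_mem_rotations (g : O3) : g ∈ rotations ∨ -g ∈ rotations := by
  rw [mem_rotations, mem_rotations, O3.det_neg]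
  rcases g.det_eq with h | h <;> simp [h]

theorem neg_notMem_rotations {g : O3} (hg : g ∈ rotations) : -g ∉ rotations := by
  rw [mem_rotations] at *
  rw [O3.det_neg, hg]
  norm_num

/-! ### Standard elements -/

theorem O3.ext_entries {g h : O3} (H : ∀ i j, g i j = h i j) : g = h := by
  apply Subtype.ext
  ext i j
  exact H i j

theorem rotZ_add (a b : ℝ) : rotZ (a + b) = rotZ a * rotZ b := by
  apply Subtype.ext
  ext i j
  fin_cases i <;> fin_cases j <;>
    simp [rotZ, Real.cos_add, Real.sin_add] <;> ring

theorem rotZ_zero : rotZ 0 = 1 := by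
  apply Subtype.ext
  ext i j
  fin_cases i <;> fin_cases j <;> simp [rotZ]

theorem rotZ_neg (a : ℝ) : rotZ (-a) = (rotZ a)⁻¹ := by
  rw [eq_inv_iff_mul_eq_one, ← rotZ_add, neg_add_cancel, rotZ_zero]

theorem rotZ_eq_of_cos_sin {a b : ℝ} (hc : Real.cos a = Real.cos b)
    (hs : Real.sin a = Real.sin b) : rotZ a = rotZ b := by
  apply Subtype.ext
  simp [rotZ, hc, hs]

theorem rotZ_int_two_pi (k : ℤ) : rotZ (k * (2 * Real.pi)) = 1 := by
  rw [← rotZ_zero]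
  apply rotZ_eq_of_cos_sin
  · rw [Real.cos_int_mul_two_pi, Real.cos_zero]
  · have := Real.sin_int_mul_pi (2 * k)
    push_cast at this
    rw [Real.sin_zero, ← this]
    ring_nf

theorem rotZ_zpow (a : ℝ) (k : ℤ) : rotZ a ^ k = rotZ (k * a) := by
  induction k using Int.induction_on with
  | zero => simp [rotZ_zero]
  | succ n ih =>
    rw [zpow_add_one, ih, ← rotZ_add]
    push_cast
    ring_nf
  | pred n ih =>
    rw [zpow_sub_one, ih, ← rotZ_neg, ← rotZ_add]
    push_cast
    ring_nf

theorem rotZ_pow (a : ℝ) (k : ℕ) : rotZ a ^ k = rotZ (k * a) := by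
  exact_mod_cast rotZ_zpow a k

theorem halfTurnX_mul_self : halfTurnX * halfTurnX = 1 := by
  apply Subtype.ext
  ext i j
  fin_cases i <;> fin_cases j <;> simp [halfTurnX]

theorem halfTurnX_mul_rotZ (a : ℝ) : halfTurnX * rotZ a = rotZ (-a) * halfTurnX := by
  apply Subtype.ext
  ext i j
  fin_cases i <;> fin_cases j <;>
    simp [halfTurnX, rotZ]

/-- Improper generators are rewritten as minus a rotation, so that all computations in the axial
groups involve only `rotZ`, `halfTurnX` and signs. -/
theorem reflZ_eq : reflZ = -rotZ Real.pi := by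
  apply Subtype.ext
  change _ = -(rotZ Real.pi : Matrix (Fin 3) (Fin 3) ℝ)
  ext i j
  fin_cases i <;> fin_cases j <;> simp [reflZ, rotZ]

theorem reflVert_eq (a : ℝ) : reflVert a = -(rotZ (2 * a + Real.pi) * halfTurnX) := by
  apply Subtype.ext
  change _ = -((rotZ (2 * a + Real.pi) : Matrix (Fin 3) (Fin 3) ℝ) * halfTurnX)
  ext i j
  fin_cases i <;> fin_cases j <;>
    simp [reflVert, rotZ, halfTurnX]

theorem rotZ_mem_rotations (a : ℝ) : rotZ a ∈ rotations := by
  rw [mem_rotations, rotZ, Matrix.det_fin_three]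
  have := Real.sin_sq_add_cos_sq a
  simp
  nlinarith

theorem halfTurnX_mem_rotations : halfTurnX ∈ rotations := by
  rw [mem_rotations, halfTurnX, Matrix.det_fin_three]
  simp

theorem rotZ_smul (a : ℝ) (v : Fin 3 → ℝ) : rotZ a • v =
    ![Real.cos a * v 0 - Real.sin a * v 1, Real.sin a * v 0 + Real.cos a * v 1, v 2] := by
  ext i
  fin_cases i <;> simp [rotZ, Matrix.mulVec, dotProduct, Fin.sum_univ_three] <;> ring

theorem halfTurnX_smul (v : Fin 3 → ℝ) : halfTurnX • v = ![v 0, -v 1, -v 2] := by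
  ext i
  fin_cases i <;> simp [halfTurnX, Matrix.mulVec, dotProduct, Fin.sum_univ_three]

/-! ### Fixed vectors of rotations -/

theorem exists_cos_sin_eq {x y : ℝ} (h : x * x + y * y = 1) :
    ∃ a, Real.cos a = x ∧ Real.sin a = y := by
  have hn : ‖(⟨x, y⟩ : ℂ)‖ = 1 := by
    rw [Complex.norm_def, Complex.normSq_mk, Real.sqrt_eq_one]
    exact h
  refine ⟨Complex.arg ⟨x, y⟩, ?_, ?_⟩
  · rw [Complex.cos_arg (by intro h0; simp [h0] at hn), hn]
    simp
  · rw [Complex.sin_arg, hn]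
    simp

/-- The third column is `e₃`; orthogonality of the columns clears the third row, and the remaining
block lies in `SO(2)`. -/
theorem exists_rotZ_of_smul_eq {g : O3} (hg : g ∈ rotations) (h : g • zAxis = zAxis) :
    ∃ a, g = rotZ a := by
  rw [mem_rotations, Matrix.det_fin_three] at hg
  have ho := (Matrix.mem_orthogonalGroup_iff' _ _).1 g.2
  have e1 : (g : Matrix (Fin 3) (Fin 3) ℝ) 0 2 = 0 := by
    simpa [O3.smul_def, zAxis, Matrix.mulVec, dotProduct, Fin.sum_univ_three] using congrFun h 0
  have e2 : (g : Matrix (Fin 3) (Fin 3) ℝ) 1 2 = 0 := by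
    simpa [O3.smul_def, zAxis, Matrix.mulVec, dotProduct, Fin.sum_univ_three] using congrFun h 1
  have e3 : (g : Matrix (Fin 3) (Fin 3) ℝ) 2 2 = 1 := by
    simpa [O3.smul_def, zAxis, Matrix.mulVec, dotProduct, Fin.sum_univ_three] using congrFun h 2
  have o00 := congrFun (congrFun ho 0) 0
  have o01 := congrFun (congrFun ho 0) 1
  have o02 := congrFun (congrFun ho 0) 2
  have o12 := congrFun (congrFun ho 1) 2
  simp [Matrix.mul_apply, Fin.sum_univ_three, e1, e2, e3] at o00 o01 o02 o12
  simp [e1, e2, e3] at hg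
  simp only [o02, o12, mul_zero, add_zero] at o00 o01
  obtain ⟨a, ha, hb⟩ := exists_cos_sin_eq o00
  refine ⟨a, O3.ext_entries fun i j => ?_⟩
  fin_cases i <;> fin_cases j <;> simp [rotZ, ha, hb, e1, e2, e3, o02, o12]
  -- The second column of the block follows from its orthogonality to the first and from the
  -- determinant.
  · linear_combination g 0 0 * o01 - g 0 1 * o00 - g 1 0 * hg
  · linear_combination g 1 0 * o01 + g 0 0 * hg - g 1 1 * o00

theorem exists_rotZ_mul_halfTurnX {g : O3} (hg : g ∈ rotations)
    (h : g • zAxis = -zAxis) : ∃ a, g = rotZ a * halfTurnX := by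
  obtain ⟨a, ha⟩ := exists_rotZ_of_smul_eq (g := g * halfTurnX)
    (mul_mem hg halfTurnX_mem_rotations) (by
      rw [mul_smul, halfTurnX_smul]
      have : ![zAxis 0, -zAxis 1, -zAxis 2] = -zAxis := by
        ext i; fin_cases i <;> simp [zAxis]
      rw [this, smul_neg, h, neg_neg])
  exact ⟨a, by rw [← ha, mul_assoc, halfTurnX_mul_self, mul_one]⟩

/-- Every unit vector can be moved to the north pole. -/
theorem exists_smul_eq_north {v : Fin 3 → ℝ} (hv : v ⬝ᵥ v = 1) :
    ∃ Q : O3, Q • v = zAxis := by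
  simp only [dotProduct, Fin.sum_univ_three] at hv
  by_cases h : v 2 = 1
  · refine ⟨1, ?_⟩
    rw [one_smul]
    have h0 : v 0 = 0 := by nlinarith [sq_nonneg (v 0), sq_nonneg (v 1)]
    have h1 : v 1 = 0 := by nlinarith [sq_nonneg (v 0), sq_nonneg (v 1)]
    ext i; fin_cases i <;> simp [zAxis, h, h0, h1]
  · have h' : 1 - v 2 ≠ 0 := fun h0 => h (by linarith)
    -- This is the Householder reflection interchanging `v` and the north pole; its denominator `1 -
    -- v 2` vanishes only in the case treated above.
    refine ⟨⟨!![1 - v 0 * v 0 / (1 - v 2), - (v 0 * v 1 / (1 - v 2)), v 0;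
      - (v 0 * v 1 / (1 - v 2)), 1 - v 1 * v 1 / (1 - v 2), v 1; v 0, v 1, v 2], ?_⟩, ?_⟩
    · rw [Matrix.mem_orthogonalGroup_iff]
      have e : v 0 * v 0 = 1 - v 1 * v 1 - v 2 * v 2 := by linarith
      have e' : v 0 ^ 2 = 1 - v 1 * v 1 - v 2 * v 2 := by linarith [sq (v 0)]
      ext i j
      fin_cases i <;> fin_cases j <;>
        simp [Matrix.mul_apply, Fin.sum_univ_three] <;> field_simp <;> grind
    · ext i
      fin_cases i <;> simp [zAxis, Matrix.mulVec, dotProduct, Fin.sum_univ_three]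
        <;> field_simp <;> grind

/-- From `g - 1 = g (1 - g)ᵀ` and `det g = 1` one gets `det (g - 1) = det (1 - g)`, which is `-det
(g - 1)` in dimension three. So `1` is an eigenvalue. -/
theorem exists_unit_fixed {g : O3} (hg : g ∈ rotations) :
    ∃ v : Fin 3 → ℝ, v ⬝ᵥ v = 1 ∧ g • v = v := by
  have hdet : ((g : Matrix (Fin 3) (Fin 3) ℝ) - 1).det = 0 := by
    have h1 : (g : Matrix (Fin 3) (Fin 3) ℝ) - 1 =
        (g : Matrix (Fin 3) (Fin 3) ℝ) * (1 - (g : Matrix (Fin 3) (Fin 3) ℝ))ᵀ := by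
      rw [Matrix.transpose_sub, Matrix.mul_sub, (Matrix.mem_orthogonalGroup_iff _ _).1 g.2]
      simp
    have h2 := congrArg Matrix.det h1
    rw [Matrix.det_mul, Matrix.det_transpose, mem_rotations.1 hg, ← neg_sub, Matrix.det_neg] at h2
    rw [← neg_sub, Matrix.det_neg]
    norm_num at h2 ⊢
    linarith
  obtain ⟨v, hv0, hv⟩ := Matrix.exists_mulVec_eq_zero_iff.2 hdet
  have hgv : g • v = v := by
    rw [Matrix.sub_mulVec, Matrix.one_mulVec, sub_eq_zero] at hv
    exact hv
  have hpos : 0 < v ⬝ᵥ v := by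
    refine lt_of_le_of_ne ?_ fun h => hv0 (dotProduct_self_eq_zero.1 h.symm)
    exact Finset.sum_nonneg fun i _ => mul_self_nonneg _
  refine ⟨(Real.sqrt (v ⬝ᵥ v))⁻¹ • v, ?_, by rw [smul_comm, hgv]⟩
  rw [smul_dotProduct, dotProduct_smul, smul_eq_mul, smul_eq_mul, ← mul_assoc, ← mul_inv,
    Real.mul_self_sqrt hpos.le, inv_mul_cancel₀ hpos.ne']

theorem conj_mem_rotations {k : O3} (Q : O3) (hk : k ∈ rotations) : Q * k * Q⁻¹ ∈ rotations :=
  MonoidHom.normal_ker _ |>.conj_mem k hk Q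

/-- A rotation with two independent fixed vectors is the identity. -/
theorem eq_one_of_fixed {g : O3} (hg : g ∈ rotations) {v w : Fin 3 → ℝ} (hv : v ⬝ᵥ v = 1)
    (hw : w ⬝ᵥ w = 1) (h1 : w ≠ v) (h2 : w ≠ -v) (hgv : g • v = v) (hgw : g • w = w) : g = 1 := by
  obtain ⟨Q, hQ⟩ := exists_smul_eq_north hv
  have hv' : v = Q⁻¹ • zAxis := (smul_eq_iff_eq_inv_smul _).1 hQ
  obtain ⟨a, ha⟩ := exists_rotZ_of_smul_eq (conj_mem_rotations Q hg) (by
    rw [mul_smul, mul_smul, ← hv', hgv, hQ])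
  have hu : (Q * g * Q⁻¹) • (Q • w) = Q • w := by
    rw [mul_smul, inv_smul_smul, mul_smul, hgw]
  have huu : (Q • w) ⬝ᵥ (Q • w) = 1 := by rw [O3.dotProduct_smul_smul, hw]
  have n1 : Q • w ≠ zAxis := fun h => h1 (by rw [hv', ← h, inv_smul_smul])
  have n2 : Q • w ≠ -zAxis := fun h => h2 (by rw [hv', ← smul_neg, ← h, inv_smul_smul])
  generalize Q • w = u at *
  rw [ha, rotZ_smul] at hu
  have e0 := congrFun hu 0
  have e1 := congrFun hu 1
  simp at e0 e1
  simp only [dotProduct, Fin.sum_univ_three] at huu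
  have hs := Real.sin_sq_add_cos_sq a
  have hcos : Real.cos a = 1 := by
    by_contra hc
    -- Off the trivial angle a fixed vector has no horizontal part, so it would be one of the two
    -- poles excluded by `n1` and `n2`.
    have hz : (1 - Real.cos a) * (u 0 * u 0 + u 1 * u 1) = 0 := by
      linear_combination -u 0 * e0 - u 1 * e1
    have hz' : u 0 * u 0 + u 1 * u 1 = 0 := by
      rcases mul_eq_zero.1 hz with h | h
      · exact absurd (by linarith) hc
      · exact h
    have z0 : u 0 = 0 := by nlinarith [mul_self_nonneg (u 0), mul_self_nonneg (u 1)]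
    have z1 : u 1 = 0 := by nlinarith [mul_self_nonneg (u 0), mul_self_nonneg (u 1)]
    have z2 : u 2 = 1 ∨ u 2 = -1 := mul_self_eq_one_iff.1 (by linarith)
    rcases z2 with z2 | z2
    · exact n1 (by ext i; fin_cases i <;> simp [zAxis, z0, z1, z2])
    · exact n2 (by ext i; fin_cases i <;> simp [zAxis, z0, z1, z2])
  have hsin : Real.sin a = 0 := by
    rw [hcos] at hs
    nlinarith
  have : Q * g * Q⁻¹ = 1 := by
    rw [ha, ← rotZ_zero]
    exact rotZ_eq_of_cos_sin (by simp [hcos]) (by simp [hsin])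
  rw [mul_inv_eq_one] at this
  exact mul_eq_left.1 this

/-- Two bases with the same Gram matrix differ by an orthogonal map. -/
theorem exists_smul_eq_of_gram {x y : Fin 3 → Fin 3 → ℝ} (hdet : (Matrix.of y).det ≠ 0)
    (h : ∀ i j, x i ⬝ᵥ x j = y i ⬝ᵥ y j) : ∃ g : O3, ∀ i, g • x i = y i := by
  set X : Matrix (Fin 3) (Fin 3) ℝ := (Matrix.of x)ᵀ with hX
  set Y : Matrix (Fin 3) (Fin 3) ℝ := (Matrix.of y)ᵀ with hY
  have hG : Xᵀ * X = Yᵀ * Y := by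
    ext i j
    exact h i j
  have hYd : Y.det ≠ 0 := by rwa [hY, Matrix.det_transpose]
  have hXd : X.det ≠ 0 := by
    intro h0
    have := congrArg Matrix.det hG
    rw [Matrix.det_mul, Matrix.det_mul, Matrix.det_transpose, Matrix.det_transpose Y, h0] at this
    apply hYd
    simpa using this.symm
  have hXu : IsUnit X.det := hXd.isUnit
  refine ⟨⟨Y * X⁻¹, ?_⟩, fun i => ?_⟩
  · rw [Matrix.mem_orthogonalGroup_iff']
    change (Y * X⁻¹)ᵀ * (Y * X⁻¹) = 1
    rw [Matrix.transpose_mul, Matrix.mul_assoc, ← Matrix.mul_assoc Yᵀ, ← hG, Matrix.mul_assoc,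
      Matrix.mul_nonsing_inv _ hXu, Matrix.mul_one, ← Matrix.transpose_mul,
      Matrix.mul_nonsing_inv _ hXu, Matrix.transpose_one]
  · have : (Y * X⁻¹) * X = Y := by
      rw [Matrix.mul_assoc, Matrix.nonsing_inv_mul _ hXu, Matrix.mul_one]
    ext j
    exact congrFun (congrFun this j) i

/-! ### Adjoining the inversion to a group -/

/-- The subgroup generated by `G` and the inversion. -/
def withInversion (G : Subgroup O3) : Subgroup O3 where
  carrier := {x | x ∈ G ∨ -x ∈ G}
  one_mem' := Or.inl G.one_mem
  mul_mem' := by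
    rintro a b (ha | ha) (hb | hb)
    · exact Or.inl (mul_mem ha hb)
    · exact Or.inr (by rw [← mul_neg]; exact mul_mem ha hb)
    · exact Or.inr (by rw [← neg_mul]; exact mul_mem ha hb)
    · exact Or.inl (by rw [← neg_mul_neg]; exact mul_mem ha hb)
  inv_mem' := by
    rintro a (ha | ha)
    · exact Or.inl (inv_mem ha)
    · refine Or.inr ?_
      have : -a⁻¹ = (-a)⁻¹ := by
        rw [eq_inv_iff_mul_eq_one, neg_mul_neg, inv_mul_cancel]
      rw [this]
      exact inv_mem ha

theorem mem_withInversion {G : Subgroup O3} {x : O3} : x ∈ withInversion G ↔ x ∈ G ∨ -x ∈ G :=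
  Iff.rfl

theorem le_withInversion (G : Subgroup O3) : G ≤ withInversion G := fun _ h => Or.inl h

theorem neg_mem_withInversion {G : Subgroup O3} {x : O3} (h : x ∈ withInversion G) :
    -x ∈ withInversion G := by
  rcases h with h | h
  · exact Or.inr (by rwa [neg_neg])
  · exact Or.inl h

theorem withInversion_le {G H : Subgroup O3} (h : G ≤ H) (h1 : -1 ∈ H) : withInversion G ≤ H := by
  rintro x (hx | hx)
  · exact h hx
  · simpa using mul_mem h1 (h hx)

theorem neg_one_mem {G : Subgroup O3} {x : O3} (h : x ∈ G) (h' : -x ∈ G) : -1 ∈ G := by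
  have := mul_mem h' (inv_mem h)
  rwa [neg_mul, mul_inv_cancel] at this

/-- A group containing `-1` is determined by its rotations; this gives the rows for `O` and `I` at
once. -/
theorem withInversion_inf_rotations_of_le {G : Subgroup O3} (h1 : -1 ∈ G) :
    G = withInversion (G ⊓ rotations) := by
  refine le_antisymm (fun x hx => ?_) (withInversion_le inf_le_left h1)
  rcases mem_or_neg_mem_rotations x with h | h
  · exact Or.inl ⟨hx, h⟩
  · exact Or.inr ⟨by simpa using mul_mem h1 hx, h⟩

/-- The conjugate of a subgroup. -/
abbrev conjSubgroup (g : O3) (G : Subgroup O3) : Subgroup O3 :=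
  G.map (MulAut.conj g).toMonoidHom

theorem mem_conjSubgroup {g x : O3} {G : Subgroup O3} :
    x ∈ conjSubgroup g G ↔ g⁻¹ * x * g ∈ G := by
  constructor
  · rintro ⟨y, hy, rfl⟩
    simpa [mul_assoc] using hy
  · intro h
    exact ⟨_, h, by simp [mul_assoc]⟩

theorem withInversion_conjSubgroup (g : O3) (G : Subgroup O3) :
    withInversion (conjSubgroup g G) = conjSubgroup g (withInversion G) := by
  ext x
  simp only [mem_withInversion, mem_conjSubgroup, mul_neg, neg_mul]

theorem conjSubgroup_conjSubgroup (g h : O3) (G : Subgroup O3) :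
    conjSubgroup g (conjSubgroup h G) = conjSubgroup (g * h) G := by
  ext x
  simp only [mem_conjSubgroup, mul_inv_rev, mul_assoc]

theorem conjSubgroup_one (G : Subgroup O3) : conjSubgroup 1 G = G := by
  ext x
  simp

theorem conjSubgroup_le_rotations {g : O3} {G : Subgroup O3} (h : G ≤ rotations) :
    conjSubgroup g G ≤ rotations := by
  rintro _ ⟨y, hy, rfl⟩
  exact conj_mem_rotations g (h hy)

/-! ### Membership in the standard groups -/

theorem rotZ_mem {G : Subgroup O3} {a b : ℝ} (h : rotZ a ∈ G) (k l : ℤ)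
    (hb : b = k * a + l * (2 * Real.pi)) : rotZ b ∈ G := by
  rw [hb, rotZ_add, rotZ_int_two_pi, mul_one, ← rotZ_zpow]
  exact zpow_mem h k

theorem rotZ_eq_one (k : ℤ) {b : ℝ} (hb : b = k * (2 * Real.pi)) : rotZ b = 1 := by
  rw [hb, rotZ_int_two_pi]

theorem reflVert_pi_div_two : reflVert (Real.pi / 2) = -halfTurnX := by
  rw [reflVert_eq, rotZ_eq_one 1 (by push_cast; ring), one_mul]

theorem reflVert_pi_div (n : ℕ) :
    reflVert (Real.pi / (2 * n)) = -(rotZ (Real.pi / n + Real.pi) * halfTurnX) := by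
  rw [reflVert_eq]
  congr 3
  rcases eq_or_ne (n : ℝ) 0 with h | h
  · simp [h]
  · field_simp

theorem reflZ_mul_rotZ (a : ℝ) : reflZ * rotZ a = -rotZ (a + Real.pi) := by
  rw [reflZ_eq, neg_mul, ← rotZ_add, add_comm]

theorem closure_pair_le {G : Subgroup O3} {a b : O3} (ha : a ∈ G) (hb : b ∈ G) :
    Subgroup.closure {a, b} ≤ G := by
  rw [Subgroup.closure_le]
  rintro x (rfl | rfl)
  exacts [ha, hb]

theorem closure_triple_le {G : Subgroup O3} {a b c : O3} (ha : a ∈ G) (hb : b ∈ G) (hc : c ∈ G) :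
    Subgroup.closure {a, b, c} ≤ G := by
  rw [Subgroup.closure_le]
  rintro x (rfl | rfl | rfl)
  exacts [ha, hb, hc]

theorem closure_singleton_le {G : Subgroup O3} {a : O3} (ha : a ∈ G) :
    Subgroup.closure {a} ≤ G := by
  rw [Subgroup.closure_le]
  rintro x rfl
  exact ha

namespace Schoenflies

theorem rotZ_mem_C (n : ℕ) : rotZ (2 * Real.pi / n) ∈ (C n).group :=
  Subgroup.subset_closure (by simp)

theorem rotZ_mem_Cv (n : ℕ) : rotZ (2 * Real.pi / n) ∈ (Cv n).group :=
  Subgroup.subset_closure (by simp)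

theorem rotZ_mem_Ch (n : ℕ) : rotZ (2 * Real.pi / n) ∈ (Ch n).group :=
  Subgroup.subset_closure (by simp)

theorem rotZ_mem_D (n : ℕ) : rotZ (2 * Real.pi / n) ∈ (D n).group :=
  Subgroup.subset_closure (by simp)

theorem rotZ_mem_Dh (n : ℕ) : rotZ (2 * Real.pi / n) ∈ (Dh n).group :=
  Subgroup.subset_closure (by simp)

theorem rotZ_mem_Dd (n : ℕ) : rotZ (2 * Real.pi / n) ∈ (Dd n).group :=
  Subgroup.subset_closure (by simp)

theorem neg_halfTurnX_mem_Cv (n : ℕ) : -halfTurnX ∈ (Cv n).group := by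
  rw [← reflVert_pi_div_two]
  exact Subgroup.subset_closure (by simp)

theorem neg_rotZ_mem_Ch (n : ℕ) : -rotZ Real.pi ∈ (Ch n).group := by
  rw [← reflZ_eq]
  exact Subgroup.subset_closure (by simp)

theorem halfTurnX_mem_D (n : ℕ) : halfTurnX ∈ (D n).group :=
  Subgroup.subset_closure (by simp)

theorem halfTurnX_mem_Dh (n : ℕ) : halfTurnX ∈ (Dh n).group :=
  Subgroup.subset_closure (by simp)

theorem neg_rotZ_mem_Dh (n : ℕ) : -rotZ Real.pi ∈ (Dh n).group := by
  rw [← reflZ_eq]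
  exact Subgroup.subset_closure (by simp)

theorem halfTurnX_mem_Dd (n : ℕ) : halfTurnX ∈ (Dd n).group :=
  Subgroup.subset_closure (by simp)

/-- Multiplying the vertical mirror by the half-turn leaves the generator of `𝒮_{2n}`, so one parity
computation serves both families. -/
theorem neg_rotZ_mem_Dd (n : ℕ) : -rotZ (Real.pi / n + Real.pi) ∈ (Dd n).group := by
  have h : reflVert (Real.pi / (2 * n)) ∈ (Dd n).group := Subgroup.subset_closure (by simp)
  rw [reflVert_pi_div] at h
  simpa [neg_mul, mul_assoc, halfTurnX_mul_self] using mul_mem h (halfTurnX_mem_Dd n)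

theorem neg_rotZ_mem_S (n : ℕ) : -rotZ (Real.pi / n + Real.pi) ∈ (S (2 * n)).group := by
  have h : reflZ * rotZ (2 * Real.pi / (2 * n : ℕ)) ∈ (S (2 * n)).group :=
    Subgroup.subset_closure (by simp)
  rw [reflZ_mul_rotZ] at h
  push_cast at h
  rwa [mul_div_mul_left _ _ two_ne_zero] at h

theorem Cs_le {G : Subgroup O3} (h : -rotZ Real.pi ∈ G) : Cs.group ≤ G :=
  closure_singleton_le (by rwa [reflZ_eq])

theorem C_le {n : ℕ} {G : Subgroup O3} (h : rotZ (2 * Real.pi / n) ∈ G) : (C n).group ≤ G :=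
  closure_singleton_le h

theorem Cv_le {n : ℕ} {G : Subgroup O3} (h : rotZ (2 * Real.pi / n) ∈ G) (h' : -halfTurnX ∈ G) :
    (Cv n).group ≤ G :=
  closure_pair_le h (by rwa [reflVert_pi_div_two])

theorem Ch_le {n : ℕ} {G : Subgroup O3} (h : rotZ (2 * Real.pi / n) ∈ G)
    (h' : -rotZ Real.pi ∈ G) : (Ch n).group ≤ G :=
  closure_pair_le h (by rwa [reflZ_eq])

theorem D_le {n : ℕ} {G : Subgroup O3} (h : rotZ (2 * Real.pi / n) ∈ G) (h' : halfTurnX ∈ G) :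
    (D n).group ≤ G :=
  closure_pair_le h h'

theorem Dh_le {n : ℕ} {G : Subgroup O3} (h : rotZ (2 * Real.pi / n) ∈ G) (h' : halfTurnX ∈ G)
    (h'' : -rotZ Real.pi ∈ G) : (Dh n).group ≤ G :=
  closure_triple_le h h' (by rwa [reflZ_eq])

theorem Dd_le {n : ℕ} {G : Subgroup O3} (h : rotZ (2 * Real.pi / n) ∈ G) (h' : halfTurnX ∈ G)
    (h'' : -rotZ (Real.pi / n + Real.pi) ∈ G) : (Dd n).group ≤ G :=
  closure_triple_le h h' (by rw [reflVert_pi_div, ← neg_mul]; exact mul_mem h'' h')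

theorem S_le {n : ℕ} {G : Subgroup O3} (h : -rotZ (Real.pi / n + Real.pi) ∈ G) :
    (S (2 * n)).group ≤ G :=
  closure_singleton_le (by
    rw [reflZ_mul_rotZ]
    push_cast
    rwa [mul_div_mul_left _ _ two_ne_zero])

end Schoenflies

/-- Odd powers of minus a rotation keep the sign and even powers lose it. The parity of the multiple
`k` thus decides between this lemma and the next. -/
theorem neg_mem_iff_of_rotZ {G : Subgroup O3} {a b : ℝ} (h : -rotZ a ∈ G) (k l : ℤ) (hk : Odd k)
    (hb : b = k * a + l * (2 * Real.pi)) : -rotZ b ∈ G := by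
  rw [hb, rotZ_add, rotZ_int_two_pi, mul_one, ← rotZ_zpow, ← hk.neg_zpow]
  exact zpow_mem h k

theorem rotZ_mem_of_neg {G : Subgroup O3} {a b : ℝ} (h : -rotZ a ∈ G) (k l : ℤ) (hk : Even k)
    (hb : b = k * a + l * (2 * Real.pi)) : rotZ b ∈ G := by
  rw [hb, rotZ_add, rotZ_int_two_pi, mul_one, ← rotZ_zpow, ← hk.neg_zpow]
  exact zpow_mem h k

/-! ### Symmetries of finite sets -/

theorem mem_setSymmetries {S : Set (Fin 3 → ℝ)} {g : O3} :
    g ∈ setSymmetries S ↔ ∀ v, g • v ∈ S ↔ v ∈ S := Iff.rfl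

/-- An injective self-map of a finite set is onto, so only the forward inclusion has to be checked.
-/
theorem mem_setSymmetries_of_finite {S : Set (Fin 3 → ℝ)} (hS : S.Finite) {g : O3}
    (h : ∀ v ∈ S, g • v ∈ S) : g ∈ setSymmetries S := by
  refine mem_setSymmetries.2 fun v => ⟨fun hv => ?_, h v⟩
  have himage : (fun v => g • v) '' S = S :=
    Set.eq_of_subset_of_ncard_le (Set.image_subset_iff.2 h)
      (Set.ncard_image_of_injective _ (MulAction.injective g)).ge hS
  obtain ⟨w, hw, hwv⟩ := himage.ge hv
  exact MulAction.injective g hwv ▸ hw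

theorem O3.eq_of_smul_basis {x : Fin 3 → Fin 3 → ℝ} (hdet : (Matrix.of x).det ≠ 0) {g h : O3}
    (H : ∀ i, g • x i = h • x i) : g = h := by
  have hu : IsUnit ((Matrix.of x)ᵀ).det := by
    rw [Matrix.det_transpose]
    exact hdet.isUnit
  apply Subtype.ext
  have h1 : (g : Matrix (Fin 3) (Fin 3) ℝ) * (Matrix.of x)ᵀ =
      (h : Matrix (Fin 3) (Fin 3) ℝ) * (Matrix.of x)ᵀ := by
    ext i j
    exact congrFun (H j) i
  exact ((Matrix.isUnit_iff_isUnit_det _).2 hu).mul_left_injective h1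

/-- A symmetry is determined by the images of three independent points, for which there are finitely
many choices. -/
theorem finite_setSymmetries {S : Set (Fin 3 → ℝ)} (hS : S.Finite) {x : Fin 3 → Fin 3 → ℝ}
    (hx : ∀ i, x i ∈ S) (hdet : (Matrix.of x).det ≠ 0) : Finite (setSymmetries S) := by
  have : Finite S := hS
  refine Finite.of_injective
    (fun (g : setSymmetries S) (i : Fin 3) => (⟨(g : O3) • x i, (g.2 (x i)).2 (hx i)⟩ : S)) ?_
  intro g h hgh
  apply Subtype.ext
  exact O3.eq_of_smul_basis hdet fun i => congrArg Subtype.val (congrFun hgh i)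

/-! ### Prisms and antiprisms -/

/-- The point at angle `a` on the unit circle at height `e`. -/
noncomputable def circlePoint (a e : ℝ) : Fin 3 → ℝ := ![Real.cos a, Real.sin a, e]

theorem rotZ_smul_circlePoint (a b e : ℝ) :
    rotZ a • circlePoint b e = circlePoint (a + b) e := by
  rw [rotZ_smul]
  ext i
  fin_cases i <;> simp [circlePoint, Real.cos_add, Real.sin_add]

theorem halfTurnX_smul_circlePoint (b e : ℝ) :
    halfTurnX • circlePoint b e = circlePoint (-b) (-e) := by
  rw [halfTurnX_smul]
  ext i
  fin_cases i <;> simp [circlePoint]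

theorem neg_circlePoint (b e : ℝ) : -circlePoint b e = circlePoint (Real.pi + b) (-e) := by
  ext i
  fin_cases i <;> simp [circlePoint, Real.cos_add, Real.sin_add]

theorem circlePoint_add_int (b e : ℝ) (k : ℤ) :
    circlePoint (b + k * (2 * Real.pi)) e = circlePoint b e := by
  rw [add_comm, ← rotZ_smul_circlePoint, rotZ_int_two_pi, one_smul]

/-- The vertices of a prism over the regular `4n`-gon. -/
def prism (n : ℕ) : Set (Fin 3 → ℝ) :=
  {v | ∃ (k : ℤ) (e : ℝ), (e = 1 ∨ e = -1) ∧ v = circlePoint (k * (Real.pi / (2 * n))) e}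

theorem prism_finite {n : ℕ} (hn : 0 < n) : (prism n).Finite := by
  refine Set.Finite.subset ((Set.finite_Ico (0 : ℤ) (4 * n)).prod
    (Set.toFinite {(1 : ℝ), -1}) |>.image
      fun q => circlePoint (q.1 * (Real.pi / (2 * n))) q.2) ?_
  rintro v ⟨k, e, he, rfl⟩
  have hn' : (0 : ℤ) < 4 * n := by positivity
  -- The index may be reduced modulo `4n`, since `4n` steps of `π/(2n)` make a full turn.
  refine ⟨(k % (4 * n), e), ⟨⟨Int.emod_nonneg _ hn'.ne', Int.emod_lt_of_pos _ hn'⟩, he⟩, ?_⟩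
  have hn0 : (n : ℝ) ≠ 0 := by positivity
  rw [← circlePoint_add_int (k * _) _ (-(k / (4 * n)))]
  change circlePoint _ e = _
  congr 1
  have := congrArg (Int.cast (R := ℝ)) (Int.emod_add_mul_ediv k (4 * n))
  push_cast at this ⊢
  rw [← this]
  field_simp
  ring

theorem finite_setSymmetries_prism {n : ℕ} (hn : 0 < n) : Finite (setSymmetries (prism n)) := by
  have hn0 : (n : ℝ) ≠ 0 := by positivity
  refine finite_setSymmetries (prism_finite hn)
    (x := ![circlePoint 0 1, circlePoint 0 (-1), circlePoint (Real.pi / 2) 1]) ?_ ?_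
  · intro i
    fin_cases i
    · exact ⟨0, 1, by simp, by simp⟩
    · exact ⟨0, -1, by simp, by simp⟩
    · refine ⟨n, 1, by simp, ?_⟩
      change circlePoint _ _ = _
      congr 1
      push_cast
      field_simp
  · rw [Matrix.det_fin_three]
    simp [circlePoint]

theorem rotZ_mem_setSymmetries_prism {n : ℕ} (hn : 0 < n) {a : ℝ} (k : ℤ)
    (ha : a = k * (Real.pi / (2 * n))) : rotZ a ∈ setSymmetries (prism n) := by
  refine mem_setSymmetries_of_finite (prism_finite hn) ?_
  rintro _ ⟨l, e, he, rfl⟩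
  rw [rotZ_smul_circlePoint]
  exact ⟨k + l, e, he, by rw [ha]; push_cast; ring_nf⟩

theorem halfTurnX_mem_setSymmetries_prism {n : ℕ} (hn : 0 < n) :
    halfTurnX ∈ setSymmetries (prism n) := by
  refine mem_setSymmetries_of_finite (prism_finite hn) ?_
  rintro _ ⟨l, e, he, rfl⟩
  rw [halfTurnX_smul_circlePoint]
  refine ⟨-l, -e, by rcases he with rfl | rfl <;> simp, by push_cast; ring_nf⟩

theorem neg_mem_setSymmetries_prism {n : ℕ} (hn : 0 < n) {g : O3}
    (hg : g ∈ setSymmetries (prism n)) : -g ∈ setSymmetries (prism n) := by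
  refine mem_setSymmetries_of_finite (prism_finite hn) fun v hv => ?_
  obtain ⟨l, e, he, h⟩ := (hg v).2 hv
  change g • v = _ at h
  have hn0 : (n : ℝ) ≠ 0 := by positivity
  rw [O3.neg_smul, h, neg_circlePoint]
  refine ⟨2 * n + l, -e, by rcases he with rfl | rfl <;> simp, ?_⟩
  congr 1
  push_cast
  field_simp

-- The step `π/(2n)` of the prism divides `2π/n`, `π` and `π/n + π`, and the prism is centrally
-- symmetric, so its finite symmetry group contains all generators.
open Schoenflies in
theorem finite_axial {n : ℕ} (hn : 0 < n) : Finite (C n).group ∧ Finite (Cv n).group ∧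
    Finite (Ch n).group ∧ Finite (D n).group ∧ Finite (Dh n).group ∧ Finite (Dd n).group ∧
    Finite (S (2 * n)).group := by
  have hn0 : (n : ℝ) ≠ 0 := by positivity
  have h1 : rotZ (2 * Real.pi / n) ∈ setSymmetries (prism n) :=
    rotZ_mem_setSymmetries_prism hn 4 (by push_cast; field_simp; norm_num)
  have h2 := halfTurnX_mem_setSymmetries_prism hn
  have h3 := neg_mem_setSymmetries_prism hn h2
  have h4 : -rotZ Real.pi ∈ setSymmetries (prism n) := neg_mem_setSymmetries_prism hn
    (rotZ_mem_setSymmetries_prism hn (2 * n) (by push_cast; field_simp))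
  have h5 : -rotZ (Real.pi / n + Real.pi) ∈ setSymmetries (prism n) :=
    neg_mem_setSymmetries_prism hn
      (rotZ_mem_setSymmetries_prism hn (2 + 2 * n) (by push_cast; field_simp))
  have := finite_setSymmetries_prism hn
  exact ⟨.of_injective _ (Subgroup.inclusion_injective (C_le h1)),
    .of_injective _ (Subgroup.inclusion_injective (Cv_le h1 h3)),
    .of_injective _ (Subgroup.inclusion_injective (Ch_le h1 h4)),
    .of_injective _ (Subgroup.inclusion_injective (D_le h1 h2)),
    .of_injective _ (Subgroup.inclusion_injective (Dh_le h1 h2 h4)),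
    .of_injective _ (Subgroup.inclusion_injective (Dd_le h1 h2 h5)),
    .of_injective _ (Subgroup.inclusion_injective (S_le h5))⟩

/-- The vertices of a prism over the regular `n`-gon. -/
def smallPrism (n : ℕ) : Set (Fin 3 → ℝ) :=
  {v | ∃ (k : ℤ) (e : ℝ), (e = 1 ∨ e = -1) ∧ v = circlePoint (k * (2 * Real.pi / n)) e}

/-- The vertices of an antiprism over the regular `n`-gon, as the points at the angles
`kπ/n + π/(2n)` and the heights `(-1)^k`. -/
def antiprism (n : ℕ) : Set (Fin 3 → ℝ) :=
  {v | ∃ (k : ℤ) (e : ℝ), (Even k ∧ e = 1 ∨ Odd k ∧ e = -1) ∧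
    v = circlePoint (k * (Real.pi / n) + Real.pi / (2 * n)) e}

theorem smallPrism_finite {n : ℕ} (hn : 0 < n) : (smallPrism n).Finite := by
  have hn0 : (n : ℝ) ≠ 0 := by positivity
  refine (prism_finite hn).subset ?_
  rintro _ ⟨k, e, he, rfl⟩
  exact ⟨4 * k, e, he, by congr 1; push_cast; field_simp; norm_num⟩

theorem antiprism_finite {n : ℕ} (hn : 0 < n) : (antiprism n).Finite := by
  have hn0 : (n : ℝ) ≠ 0 := by positivity
  refine (prism_finite hn).subset ?_
  rintro _ ⟨k, e, he, rfl⟩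
  exact ⟨2 * k + 1, e, he.imp And.right And.right, by congr 1; push_cast; field_simp⟩

theorem Dh_le_setSymmetries {n : ℕ} (hn : 0 < n) :
    (Schoenflies.Dh n).group ≤ setSymmetries (smallPrism n) := by
  refine Schoenflies.Dh_le ?_ ?_ ?_ <;>
    refine mem_setSymmetries_of_finite (smallPrism_finite hn) ?_ <;> rintro _ ⟨l, e, he, rfl⟩
  · rw [rotZ_smul_circlePoint]
    exact ⟨1 + l, e, he, by congr 1; push_cast; ring⟩
  · rw [halfTurnX_smul_circlePoint]
    exact ⟨-l, -e, by rcases he with rfl | rfl <;> simp, by congr 1; push_cast; ring⟩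
  · rw [O3.neg_smul, rotZ_smul_circlePoint, neg_circlePoint]
    refine ⟨l, -e, by rcases he with rfl | rfl <;> simp, ?_⟩
    rw [← circlePoint_add_int (l * _) _ 1]
    congr 1
    push_cast
    ring

theorem Dd_le_setSymmetries {n : ℕ} (hn : 0 < n) :
    (Schoenflies.Dd n).group ≤ setSymmetries (antiprism n) := by
  have hn0 : (n : ℝ) ≠ 0 := by positivity
  refine Schoenflies.Dd_le ?_ ?_ ?_ <;>
    refine mem_setSymmetries_of_finite (antiprism_finite hn) ?_ <;> rintro _ ⟨l, e, he, rfl⟩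
  · rw [rotZ_smul_circlePoint]
    refine ⟨2 + l, e, ?_, by congr 1; push_cast; ring⟩
    rcases he with ⟨h, rfl⟩ | ⟨h, rfl⟩
    · exact Or.inl ⟨even_two.add h, rfl⟩
    · exact Or.inr ⟨even_two.add_odd h, rfl⟩
  · rw [halfTurnX_smul_circlePoint]
    -- The offset `π/(2n)` is half a step, so negating the angle turns the index `l` into `-(l +
    -- 1)`; the parity changes together with the height.
    refine ⟨-(l + 1), -e, ?_, by congr 1; push_cast; field_simp; ring⟩
    rcases he with ⟨h, rfl⟩ | ⟨h, rfl⟩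
    · exact Or.inr ⟨h.add_one.neg, rfl⟩
    · exact Or.inl ⟨h.add_one.neg, by norm_num⟩
  · rw [O3.neg_smul, rotZ_smul_circlePoint, neg_circlePoint]
    refine ⟨l + 1, -e, ?_, ?_⟩
    · rcases he with ⟨h, rfl⟩ | ⟨h, rfl⟩
      · exact Or.inr ⟨h.add_one, rfl⟩
      · exact Or.inl ⟨h.add_one, by norm_num⟩
    rw [← circlePoint_add_int ((l + 1 : ℤ) * _ + _) _ 1]
    congr 1
    push_cast
    field_simp
    ring

/-- The prism over an odd polygon is not centrally symmetric: the angle `π` is no multiple of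
`2π/n`. -/
theorem neg_one_notMem_Dh {n : ℕ} (hn : Odd n) : -1 ∉ (Schoenflies.Dh n).group := by
  intro h
  have hpos := hn.pos
  have hn0 : (n : ℝ) ≠ 0 := by positivity
  obtain ⟨k, e, he, hk⟩ := (mem_setSymmetries.1 (Dh_le_setSymmetries hpos h) (circlePoint 0 1)).2
    ⟨0, 1, by simp, by simp⟩
  rw [O3.neg_smul, one_smul, neg_circlePoint] at hk
  have hc := congrFun hk 0
  simp only [circlePoint, Matrix.cons_val_zero, add_zero, Real.cos_pi] at hc
  obtain ⟨j, hj⟩ := Real.cos_eq_neg_one_iff.1 hc.symm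
  field_simp at hj
  have : (n : ℤ) * (1 + j * 2) = k * 2 := by
    rw [mul_comm, mul_comm k]
    exact_mod_cast hj
  have h2 : Even ((n : ℤ) * (1 + j * 2)) := by simp [this]
  rw [Int.even_mul, Int.even_coe_nat] at h2
  rcases h2 with h2 | h2
  · exact Nat.not_even_iff_odd.2 hn h2
  · simp [Int.even_add] at h2

/-- The antipode of a top vertex of the antiprism lies at the bottom, where indices are odd, but for
even `n` its angle corresponds to an index that is an odd multiple of `n`, hence even. -/
theorem neg_one_notMem_Dd {n : ℕ} (hpos : 0 < n) (hn : Even n) :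
    -1 ∉ (Schoenflies.Dd n).group := by
  intro h
  have hn0 : (n : ℝ) ≠ 0 := by positivity
  obtain ⟨k, e, he, hk⟩ := (mem_setSymmetries.1 (Dd_le_setSymmetries hpos h)
    (circlePoint (Real.pi / (2 * n)) 1)).2 ⟨0, 1, by simp, by simp⟩
  rw [O3.neg_smul, one_smul, neg_circlePoint] at hk
  have hk' := congrArg (fun v => rotZ (-(Real.pi / (2 * n))) • v) hk
  simp only [rotZ_smul_circlePoint, neg_add_cancel_comm_assoc] at hk'
  have hc := congrFun hk' 0
  have hz := congrFun hk' 2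
  simp [circlePoint] at hc hz
  obtain ⟨j, hj⟩ := Real.cos_eq_neg_one_iff.1 hc.symm
  field_simp at hj
  have h2 : (1 + j * 2) * (n : ℤ) = k := by exact_mod_cast hj
  rcases he with ⟨_, he⟩ | ⟨h3, _⟩
  · linarith
  · rw [← Int.not_even_iff_odd, ← h2, Int.even_mul, Int.even_coe_nat] at h3
    exact h3 (Or.inr hn)

/-! ### The polyhedral groups -/

/-- The cyclic permutation of the coordinates. -/
def cyclicPerm : O3 :=
  ⟨!![0, 0, 1; 1, 0, 0; 0, 1, 0], by
    rw [Matrix.mem_orthogonalGroup_iff]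
    ext i j
    fin_cases i <;> fin_cases j <;> simp [Matrix.mul_apply, Fin.sum_univ_three]⟩

theorem cyclicPerm_smul (v : Fin 3 → ℝ) : cyclicPerm • v = ![v 2, v 0, v 1] := by
  ext i
  fin_cases i <;> simp [cyclicPerm, Matrix.mulVec, dotProduct, Fin.sum_univ_three]

theorem cyclicPerm_mem_rotations : cyclicPerm ∈ rotations := by
  rw [mem_rotations, cyclicPerm, Matrix.det_fin_three]
  simp

theorem rotZ_pi_smul (v : Fin 3 → ℝ) : rotZ Real.pi • v = ![-v 0, -v 1, v 2] := by
  rw [rotZ_smul]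
  simp

theorem cyclicPerm_conj : cyclicPerm * rotZ Real.pi * cyclicPerm⁻¹ = halfTurnX := by
  rw [mul_inv_eq_iff_eq_mul]
  refine O3.eq_of_smul_eq fun v => ?_
  simp only [mul_smul, cyclicPerm_smul, rotZ_pi_smul, halfTurnX_smul]
  ext i
  fin_cases i <;> simp

theorem cyclicPerm_conj' :
    cyclicPerm * halfTurnX * cyclicPerm⁻¹ = rotZ Real.pi * halfTurnX := by
  rw [mul_inv_eq_iff_eq_mul]
  refine O3.eq_of_smul_eq fun v => ?_
  simp only [mul_smul, cyclicPerm_smul, rotZ_pi_smul, halfTurnX_smul]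
  ext i
  fin_cases i <;> simp

theorem cyclicPerm_pow_three : cyclicPerm ^ 3 = 1 := by
  refine O3.eq_of_smul_eq fun v => ?_
  simp only [pow_succ, pow_zero, one_mul, mul_smul, cyclicPerm_smul, one_smul]
  ext i
  fin_cases i <;> simp

theorem vec_eta (v : Fin 3 → ℝ) : v = ![v 0, v 1, v 2] := by
  ext i
  fin_cases i <;> rfl

theorem mem_tetrahedron {v : Fin 3 → ℝ} : v ∈ tetrahedron ↔
    v 0 ^ 2 = 1 ∧ v 1 ^ 2 = 1 ∧ v 2 = v 0 * v 1 := by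
  constructor
  · rintro (rfl | rfl | rfl | rfl) <;> simp
  · rintro ⟨h0, h1, h2⟩
    rw [sq] at h0 h1
    rw [vec_eta v, h2]
    rcases mul_self_eq_one_iff.1 h0 with h0 | h0 <;>
      rcases mul_self_eq_one_iff.1 h1 with h1 | h1 <;> simp [h0, h1, tetrahedron]

theorem mem_octahedron {v : Fin 3 → ℝ} : v ∈ octahedron ↔
    v ⬝ᵥ v = 1 ∧ v 0 * v 1 = 0 ∧ v 0 * v 2 = 0 ∧ v 1 * v 2 = 0 := by
  constructor
  · rintro (rfl | rfl | rfl | rfl | rfl | rfl) <;> simp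
  · rintro ⟨h, h01, h02, h12⟩
    rw [vec_eta v]
    simp only [dotProduct, Fin.sum_univ_three] at h
    rcases mul_eq_zero.1 h01 with h0 | h0 <;> rcases mul_eq_zero.1 h02 with h1 | h1 <;>
      rcases mul_eq_zero.1 h12 with h2 | h2 <;> simp [h0, h1, h2] at h ⊢ <;>
      rcases mul_self_eq_one_iff.1 h with h | h <;> simp [h, octahedron]

theorem tetrahedron_finite : tetrahedron.Finite := by
  unfold tetrahedron
  exact Set.toFinite _

theorem octahedron_finite : octahedron.Finite := by
  unfold octahedron
  exact Set.toFinite _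

theorem icosahedron_subset : icosahedron ⊆
    (fun q : ℝ × ℝ × (ℝ → ℝ → Fin 3 → ℝ) => q.2.2 q.1 q.2.1) '' (({1, -1} : Set ℝ) ×ˢ
    (({Real.goldenRatio, -Real.goldenRatio} : Set ℝ) ×ˢ
    ({fun a b => ![0, a, b], fun a b => ![a, b, 0], fun a b => ![b, 0, a]} :
      Set (ℝ → ℝ → Fin 3 → ℝ)))) := by
  rintro v ⟨a, b, ha, hb, hv⟩
  rcases hv with rfl | rfl | rfl
  · exact ⟨(a, b, _), ⟨ha, hb, Or.inl rfl⟩, rfl⟩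
  · exact ⟨(a, b, _), ⟨ha, hb, Or.inr (Or.inl rfl)⟩, rfl⟩
  · exact ⟨(a, b, _), ⟨ha, hb, Or.inr (Or.inr rfl)⟩, rfl⟩

theorem icosahedron_finite : icosahedron.Finite :=
  (Set.Finite.image _ (Set.toFinite _)).subset icosahedron_subset

theorem ncard_pair_le {α : Type*} (a b : α) : ({a, b} : Set α).ncard ≤ 2 :=
  (Set.ncard_insert_le _ _).trans (by rw [Set.ncard_singleton])

theorem ncard_icosahedron_le : icosahedron.ncard ≤ 12 := by
  refine (Set.ncard_le_ncard icosahedron_subset (Set.Finite.image _ (Set.toFinite _))).trans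
    ((Set.ncard_image_le (Set.toFinite _)).trans ?_)
  rw [Set.ncard_prod, Set.ncard_prod]
  have h1 : ({1, -1} : Set ℝ).ncard ≤ 2 := ncard_pair_le _ _
  have h2 : ({Real.goldenRatio, -Real.goldenRatio} : Set ℝ).ncard ≤ 2 := ncard_pair_le _ _
  have h3 : ({fun a b => ![0, a, b], fun a b => ![a, b, 0], fun a b => ![b, 0, a]} :
      Set (ℝ → ℝ → Fin 3 → ℝ)).ncard ≤ 3 :=
    (Set.ncard_insert_le _ _).trans (Nat.succ_le_succ (ncard_pair_le _ _))
  calc _ ≤ 2 * (2 * 3) := Nat.mul_le_mul h1 (Nat.mul_le_mul h2 h3)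
    _ = 12 := rfl

theorem cyclicPerm_mem_tetrahedral : cyclicPerm ∈ setSymmetries tetrahedron := by
  refine mem_setSymmetries_of_finite tetrahedron_finite fun v hv => ?_
  rw [mem_tetrahedron] at hv ⊢
  rw [cyclicPerm_smul]
  obtain ⟨h0, h1, h2⟩ := hv
  simp [h2, mul_pow, h0, h1]
  linear_combination -v 1 * h0

theorem rotZ_pi_mem_tetrahedral : rotZ Real.pi ∈ setSymmetries tetrahedron := by
  refine mem_setSymmetries_of_finite tetrahedron_finite fun v hv => ?_
  rw [mem_tetrahedron] at hv ⊢
  rw [rotZ_pi_smul]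
  simpa using hv

theorem cyclicPerm_mem_octahedral : cyclicPerm ∈ setSymmetries octahedron := by
  refine mem_setSymmetries_of_finite octahedron_finite fun v hv => ?_
  rw [mem_octahedron] at hv ⊢
  rw [O3.dotProduct_smul_smul, cyclicPerm_smul]
  simp only [Matrix.cons_val]
  grind

theorem rotZ_pi_mem_octahedral : rotZ Real.pi ∈ setSymmetries octahedron := by
  refine mem_setSymmetries_of_finite octahedron_finite fun v hv => ?_
  rw [mem_octahedron] at hv ⊢
  rw [O3.dotProduct_smul_smul, rotZ_pi_smul]
  simpa using hv

theorem neg_one_mem_octahedral : -1 ∈ setSymmetries octahedron := by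
  refine mem_setSymmetries_of_finite octahedron_finite fun v hv => ?_
  rw [mem_octahedron] at hv ⊢
  rw [O3.dotProduct_smul_smul, O3.neg_smul, one_smul]
  simpa using hv

theorem cyclicPerm_mem_icosahedral : cyclicPerm ∈ setSymmetries icosahedron := by
  refine mem_setSymmetries_of_finite icosahedron_finite ?_
  rintro _ ⟨a, b, ha, hb, rfl | rfl | rfl⟩ <;> refine ⟨a, b, ha, hb, ?_⟩ <;>
    rw [cyclicPerm_smul] <;> simp

theorem rotZ_pi_mem_icosahedral : rotZ Real.pi ∈ setSymmetries icosahedron := by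
  refine mem_setSymmetries_of_finite icosahedron_finite ?_
  rintro _ ⟨a, b, ha, hb, rfl | rfl | rfl⟩ <;> rw [rotZ_pi_smul]
  · exact ⟨-a, b, by rcases ha with rfl | rfl <;> simp, hb, by simp⟩
  · exact ⟨-a, -b, by rcases ha with rfl | rfl <;> simp, by rcases hb with rfl | rfl <;> simp,
      by simp⟩
  · exact ⟨a, -b, ha, by rcases hb with rfl | rfl <;> simp, by simp⟩

theorem neg_one_mem_icosahedral : -1 ∈ setSymmetries icosahedron := by
  refine mem_setSymmetries_of_finite icosahedron_finite ?_
  rintro v ⟨a, b, ha, hb, hv⟩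
  refine ⟨-a, -b, by rcases ha with rfl | rfl <;> simp, by rcases hb with rfl | rfl <;> simp, ?_⟩
  rw [O3.neg_smul, one_smul]
  rcases hv with rfl | rfl | rfl <;> simp

theorem neg_one_notMem_Td : -1 ∉ Schoenflies.Td.group := by
  intro h
  have h1 := (mem_setSymmetries.1 h ![1, 1, 1]).2 (Or.inl rfl)
  rw [O3.neg_smul, one_smul, mem_tetrahedron] at h1
  simp at h1
  norm_num at h1

theorem finite_Td : Finite Schoenflies.Td.group :=
  finite_setSymmetries tetrahedron_finite (x := ![![1, 1, 1], ![1, -1, -1], ![-1, 1, -1]])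
    (by intro i; fin_cases i <;> simp [tetrahedron])
    (by rw [Matrix.det_fin_three]; simp; norm_num)

theorem finite_Oh : Finite Schoenflies.Oh.group :=
  finite_setSymmetries octahedron_finite (x := ![![1, 0, 0], ![0, 1, 0], ![0, 0, 1]])
    (by intro i; fin_cases i <;> simp [octahedron])
    (by rw [Matrix.det_fin_three]; simp)

theorem det_icosahedron_basis : (Matrix.of ![![0, 1, Real.goldenRatio],
    ![0, -1, Real.goldenRatio], ![Real.goldenRatio, 0, 1]]).det ≠ 0 := by
  rw [Matrix.det_fin_three]
  have := Real.goldenRatio_sq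
  have := Real.one_lt_goldenRatio
  simp only [Matrix.of_apply, Matrix.cons_val]
  intro h
  nlinarith

theorem finite_Ih : Finite Schoenflies.Ih.group :=
  finite_setSymmetries icosahedron_finite (x := ![![0, 1, Real.goldenRatio],
    ![0, -1, Real.goldenRatio], ![Real.goldenRatio, 0, 1]])
    (by
      intro i
      fin_cases i
      · exact ⟨1, _, Or.inl rfl, Or.inl rfl, Or.inl rfl⟩
      · exact ⟨-1, _, Or.inr rfl, Or.inl rfl, Or.inl rfl⟩
      · exact ⟨1, _, Or.inl rfl, Or.inl rfl, Or.inr (Or.inr rfl)⟩)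
    det_icosahedron_basis

/-! ### The full octahedral group -/

/-- The vertices of the octahedron are the midpoints of the edges of the tetrahedron, which makes
`Td` a subgroup of `Oh`. -/
theorem mem_octahedron_iff_tetrahedron {v : Fin 3 → ℝ} : v ∈ octahedron ↔
    ∃ s ∈ tetrahedron, ∃ t ∈ tetrahedron, s ≠ t ∧ v = (1 / 2 : ℝ) • (s + t) := by
  constructor
  · rintro (rfl | rfl | rfl | rfl | rfl | rfl)
    · exact ⟨![1, 1, 1], by simp [tetrahedron], ![1, -1, -1], by simp [tetrahedron],
        fun h => absurd (congrFun h 1) (by norm_num), by ext i; fin_cases i <;> simp <;> norm_num⟩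
    · exact ⟨![-1, 1, -1], by simp [tetrahedron], ![-1, -1, 1], by simp [tetrahedron],
        fun h => absurd (congrFun h 1) (by norm_num), by ext i; fin_cases i <;> simp <;> norm_num⟩
    · exact ⟨![1, 1, 1], by simp [tetrahedron], ![-1, 1, -1], by simp [tetrahedron],
        fun h => absurd (congrFun h 0) (by norm_num), by ext i; fin_cases i <;> simp <;> norm_num⟩
    · exact ⟨![1, -1, -1], by simp [tetrahedron], ![-1, -1, 1], by simp [tetrahedron],
        fun h => absurd (congrFun h 0) (by norm_num), by ext i; fin_cases i <;> simp <;> norm_num⟩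
    · exact ⟨![1, 1, 1], by simp [tetrahedron], ![-1, -1, 1], by simp [tetrahedron],
        fun h => absurd (congrFun h 0) (by norm_num), by ext i; fin_cases i <;> simp <;> norm_num⟩
    · exact ⟨![1, -1, -1], by simp [tetrahedron], ![-1, 1, -1], by simp [tetrahedron],
        fun h => absurd (congrFun h 0) (by norm_num), by ext i; fin_cases i <;> simp <;> norm_num⟩
  · rintro ⟨s, hs, t, ht, hne, rfl⟩
    rw [mem_octahedron]
    rcases hs with rfl | rfl | rfl | rfl <;> rcases ht with rfl | rfl | rfl | rfl <;>
      first
      | exact absurd rfl hne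
      | (simp [dotProduct, Fin.sum_univ_three]; norm_num)

theorem Td_le_Oh : Schoenflies.Td.group ≤ Schoenflies.Oh.group := by
  intro g hg
  refine mem_setSymmetries_of_finite octahedron_finite fun v hv => ?_
  obtain ⟨s, hs, t, ht, hne, rfl⟩ := mem_octahedron_iff_tetrahedron.1 hv
  refine mem_octahedron_iff_tetrahedron.2
    ⟨g • s, (hg s).2 hs, g • t, (hg t).2 ht, (MulAction.injective g).ne hne, ?_⟩
  rw [smul_comm, smul_add]

theorem dotProduct_of_mem_tetrahedron {s t : Fin 3 → ℝ} (hs : s ∈ tetrahedron)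
    (ht : t ∈ tetrahedron) : s ⬝ᵥ t = 3 ∨ s ⬝ᵥ t = -1 := by
  rcases hs with rfl | rfl | rfl | rfl <;> rcases ht with rfl | rfl | rfl | rfl <;> norm_num

/-- The inner products of `g • t` with the octahedron vertices are `±1`, so `g • t` is a vertex of
the cube, and the cube is the union of the tetrahedron and its antipode. -/
theorem smul_mem_tetrahedron_or {g : O3} (hg : g ∈ Schoenflies.Oh.group) {t : Fin 3 → ℝ}
    (ht : t ∈ tetrahedron) : g • t ∈ tetrahedron ∨ -(g • t) ∈ tetrahedron := by
  have key : ∀ v ∈ octahedron, ((g • t) ⬝ᵥ v) ^ 2 = 1 := by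
    intro v hv
    have hv' : g⁻¹ • v ∈ octahedron := (mem_setSymmetries.1 (inv_mem hg) v).2 hv
    have : (g • t) ⬝ᵥ v = t ⬝ᵥ (g⁻¹ • v) := by
      rw [← O3.dotProduct_smul_smul g⁻¹, inv_smul_smul]
    rw [this]
    rcases ht with rfl | rfl | rfl | rfl <;>
      rcases hv' with h | h | h | h | h | h <;> rw [h] <;> norm_num
  have k0 := key ![1, 0, 0] (by simp [octahedron])
  have k1 := key ![0, 1, 0] (by simp [octahedron])
  have k2 := key ![0, 0, 1] (by simp [octahedron])
  generalize g • t = u at *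
  simp only [dotProduct, Fin.sum_univ_three, Matrix.cons_val] at k0 k1 k2
  simp only [mul_one, mul_zero, add_zero, zero_add] at k0 k1 k2
  rw [mem_tetrahedron, mem_tetrahedron]
  have : (u 2 - u 0 * u 1) * (u 2 + u 0 * u 1) = 0 := by
    linear_combination k2 - u 1 ^ 2 * k0 - k1
  simp only [Pi.neg_apply]
  rcases mul_eq_zero.1 this with h | h
  · exact Or.inl ⟨k0, k1, by linarith⟩
  · exact Or.inr ⟨by linarith, by linarith, by linarith⟩

theorem Oh_le_withInversion : Schoenflies.Oh.group ≤ withInversion Schoenflies.Td.group := by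
  -- The image of one vertex decides between the two tetrahedra: inner products are `3` or `-1`
  -- within either of them, but `-3` or `1` between them.
  have key : ∀ g ∈ Schoenflies.Oh.group, g • ![1, 1, 1] ∈ tetrahedron →
      g ∈ Schoenflies.Td.group := by
    intro g hg h0
    refine mem_setSymmetries_of_finite tetrahedron_finite fun t ht => ?_
    refine (smul_mem_tetrahedron_or hg ht).resolve_right fun h => ?_
    have h1 := dotProduct_of_mem_tetrahedron h h0
    rw [neg_dotProduct, O3.dotProduct_smul_smul] at h1
    rcases dotProduct_of_mem_tetrahedron ht (show ![1, 1, 1] ∈ tetrahedron from Or.inl rfl)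
      with h2 | h2 <;> rw [h2] at h1 <;> norm_num at h1
  intro g hg
  rcases smul_mem_tetrahedron_or hg (show ![1, 1, 1] ∈ tetrahedron from Or.inl rfl) with h | h
  · exact Or.inl (key g hg h)
  · refine Or.inr (key (-g) ?_ ?_)
    · rw [← neg_one_mul]
      exact mul_mem neg_one_mem_octahedral hg
    · rwa [O3.neg_smul]

/-! ### The listed pairings -/

theorem eq_withInversion {G H : Subgroup O3} (h1 : H ≤ withInversion G) (h2 : G ≤ H)
    (h3 : -1 ∈ H) : H = withInversion G :=
  le_antisymm h1 (withInversion_le h2 h3)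

theorem neg_one_notMem_of_le_rotations {G : Subgroup O3} (h : G ≤ rotations) : -1 ∉ G :=
  fun h1 => neg_notMem_rotations (one_mem _) (h h1)

theorem neg_mem_withInversion_of_mem {G : Subgroup O3} {x : O3} (h : x ∈ G) :
    -x ∈ withInversion G :=
  neg_mem_withInversion (Or.inl h)

namespace Schoenflies

theorem C_le_rotations (n : ℕ) : (C n).group ≤ rotations := C_le (rotZ_mem_rotations _)

theorem D_le_rotations (n : ℕ) : (D n).group ≤ rotations :=
  D_le (rotZ_mem_rotations _) halfTurnX_mem_rotations

theorem T_le_rotations : T.group ≤ rotations := inf_le_right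

theorem O_le_rotations : O.group ≤ rotations := inf_le_right

theorem I_le_rotations : I.group ≤ rotations := inf_le_right

/-- The group fixes the north pole, which the inversion does not. -/
theorem neg_one_notMem_Cv (n : ℕ) : -1 ∉ (Cv n).group := by
  have h : (Cv n).group ≤ (MulAction.stabilizer O3 zAxis) := by
    refine Cv_le ?_ ?_
    · rw [MulAction.mem_stabilizer_iff, rotZ_smul]
      simp [zAxis]
    · rw [MulAction.mem_stabilizer_iff, O3.neg_smul, halfTurnX_smul]
      simp [zAxis]
  intro h1
  have h2 := congrFun (MulAction.mem_stabilizer_iff.1 (h h1)) 2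
  rw [O3.neg_smul, one_smul] at h2
  simp [zAxis] at h2
  norm_num at h2

theorem C_one_pairing : Ci.group = withInversion (C 1).group := by
  refine eq_withInversion (closure_singleton_le ?_) (C_le ?_) (Subgroup.subset_closure rfl)
  · exact neg_mem_withInversion_of_mem (one_mem _)
  · rw [rotZ_eq_one 1 (by simp)]
    exact one_mem _

theorem Cs_pairing : (Ch 2).group = withInversion Cs.group := by
  have h0 : -rotZ Real.pi ∈ Cs.group := reflZ_eq ▸ Subgroup.subset_closure rfl
  have h1 : rotZ Real.pi ∈ (Ch 2).group := rotZ_mem (rotZ_mem_Ch 2) 1 0 (by simp)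
  refine eq_withInversion (Ch_le ?_ (Or.inl h0)) (Cs_le (neg_rotZ_mem_Ch 2))
    (neg_one_mem h1 (neg_rotZ_mem_Ch 2))
  have : 2 * Real.pi / (2 : ℕ) = Real.pi := by simp
  rw [this]
  exact Or.inr h0

theorem C_odd_pairing {n : ℕ} (hn : Odd n) : (S (2 * n)).group = withInversion (C n).group := by
  have hn0 : (n : ℝ) ≠ 0 := by have := hn.pos; positivity
  have hS := neg_rotZ_mem_S n
  obtain ⟨k, hk⟩ := hn
  have hk' : (n : ℝ) = 2 * k + 1 := by exact_mod_cast hk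
  refine eq_withInversion (S_le (neg_mem_withInversion_of_mem ?_)) (C_le ?_) ?_
  · refine rotZ_mem (rotZ_mem_C n) (k + 1) 0 ?_
    field_simp
    push_cast
    rw [hk']
    ring
  · refine rotZ_mem_of_neg hS 2 (-1) even_two ?_
    push_cast
    field_simp
    ring
  · rw [← rotZ_eq_one (k + 1) rfl]
    refine neg_mem_iff_of_rotZ hS n 0 ⟨k, by exact_mod_cast hk⟩ ?_
    field_simp
    push_cast
    rw [hk']
    ring

/-- With `n = 2k + 1` one has `π/n + π = (k + 1)(2π/n)`, whereas for even `n` already `π` is a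
multiple of `2π/n`. This is the source of the parity split in the rows for `Cv` and `D`. -/
theorem pi_div_add_pi_of_odd {n : ℕ} (hn : Odd n) : ∃ k : ℤ,
    Real.pi / n + Real.pi = k * (2 * Real.pi / n) + (0 : ℤ) * (2 * Real.pi) := by
  have hn0 : (n : ℝ) ≠ 0 := by have := hn.pos; positivity
  obtain ⟨k, hk⟩ := hn
  have hk' : (n : ℝ) = 2 * k + 1 := by exact_mod_cast hk
  refine ⟨k + 1, ?_⟩
  field_simp
  push_cast
  rw [hk']
  ring

theorem pi_of_even {n : ℕ} (h0 : 0 < n) (hn : Even n) : ∃ k : ℤ,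
    Real.pi = k * (2 * Real.pi / n) + (0 : ℤ) * (2 * Real.pi) := by
  have hn0 : (n : ℝ) ≠ 0 := by positivity
  obtain ⟨k, hk⟩ := hn
  have hk' : (n : ℝ) = k + k := by exact_mod_cast hk
  refine ⟨k, ?_⟩
  field_simp
  push_cast
  rw [hk']
  ring

theorem C_even_pairing {n : ℕ} (h0 : 0 < n) (hn : Even n) :
    (Ch n).group = withInversion (C n).group := by
  obtain ⟨k, hk⟩ := pi_of_even h0 hn
  exact eq_withInversion (Ch_le (Or.inl (rotZ_mem_C n))
      (neg_mem_withInversion_of_mem (rotZ_mem (rotZ_mem_C n) _ _ hk)))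
    (C_le (rotZ_mem_Ch n)) (neg_one_mem (rotZ_mem (rotZ_mem_Ch n) _ _ hk) (neg_rotZ_mem_Ch n))

theorem Cv_odd_pairing {n : ℕ} (hn : Odd n) : (Dd n).group = withInversion (Cv n).group := by
  obtain ⟨k, hk⟩ := pi_div_add_pi_of_odd hn
  have h1 := rotZ_mem (rotZ_mem_Dd n) _ _ hk
  have h2 := neg_one_mem h1 (neg_rotZ_mem_Dd n)
  refine eq_withInversion (Dd_le (Or.inl (rotZ_mem_Cv n)) (Or.inr (neg_halfTurnX_mem_Cv n))
    (neg_mem_withInversion_of_mem (rotZ_mem (rotZ_mem_Cv n) _ _ hk)))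
    (Cv_le (rotZ_mem_Dd n) ?_) h2
  rw [← neg_one_mul]
  exact mul_mem h2 (halfTurnX_mem_Dd n)

theorem Cv_even_pairing {n : ℕ} (h0 : 0 < n) (hn : Even n) :
    (Dh n).group = withInversion (Cv n).group := by
  obtain ⟨k, hk⟩ := pi_of_even h0 hn
  have h1 := rotZ_mem (rotZ_mem_Dh n) _ _ hk
  have h2 := neg_one_mem h1 (neg_rotZ_mem_Dh n)
  refine eq_withInversion (Dh_le (Or.inl (rotZ_mem_Cv n)) (Or.inr (neg_halfTurnX_mem_Cv n))
    (neg_mem_withInversion_of_mem (rotZ_mem (rotZ_mem_Cv n) _ _ hk)))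
    (Cv_le (rotZ_mem_Dh n) ?_) h2
  rw [← neg_one_mul]
  exact mul_mem h2 (halfTurnX_mem_Dh n)

theorem D_odd_pairing {n : ℕ} (hn : Odd n) : (Dd n).group = withInversion (D n).group := by
  obtain ⟨k, hk⟩ := pi_div_add_pi_of_odd hn
  have h1 := rotZ_mem (rotZ_mem_Dd n) _ _ hk
  exact eq_withInversion (Dd_le (Or.inl (rotZ_mem_D n)) (Or.inl (halfTurnX_mem_D n))
    (neg_mem_withInversion_of_mem (rotZ_mem (rotZ_mem_D n) _ _ hk)))
    (D_le (rotZ_mem_Dd n) (halfTurnX_mem_Dd n)) (neg_one_mem h1 (neg_rotZ_mem_Dd n))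

theorem D_even_pairing {n : ℕ} (h0 : 0 < n) (hn : Even n) :
    (Dh n).group = withInversion (D n).group := by
  obtain ⟨k, hk⟩ := pi_of_even h0 hn
  have h1 := rotZ_mem (rotZ_mem_Dh n) _ _ hk
  exact eq_withInversion (Dh_le (Or.inl (rotZ_mem_D n)) (Or.inl (halfTurnX_mem_D n))
    (neg_mem_withInversion_of_mem (rotZ_mem (rotZ_mem_D n) _ _ hk)))
    (D_le (rotZ_mem_Dh n) (halfTurnX_mem_Dh n)) (neg_one_mem h1 (neg_rotZ_mem_Dh n))

/-- In the presence of the reflection `-rotZ π`, the rotation by `2π/n` with `n` odd yields minus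
the rotation by `2π/(2n)`. -/
theorem neg_rotZ_of_odd {n : ℕ} (hn : Odd n) {G : Subgroup O3}
    (h : rotZ (2 * Real.pi / n) ∈ G) (h' : -rotZ Real.pi ∈ G) :
    -rotZ (2 * Real.pi / (2 * n : ℕ)) ∈ G := by
  have hn0 : (n : ℝ) ≠ 0 := by have := hn.pos; positivity
  obtain ⟨k, hk⟩ := hn
  have hk' : (n : ℝ) = 2 * k + 1 := by exact_mod_cast hk
  -- For `n = 2k + 1` the angle `π - k(2π/n)` equals `π/n`.
  have h1 := mul_mem (zpow_mem h (-k : ℤ)) h'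
  rw [rotZ_zpow, mul_neg, ← rotZ_add] at h1
  have h2 : 2 * Real.pi / (2 * n : ℕ) = (-k : ℤ) * (2 * Real.pi / n) + Real.pi := by
    push_cast
    field_simp
    rw [hk']
    ring
  rwa [h2]

theorem rotZ_two_mul {n : ℕ} (h0 : 0 < n) {G : Subgroup O3}
    (h : rotZ (2 * Real.pi / (2 * n : ℕ)) ∈ G) :
    rotZ (2 * Real.pi / n) ∈ G ∧ rotZ Real.pi ∈ G ∧ rotZ (Real.pi / n + Real.pi) ∈ G := by
  have hn0 : (n : ℝ) ≠ 0 := by positivity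
  refine ⟨rotZ_mem h 2 0 ?_, rotZ_mem h n 0 ?_, rotZ_mem h (1 + n) 0 ?_⟩ <;>
    push_cast <;> field_simp <;> ring

/-- Minus the rotation by `π/n + π` with `n` even yields minus the rotation by `2π/(2n)`. -/
theorem neg_rotZ_of_even {n : ℕ} (h0 : 0 < n) (hn : Even n) {G : Subgroup O3}
    (h : -rotZ (Real.pi / n + Real.pi) ∈ G) : -rotZ (2 * Real.pi / (2 * n : ℕ)) ∈ G := by
  have hn0 : (n : ℝ) ≠ 0 := by positivity
  obtain ⟨k, hk⟩ := hn
  have hk' : (n : ℝ) = k + k := by exact_mod_cast hk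
  -- `(1 - n)(π/n + π) = π/n - nπ`, and `nπ = k(2π)` because `n = 2k`; the multiple `1 - n` is odd,
  -- so the sign survives.
  refine neg_mem_iff_of_rotZ h (1 - n) (k) ?_ ?_
  · rw [hk]
    exact ⟨-k, by push_cast; ring⟩
  · push_cast
    field_simp
    rw [hk']
    ring

theorem Ch_odd_pairing {n : ℕ} (hn : Odd n) :
    (Ch (2 * n)).group = withInversion (Ch n).group := by
  obtain ⟨h1, h2, -⟩ := rotZ_two_mul hn.pos (rotZ_mem_Ch (2 * n))
  exact eq_withInversion (Ch_le (Or.inr (neg_rotZ_of_odd hn (rotZ_mem_Ch n) (neg_rotZ_mem_Ch n)))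
      (Or.inl (neg_rotZ_mem_Ch n)))
    (Ch_le h1 (neg_rotZ_mem_Ch _)) (neg_one_mem h2 (neg_rotZ_mem_Ch _))

theorem Dh_odd_pairing {n : ℕ} (hn : Odd n) :
    (Dh (2 * n)).group = withInversion (Dh n).group := by
  obtain ⟨h1, h2, -⟩ := rotZ_two_mul hn.pos (rotZ_mem_Dh (2 * n))
  exact eq_withInversion (Dh_le (Or.inr (neg_rotZ_of_odd hn (rotZ_mem_Dh n) (neg_rotZ_mem_Dh n)))
      (Or.inl (halfTurnX_mem_Dh n)) (Or.inl (neg_rotZ_mem_Dh n)))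
    (Dh_le h1 (halfTurnX_mem_Dh _) (neg_rotZ_mem_Dh _)) (neg_one_mem h2 (neg_rotZ_mem_Dh _))

theorem S_even_pairing {n : ℕ} (h0 : 0 < n) (hn : Even n) :
    (Ch (2 * n)).group = withInversion (S (2 * n)).group := by
  obtain ⟨h1, h2, h3⟩ := rotZ_two_mul h0 (rotZ_mem_Ch (2 * n))
  have h4 : rotZ (2 * Real.pi / (2 * n : ℕ)) ∈ withInversion (S (2 * n)).group :=
    Or.inr (neg_rotZ_of_even h0 hn (neg_rotZ_mem_S n))
  have h5 := neg_one_mem h2 (neg_rotZ_mem_Ch _)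
  refine eq_withInversion (Ch_le h4 (neg_mem_withInversion (rotZ_two_mul h0 h4).2.1))
    (S_le ?_) h5
  rw [← neg_one_mul]
  exact mul_mem h5 h3

theorem Dd_even_pairing {n : ℕ} (h0 : 0 < n) (hn : Even n) :
    (Dh (2 * n)).group = withInversion (Dd n).group := by
  obtain ⟨h1, h2, h3⟩ := rotZ_two_mul h0 (rotZ_mem_Dh (2 * n))
  have h4 : rotZ (2 * Real.pi / (2 * n : ℕ)) ∈ withInversion (Dd n).group :=
    Or.inr (neg_rotZ_of_even h0 hn (neg_rotZ_mem_Dd n))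
  have h5 := neg_one_mem h2 (neg_rotZ_mem_Dh _)
  refine eq_withInversion (Dh_le h4 (Or.inl (halfTurnX_mem_Dd n))
    (neg_mem_withInversion (rotZ_two_mul h0 h4).2.1)) (Dd_le h1 (halfTurnX_mem_Dh _) ?_) h5
  rw [← neg_one_mul]
  exact mul_mem h5 h3

theorem T_pairing : Th.group = withInversion T.group := by
  have h1 : rotZ Real.pi ∈ T.group := ⟨rotZ_pi_mem_tetrahedral, rotZ_mem_rotations _⟩
  refine eq_withInversion (sup_le (le_withInversion _) (closure_singleton_le ?_)) le_sup_left ?_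
  · rw [reflZ_eq]
    exact neg_mem_withInversion_of_mem h1
  · refine neg_one_mem (le_sup_left (a := T.group) h1) (le_sup_right (a := T.group) ?_)
    rw [← reflZ_eq]
    exact Subgroup.subset_closure rfl

theorem S_le_Dd (n : ℕ) : (S (2 * n)).group ≤ (Dd n).group := S_le (neg_rotZ_mem_Dd n)

theorem Ch_le_Dh (n : ℕ) : (Ch n).group ≤ (Dh n).group := Ch_le (rotZ_mem_Dh n) (neg_rotZ_mem_Dh n)

end Schoenflies

open Schoenflies in
theorem ListedPairing.properties {s t : Schoenflies} (h : ListedPairing s t) :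
    t.group = withInversion s.group ∧ Finite s.group ∧ -1 ∉ s.group := by
  cases h with
  | C1_Ci => exact ⟨C_one_pairing, (finite_axial one_pos).1,
      neg_one_notMem_of_le_rotations (C_le_rotations _)⟩
  | Cs_C2h =>
    -- Both finiteness and the absence of `-1` are inherited from the axial groups with `n = 1`.
    have hle : Cs.group ≤ (Ch 1).group := Cs_le (neg_rotZ_mem_Ch 1)
    have := (finite_axial one_pos).2.2.1
    exact ⟨Cs_pairing, .of_injective _ (Subgroup.inclusion_injective hle),
      fun h => neg_one_notMem_Dh odd_one (Ch_le_Dh _ (hle h))⟩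
  | C_odd n hn => exact ⟨C_odd_pairing hn, (finite_axial hn.pos).1,
      neg_one_notMem_of_le_rotations (C_le_rotations _)⟩
  | C_even n h0 hn => exact ⟨C_even_pairing h0 hn, (finite_axial h0).1,
      neg_one_notMem_of_le_rotations (C_le_rotations _)⟩
  | Cv_odd n hn => exact ⟨Cv_odd_pairing hn, (finite_axial hn.pos).2.1, neg_one_notMem_Cv n⟩
  | Cv_even n h0 hn => exact ⟨Cv_even_pairing h0 hn, (finite_axial h0).2.1, neg_one_notMem_Cv n⟩
  | Ch_odd n hn => exact ⟨Ch_odd_pairing hn, (finite_axial hn.pos).2.2.1,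
      fun h => neg_one_notMem_Dh hn (Ch_le_Dh n h)⟩
  | S_even n h0 hn => exact ⟨S_even_pairing h0 hn, (finite_axial h0).2.2.2.2.2.2,
      fun h => neg_one_notMem_Dd h0 hn (S_le_Dd n h)⟩
  | D_odd n hn => exact ⟨D_odd_pairing hn, (finite_axial hn.pos).2.2.2.1,
      neg_one_notMem_of_le_rotations (D_le_rotations _)⟩
  | D_even n h0 hn => exact ⟨D_even_pairing h0 hn, (finite_axial h0).2.2.2.1,
      neg_one_notMem_of_le_rotations (D_le_rotations _)⟩
  | Dh_odd n hn => exact ⟨Dh_odd_pairing hn, (finite_axial hn.pos).2.2.2.2.1,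
      neg_one_notMem_Dh hn⟩
  | Dd_even n h0 hn => exact ⟨Dd_even_pairing h0 hn, (finite_axial h0).2.2.2.2.2.1,
      neg_one_notMem_Dd h0 hn⟩
  | T_Th =>
    have : Finite (setSymmetries tetrahedron) := finite_Td
    exact ⟨T_pairing, .of_injective _ (Subgroup.inclusion_injective inf_le_left),
      neg_one_notMem_of_le_rotations T_le_rotations⟩
  | Td_Oh => exact ⟨eq_withInversion Oh_le_withInversion Td_le_Oh neg_one_mem_octahedral,
      finite_Td, neg_one_notMem_Td⟩
  | O_Oh =>
    have : Finite (setSymmetries octahedron) := finite_Oh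
    exact ⟨withInversion_inf_rotations_of_le neg_one_mem_octahedral,
      .of_injective _ (Subgroup.inclusion_injective inf_le_left),
      neg_one_notMem_of_le_rotations O_le_rotations⟩
  | I_Ih =>
    have : Finite (setSymmetries icosahedron) := finite_Ih
    exact ⟨withInversion_inf_rotations_of_le neg_one_mem_icosahedral,
      .of_injective _ (Subgroup.inclusion_injective inf_le_left),
      neg_one_notMem_of_le_rotations I_le_rotations⟩

/-! ### Groups without inversion and their rotation parts -/

theorem eq_one_of_fixed_of_norm {g : O3} (hg : g ∈ rotations) {v w : Fin 3 → ℝ} {r : ℝ}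
    (hr : 0 < r) (hv : v ⬝ᵥ v = r) (hw : w ⬝ᵥ w = r) (h1 : w ≠ v) (h2 : w ≠ -v)
    (hgv : g • v = v) (hgw : g • w = w) : g = 1 := by
  have hs : (Real.sqrt r)⁻¹ ≠ 0 := inv_ne_zero (Real.sqrt_pos.2 hr).ne'
  have hone : ∀ u : Fin 3 → ℝ, u ⬝ᵥ u = r →
      ((Real.sqrt r)⁻¹ • u) ⬝ᵥ ((Real.sqrt r)⁻¹ • u) = 1 := by
    intro u hu
    rw [smul_dotProduct, dotProduct_smul, smul_eq_mul, smul_eq_mul, ← mul_assoc, ← mul_inv,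
      Real.mul_self_sqrt hr.le, hu, inv_mul_cancel₀ hr.ne']
  refine eq_one_of_fixed hg (hone v hv) (hone w hw) ?_ ?_ ?_ ?_
  · exact fun h => h1 (smul_right_injective _ hs h)
  · rw [← smul_neg]
    exact fun h => h2 (smul_right_injective _ hs h)
  · rw [smul_comm, hgv]
  · rw [smul_comm, hgw]

/-- A rotation is determined by the images of two independent vertices. The half-turns move
`(1,1,1)` to any vertex, and the powers of `cyclicPerm` then fix it and permute the other three.
Working in `L = G ⊓ T` keeps the correcting elements among the rotations of the tetrahedron. -/
theorem Schoenflies.T_le {G : Subgroup O3} (h1 : rotZ Real.pi ∈ G) (h2 : cyclicPerm ∈ G) :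
    T.group ≤ G := by
  set L := G ⊓ T.group with hL
  have hT1 : rotZ Real.pi ∈ L := ⟨h1, rotZ_pi_mem_tetrahedral, rotZ_mem_rotations _⟩
  have hT2 : cyclicPerm ∈ L := ⟨h2, cyclicPerm_mem_tetrahedral, cyclicPerm_mem_rotations⟩
  have hT3 : halfTurnX ∈ L := by
    rw [← cyclicPerm_conj]
    exact mul_mem (mul_mem hT2 hT1) (inv_mem hT2)
  have hstep : ∀ v ∈ tetrahedron, ∃ k ∈ L, k • ![1, 1, 1] = v := by
    rintro v (rfl | rfl | rfl | rfl)
    · exact ⟨1, one_mem _, one_smul _ _⟩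
    · exact ⟨_, hT3, by rw [halfTurnX_smul]; simp⟩
    · exact ⟨_, mul_mem hT1 hT3, by rw [mul_smul, halfTurnX_smul, rotZ_pi_smul]; simp⟩
    · exact ⟨_, hT1, by rw [rotZ_pi_smul]; simp⟩
  have hstep' : ∀ v ∈ tetrahedron, v ≠ ![1, 1, 1] →
      ∃ k ∈ L, k • ![1, 1, 1] = (![1, 1, 1] : Fin 3 → ℝ) ∧ k • ![1, -1, -1] = v := by
    rintro v (rfl | rfl | rfl | rfl) hne
    · exact absurd rfl hne
    · exact ⟨1, one_mem _, one_smul _ _, one_smul _ _⟩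
    · exact ⟨_, hT2, by rw [cyclicPerm_smul]; simp, by rw [cyclicPerm_smul]; simp⟩
    · exact ⟨_, mul_mem hT2 hT2, by simp only [mul_smul, cyclicPerm_smul]; simp,
        by simp only [mul_smul, cyclicPerm_smul]; simp⟩
  intro g hg
  have m0 : ![1, 1, 1] ∈ tetrahedron := Or.inl rfl
  have m1 : ![1, -1, -1] ∈ tetrahedron := Or.inr (Or.inl rfl)
  obtain ⟨k, hk, hk0⟩ := hstep (g • ![1, 1, 1]) ((mem_setSymmetries.1 hg.1 _).2 m0)
  have hkg : k⁻¹ * g ∈ T.group := mul_mem (inv_mem hk.2) hg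
  have h0 : (k⁻¹ * g) • ![1, 1, 1] = (![1, 1, 1] : Fin 3 → ℝ) := by
    rw [mul_smul, ← hk0, inv_smul_smul]
  obtain ⟨l, hl, hl0, hl1⟩ := hstep' ((k⁻¹ * g) • ![1, -1, -1])
    ((mem_setSymmetries.1 hkg.1 _).2 m1) (by
      rw [← h0]
      intro h
      have := congrFun (MulAction.injective _ h) 1
      simp at this
      norm_num at this)
  have h1 : l⁻¹ * (k⁻¹ * g) = 1 := by
    refine eq_one_of_fixed_of_norm (mul_mem (inv_mem hl.2.2) hkg.2) (v := ![1, 1, 1])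
      (w := ![1, -1, -1]) (r := 3) (by norm_num) (by norm_num) (by norm_num) ?_ ?_ ?_ ?_
    · intro h
      have := congrFun h 1
      simp at this
      norm_num at this
    · intro h
      have := congrFun h 0
      simp at this
      norm_num at this
    · rw [mul_smul, h0, inv_smul_eq_iff, hl0]
    · rw [mul_smul, inv_smul_eq_iff, hl1]
  rw [inv_mul_eq_one, eq_inv_mul_iff_mul_eq] at h1
  rw [← h1]
  exact mul_mem hk.1 hl.1

/-- Each `g ∈ G` is, up to sign, an element of `L`. If `-g ∈ L ≤ G`, then `-1 ∈ G`, which is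
excluded. So a subgroup of `G` that accounts for all rotations up to sign is the whole of `G`. -/
theorem eq_of_le_of_le_withInversion {G L : Subgroup O3} (h1 : -1 ∉ G) (h2 : L ≤ G)
    (h3 : withInversion G ⊓ rotations ≤ withInversion L) : L = G := by
  refine le_antisymm h2 fun g hg => ?_
  have key : g ∈ withInversion L := by
    rcases mem_or_neg_mem_rotations g with h | h
    · exact h3 ⟨Or.inl hg, h⟩
    · have := neg_mem_withInversion (h3 ⟨neg_mem_withInversion_of_mem hg, h⟩)
      rwa [neg_neg] at this
  rcases key with h | h
  · exact h
  · exact absurd (neg_one_mem hg (h2 h)) h1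

/-- For odd `n`, the `n`-th power of minus this rotation is `-1`. -/
theorem even_of_neg_rotZ_mem {n : ℕ} (hn : 0 < n) {G : Subgroup O3} (h1 : -1 ∉ G)
    (h : -rotZ (2 * Real.pi / n) ∈ G) : Even n := by
  have hn0 : (n : ℝ) ≠ 0 := by positivity
  by_contra hne
  have := pow_mem h n
  rw [(Nat.not_even_iff_odd.1 hne).neg_pow, rotZ_pow, rotZ_eq_one 1 (by field_simp; simp)] at this
  exact h1 this

/-- A symbol on the left of a listed pairing. -/
def Schoenflies.IsListed (s : Schoenflies) : Prop := ∃ t, ListedPairing s t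

open Schoenflies

theorem isListed_C {n : ℕ} (hn : 0 < n) : (C n).IsListed := by
  rcases Nat.even_or_odd n with h | h
  · exact ⟨_, .C_even n hn h⟩
  · exact ⟨_, .C_odd n h⟩

theorem isListed_D {n : ℕ} (hn : 0 < n) : (D n).IsListed := by
  rcases Nat.even_or_odd n with h | h
  · exact ⟨_, .D_even n hn h⟩
  · exact ⟨_, .D_odd n h⟩

theorem isListed_Cv {n : ℕ} (hn : 0 < n) : (Cv n).IsListed := by
  rcases Nat.even_or_odd n with h | h
  · exact ⟨_, .Cv_even n hn h⟩
  · exact ⟨_, .Cv_odd n h⟩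

theorem neg_rotZ_two_mul {n : ℕ} (h0 : 0 < n) {G : Subgroup O3}
    (h : -rotZ (2 * Real.pi / (2 * n : ℕ)) ∈ G) : rotZ (2 * Real.pi / n) ∈ G ∧
      (Odd n → -rotZ Real.pi ∈ G) ∧ (Even n → -rotZ (Real.pi / n + Real.pi) ∈ G) := by
  have hn0 : (n : ℝ) ≠ 0 := by positivity
  refine ⟨rotZ_mem_of_neg h 2 0 even_two ?_, fun hn => neg_mem_iff_of_rotZ h n 0 ?_ ?_,
    fun hn => neg_mem_iff_of_rotZ h (1 + n) 0 ?_ ?_⟩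
  · push_cast
    field_simp
    ring
  · exact_mod_cast hn
  · push_cast
    field_simp
    ring
  · exact odd_one.add_even (by exact_mod_cast hn)
  · push_cast
    field_simp
    ring

/-- The sign of the generator decides. A positive one gives `C n`; a negative one forces `n = 2m`,
and the parity of `m` selects `S (2 * m)` or `Ch m`. -/
theorem isListed_of_rotations_eq_C {G : Subgroup O3} (h1 : -1 ∉ G) {n : ℕ} (hn : 0 < n)
    (hK : withInversion G ⊓ rotations = (C n).group) : ∃ s : Schoenflies, s.IsListed ∧
      G = s.group := by
  rcases (hK.ge (rotZ_mem_C n)).1 with hr | hr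
  · exact ⟨_, isListed_C hn, (eq_of_le_of_le_withInversion h1 (C_le hr)
      (hK.le.trans (le_withInversion _))).symm⟩
  · obtain ⟨m, hm⟩ := (even_of_neg_rotZ_mem hn h1 hr).exists_two_nsmul
    rw [smul_eq_mul] at hm
    subst hm
    have hm0 : 0 < m := by omega
    obtain ⟨h2, h3, h4⟩ := neg_rotZ_two_mul hm0 hr
    rcases Nat.even_or_odd m with he | ho
    · refine ⟨S (2 * m), ⟨_, .S_even m hm0 he⟩, (eq_of_le_of_le_withInversion h1 (S_le (h4 he))
        (hK.le.trans (C_le (Or.inr ?_)))).symm⟩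
      exact neg_rotZ_of_even hm0 he (neg_rotZ_mem_S m)
    · refine ⟨Ch m, ⟨_, .Ch_odd m ho⟩, (eq_of_le_of_le_withInversion h1 (Ch_le h2 (h3 ho))
        (hK.le.trans (C_le (Or.inr ?_)))).symm⟩
      exact neg_rotZ_of_odd ho (rotZ_mem_Ch m) (neg_rotZ_mem_Ch m)

theorem isListed_of_halfTurnX_mem {G : Subgroup O3} (h1 : -1 ∉ G) {n : ℕ} (hn : 0 < n)
    (hK : withInversion G ⊓ rotations ≤ (D n).group) (hr : -rotZ (2 * Real.pi / n) ∈ G)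
    (hh : halfTurnX ∈ G) : ∃ s : Schoenflies, s.IsListed ∧ G = s.group := by
  obtain ⟨m, hm⟩ := (even_of_neg_rotZ_mem hn h1 hr).exists_two_nsmul
  rw [smul_eq_mul] at hm
  subst hm
  have hm0 : 0 < m := by omega
  obtain ⟨h2, h3, h4⟩ := neg_rotZ_two_mul hm0 hr
  rcases Nat.even_or_odd m with he | ho
  · refine ⟨Dd m, ⟨_, .Dd_even m hm0 he⟩, (eq_of_le_of_le_withInversion h1 (Dd_le h2 hh (h4 he))
      (hK.trans (D_le (Or.inr ?_) (Or.inl (halfTurnX_mem_Dd m))))).symm⟩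
    exact neg_rotZ_of_even hm0 he (neg_rotZ_mem_Dd m)
  · refine ⟨Dh m, ⟨_, .Dh_odd m ho⟩, (eq_of_le_of_le_withInversion h1 (Dh_le h2 hh (h3 ho))
      (hK.trans (D_le (Or.inr ?_) (Or.inl (halfTurnX_mem_Dh m))))).symm⟩
    exact neg_rotZ_of_odd ho (rotZ_mem_Dh m) (neg_rotZ_mem_Dh m)

theorem isListed_of_rotations_eq_D {G : Subgroup O3} (h1 : -1 ∉ G) {n : ℕ} (hn : 0 < n)
    (hK : withInversion G ⊓ rotations = (D n).group) : ∃ s : Schoenflies, s.IsListed ∧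
      ∃ g, conjSubgroup g G = s.group := by
  have hG := conjSubgroup_one G
  rcases (hK.ge (rotZ_mem_D n)).1 with hr | hr <;>
    rcases (hK.ge (halfTurnX_mem_D n)).1 with hh | hh
  · exact ⟨_, isListed_D hn, 1, hG.trans (eq_of_le_of_le_withInversion h1 (D_le hr hh)
      (hK.le.trans (le_withInversion _))).symm⟩
  · exact ⟨_, isListed_Cv hn, 1, hG.trans (eq_of_le_of_le_withInversion h1 (Cv_le hr hh)
      (hK.le.trans (D_le (Or.inl (rotZ_mem_Cv n)) (Or.inr (neg_halfTurnX_mem_Cv n))))).symm⟩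
  · obtain ⟨s, hs, h⟩ := isListed_of_halfTurnX_mem h1 hn hK.le hr hh
    exact ⟨s, hs, 1, hG.trans h⟩
  -- Both generators are negative, so their product `rotZ (2π/n) * halfTurnX` lies in `G`. It is the
  -- half-turn about the horizontal axis at angle `π/n`; turning by `-π/n` makes it `halfTurnX` and
  -- reduces to the preceding case.
  · have hcomm : ∀ a b, rotZ a * rotZ b * (rotZ a)⁻¹ = rotZ b := by
      intro a b
      rw [← rotZ_neg, ← rotZ_add, ← rotZ_add]
      ring_nf
    have h2 : withInversion (conjSubgroup (rotZ (-(Real.pi / n))) G) ⊓ rotations ≤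
        (D n).group := by
      rw [withInversion_conjSubgroup]
      rintro _ ⟨⟨x, hx, rfl⟩, hrot⟩
      have hx' : x ∈ (D n).group := by
        rw [← hK]
        refine ⟨hx, ?_⟩
        have := conj_mem_rotations (rotZ (-(Real.pi / n)))⁻¹ hrot
        simpa [mul_assoc] using this
      have hle : (D n).group ≤ conjSubgroup (rotZ (-(Real.pi / n)))⁻¹ (D n).group := by
        refine D_le ?_ ?_ <;> rw [mem_conjSubgroup, inv_inv]
        · rw [hcomm]
          exact rotZ_mem_D n
        · rw [mul_assoc, ← rotZ_neg, halfTurnX_mul_rotZ, ← mul_assoc, ← rotZ_add]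
          exact mul_mem (rotZ_mem (rotZ_mem_D n) (-1) 0 (by push_cast; ring)) (halfTurnX_mem_D n)
      have := mem_conjSubgroup.1 (hle hx')
      rwa [inv_inv] at this
    have h3 : -rotZ (2 * Real.pi / n) ∈ conjSubgroup (rotZ (-(Real.pi / n))) G := by
      rw [mem_conjSubgroup, ← rotZ_neg, mul_neg, neg_mul, ← rotZ_add, ← rotZ_add]
      have h0 : - -(Real.pi / n) + 2 * Real.pi / n + -(Real.pi / n) = 2 * Real.pi / n := by ring
      rwa [h0]
    have h4 : halfTurnX ∈ conjSubgroup (rotZ (-(Real.pi / n))) G := by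
      rw [mem_conjSubgroup, ← rotZ_neg, mul_assoc, halfTurnX_mul_rotZ, ← mul_assoc, ← rotZ_add]
      have := mul_mem hr hh
      rw [neg_mul_neg] at this
      convert this using 3
      ring
    obtain ⟨s, hs, h⟩ := isListed_of_halfTurnX_mem (G := conjSubgroup (rotZ (-(Real.pi / n))) G)
      (n := n) (by rw [mem_conjSubgroup]; simpa using h1) hn h2 h3 h4
    exact ⟨s, hs, _, h⟩

/-- `cyclicPerm` has odd order, so its sign is positive. The three coordinate half-turns are
conjugate under it, hence have one common sign, and since one is the product of the other two, that
sign is positive. -/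
theorem T_le_of_le_withInversion {G : Subgroup O3} (h1 : -1 ∉ G)
    (hK : T.group ≤ withInversion G) : T.group ≤ G := by
  have hc : cyclicPerm ∈ G := by
    rcases hK ⟨cyclicPerm_mem_tetrahedral, cyclicPerm_mem_rotations⟩ with h | h
    · exact h
    · have := pow_mem h 3
      rw [Odd.neg_pow (by decide), cyclicPerm_pow_three] at this
      exact absurd this h1
  refine T_le ?_ hc
  rcases hK ⟨rotZ_pi_mem_tetrahedral, rotZ_mem_rotations _⟩ with h | h
  · exact h
  · have h2 := mul_mem (mul_mem hc h) (inv_mem hc)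
    rw [mul_neg, neg_mul, cyclicPerm_conj] at h2
    have h3 := mul_mem (mul_mem hc h2) (inv_mem hc)
    rw [mul_neg, neg_mul, cyclicPerm_conj'] at h3
    have h4 := mul_mem h h2
    rw [neg_mul_neg] at h4
    exact absurd (neg_one_mem h4 h3) h1

theorem isListed_of_rotations_eq_T {G : Subgroup O3} (h1 : -1 ∉ G)
    (hK : withInversion G ⊓ rotations = T.group) : G = T.group :=
  (eq_of_le_of_le_withInversion h1 (T_le_of_le_withInversion h1 (hK.ge.trans inf_le_left))
    (hK.le.trans (le_withInversion _))).symm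

/-- All of `T` is positive. If some `k ∈ O` is negative, then `-k` belongs to `Td`, and every
element of `Td` lies in `T` or in the coset `T * (-k)`, so `Td ≤ G`. -/
theorem isListed_of_rotations_eq_O {G : Subgroup O3} (h1 : -1 ∉ G)
    (hK : withInversion G ⊓ rotations = O.group) : G = O.group ∨ G = Td.group := by
  have hTO : T.group ≤ O.group :=
    T_le ⟨rotZ_pi_mem_octahedral, rotZ_mem_rotations _⟩
      ⟨cyclicPerm_mem_octahedral, cyclicPerm_mem_rotations⟩
  have hTG := T_le_of_le_withInversion h1 (hTO.trans (hK.ge.trans inf_le_left))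
  by_cases hOG : O.group ≤ G
  · exact Or.inl (eq_of_le_of_le_withInversion h1 hOG (hK.le.trans (le_withInversion _))).symm
  · right
    obtain ⟨k, hk, hkG⟩ := SetLike.not_le_iff_exists.1 hOG
    have hkG' : -k ∈ G := (hK.ge hk).1.resolve_left hkG
    have hkT : -k ∈ Td.group :=
      (Oh_le_withInversion hk.1).resolve_left fun h => hkG (hTG ⟨h, hk.2⟩)
    refine (eq_of_le_of_le_withInversion h1 (fun g hg => ?_)
      (hK.le.trans (inf_le_left.trans Oh_le_withInversion))).symm
    rcases mem_or_neg_mem_rotations g with h | h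
    · exact hTG ⟨hg, h⟩
    · have h2 : g * (-k)⁻¹ ∈ G := by
        refine hTG ⟨mul_mem hg (Td.group.inv_mem hkT), ?_⟩
        have h3 : -g * k⁻¹ ∈ rotations := mul_mem h (inv_mem (O_le_rotations hk))
        have h4 : (-k)⁻¹ = -k⁻¹ := by
          rw [inv_eq_iff_mul_eq_one, neg_mul_neg, mul_inv_cancel]
        rwa [h4, mul_neg, ← neg_mul]
      simpa using mul_mem h2 hkG'

theorem four_dvd_card {X : Type*} [Group X] [Finite X] {a b : X} (ha : a * a = 1)
    (hb : b * b = 1) (hab : a * b = b * a) (ha1 : a ≠ 1) (hb1 : b ≠ 1) (hne : a ≠ b) :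
    4 ∣ Nat.card X := by
  classical
  have hne' : a * b ≠ 1 := fun h => hne (by
    rw [mul_eq_one_iff_eq_inv] at h
    rw [h, inv_eq_iff_mul_eq_one, hb])
  have haab : a * (a * b) = b := by rw [← mul_assoc, ha, one_mul]
  have hbab : b * (a * b) = a := by rw [hab, ← mul_assoc, hb, one_mul]
  let W : Subgroup X :=
    { carrier := {1, a, b, a * b}
      one_mem' := by simp
      mul_mem' := by
        rintro x y (rfl | rfl | rfl | rfl) (rfl | rfl | rfl | rfl) <;>
          simp [ha, hb, haab, hbab, mul_assoc, hab.symm]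
      inv_mem' := by
        have h1 : a⁻¹ = a := inv_eq_of_mul_eq_one_left ha
        have h2 : b⁻¹ = b := inv_eq_of_mul_eq_one_left hb
        rintro x (rfl | rfl | rfl | rfl) <;> simp [h1, h2, hab.symm] }
  have hW : Nat.card W = 4 := by
    change Nat.card ({1, a, b, a * b} : Set X) = 4
    rw [Nat.card_coe_set_eq, Set.ncard_insert_of_notMem, Set.ncard_insert_of_notMem,
      Set.ncard_pair]
    · simpa using ha1
    · simp [hne, hb1]
    · simp [ha1.symm, hb1.symm, hne'.symm]
  exact hW ▸ Subgroup.card_subgroup_dvd_card W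

/-- A negative element would make `G ∩ I` a subgroup of index two, of order `30`; but it contains
the Klein four-group of coordinate half-turns, and `4` does not divide `30`. -/
theorem isListed_of_rotations_eq_I {G : Subgroup O3} (h1 : -1 ∉ G)
    (hK : withInversion G ⊓ rotations = I.group) (hcard : Nat.card I.group = 60) :
    G = I.group := by
  have hTI : T.group ≤ I.group :=
    T_le ⟨rotZ_pi_mem_icosahedral, rotZ_mem_rotations _⟩
      ⟨cyclicPerm_mem_icosahedral, cyclicPerm_mem_rotations⟩
  have hTG := T_le_of_le_withInversion h1 (hTI.trans (hK.ge.trans inf_le_left))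
  suffices hIG : I.group ≤ G from
    (eq_of_le_of_le_withInversion h1 hIG (hK.le.trans (le_withInversion _))).symm
  by_contra hIG
  obtain ⟨k, hk, hkG⟩ := SetLike.not_le_iff_exists.1 hIG
  have hkG' : -k ∈ G := (hK.ge hk).1.resolve_left hkG
  have hindex : (G.subgroupOf I.group).index = 2 := by
    rw [Subgroup.index_eq_two_iff]
    refine ⟨⟨k, hk⟩, fun b => ?_⟩
    simp only [Subgroup.mem_subgroupOf, Subgroup.coe_mul]
    by_cases hb : (b : O3) ∈ G
    · refine Or.inr ⟨hb, fun h => hkG ?_⟩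
      simpa using mul_mem (inv_mem hb) h
    · have hb' : -(b : O3) ∈ G := (hK.ge b.2).1.resolve_left hb
      exact Or.inl ⟨by rw [← neg_mul_neg]; exact mul_mem hb' hkG', hb⟩
  have hfin : Finite I.group := Nat.finite_of_card_ne_zero (by omega)
  have hc := Subgroup.card_mul_index (G.subgroupOf I.group)
  rw [hindex, hcard] at hc
  have ma : rotZ Real.pi ∈ T.group := ⟨rotZ_pi_mem_tetrahedral, rotZ_mem_rotations _⟩
  have mc : cyclicPerm ∈ T.group := ⟨cyclicPerm_mem_tetrahedral, cyclicPerm_mem_rotations⟩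
  have mb : halfTurnX ∈ T.group := by
    rw [← cyclicPerm_conj]
    exact mul_mem (mul_mem mc ma) (inv_mem mc)
  have ne : ∀ {x y : O3} (v : Fin 3 → ℝ) (i : Fin 3), (x • v) i ≠ (y • v) i → x ≠ y := by
    rintro x y v i h rfl
    exact h rfl
  have h4 : 4 ∣ Nat.card (G.subgroupOf I.group) := by
    refine four_dvd_card (a := ⟨⟨_, hTI ma⟩, hTG ma⟩) (b := ⟨⟨_, hTI mb⟩, hTG mb⟩) ?_ ?_ ?_ ?_ ?_ ?_
    · apply Subtype.ext
      apply Subtype.ext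
      change rotZ Real.pi * rotZ Real.pi = 1
      rw [← rotZ_add, rotZ_eq_one 1 (by push_cast; ring)]
    · apply Subtype.ext
      apply Subtype.ext
      exact halfTurnX_mul_self
    · apply Subtype.ext
      apply Subtype.ext
      change rotZ Real.pi * halfTurnX = halfTurnX * rotZ Real.pi
      rw [halfTurnX_mul_rotZ]
      congr 1
      exact rotZ_eq_of_cos_sin (by simp) (by simp)
    · intro h
      refine ne (x := rotZ Real.pi) (y := 1) ![1, 1, 1] 0 ?_
        (congrArg (fun x : G.subgroupOf I.group => ((x : I.group) : O3)) h)
      rw [rotZ_pi_smul, one_smul]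
      norm_num
    · intro h
      refine ne (x := halfTurnX) (y := 1) ![1, 1, 1] 1 ?_
        (congrArg (fun x : G.subgroupOf I.group => ((x : I.group) : O3)) h)
      rw [halfTurnX_smul, one_smul]
      norm_num
    · intro h
      refine ne (x := rotZ Real.pi) (y := halfTurnX) ![1, 1, 1] 0 ?_
        (congrArg (fun x : G.subgroupOf I.group => ((x : I.group) : O3)) h)
      rw [rotZ_pi_smul, halfTurnX_smul]
      norm_num
  omega

/-! ### Counting the poles of a finite rotation group -/

theorem pole_arithmetic_two {N a b c y z : ℕ} (ha : 2 * a = N) (hb : b * y = N)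
    (hc : c * z = N) (hy : 2 ≤ y) (hz : 2 ≤ z) (hy3 : y ≤ 3) (hsum : b + c = a + 2) :
    N = 2 * y ∨ N = 2 * z ∨ (N = 12 ∧ z = 3) ∨ (N = 24 ∧ z = 4) ∨ (N = 60 ∧ z = 5) := by
  interval_cases y
  · have : c = 2 := by omega
    subst this
    omega
  · have hz6 : z < 6 := by
      by_contra h
      have : c * 6 ≤ c * z := Nat.mul_le_mul_left c (by omega)
      omega
    interval_cases z <;> omega

/-- The hypotheses say `1/x + 1/y + 1/z = 1 + 2/N > 1`. Hence one order is `2` and another at most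
`3`, which leaves the triples `(2,2,n)`, `(2,3,3)`, `(2,3,4)` and `(2,3,5)`. The number `n` belongs
to the pole that will be placed in the north. -/
theorem pole_arithmetic {N a b c x y z : ℕ} (ha : a * x = N) (hb : b * y = N)
    (hc : c * z = N) (hx : 2 ≤ x) (hy : 2 ≤ y) (hz : 2 ≤ z) (hsum : a + b + c = N + 2) :
    ∃ n, (n = x ∨ n = y ∨ n = z) ∧
      (N = 2 * n ∨ (N = 12 ∧ n = 3) ∨ (N = 24 ∧ n = 4) ∨ (N = 60 ∧ n = 5)) := by
  have key : ∀ {a b c x y z : ℕ}, a * x = N → b * y = N → c * z = N → 2 ≤ y → 2 ≤ z →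
      a + b + c = N + 2 → x = 2 → ∃ n, (n = y ∨ n = z) ∧
        (N = 2 * n ∨ (N = 12 ∧ n = 3) ∨ (N = 24 ∧ n = 4) ∨ (N = 60 ∧ n = 5)) := by
    intro a b c x y z ha hb hc hy hz hsum hx
    subst hx
    have hyz : y ≤ 3 ∨ z ≤ 3 := by
      by_contra! h
      have h1 : b * 4 ≤ b * y := Nat.mul_le_mul_left b h.1
      have h2 : c * 4 ≤ c * z := Nat.mul_le_mul_left c h.2
      omega
    rcases hyz with h | h
    · rcases pole_arithmetic_two (by omega) hb hc hy hz h (by omega : b + c = a + 2) with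
        h | h | h
      · exact ⟨y, Or.inl rfl, Or.inl h⟩
      · exact ⟨z, Or.inr rfl, Or.inl h⟩
      · exact ⟨z, Or.inr rfl, Or.inr h⟩
    · rcases pole_arithmetic_two (by omega) hc hb hz hy h (by omega : c + b = a + 2) with
        h | h | h
      · exact ⟨z, Or.inr rfl, Or.inl h⟩
      · exact ⟨y, Or.inl rfl, Or.inl h⟩
      · exact ⟨y, Or.inl rfl, Or.inr h⟩
  have h2 : x = 2 ∨ y = 2 ∨ z = 2 := by
    by_contra! h
    have h1 : a * 3 ≤ a * x := Nat.mul_le_mul_left a (by omega)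
    have h2 : b * 3 ≤ b * y := Nat.mul_le_mul_left b (by omega)
    have h3 : c * 3 ≤ c * z := Nat.mul_le_mul_left c (by omega)
    omega
  rcases h2 with h | h | h
  · obtain ⟨n, hn, h⟩ := key ha hb hc hy hz hsum h
    exact ⟨n, by tauto, h⟩
  · obtain ⟨n, hn, h⟩ := key hb ha hc hx hz (by omega) h
    exact ⟨n, by tauto, h⟩
  · obtain ⟨n, hn, h⟩ := key hc ha hb hx hy (by omega) h
    exact ⟨n, by tauto, h⟩

/-- The numerical consequence of the class formula for the poles: here `f ω` is the length of the
orbit `ω`, and `s ω` the order of its stabilizers. -/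
theorem exists_orbit_of_sum {Ω : Type*} [Fintype Ω] {N : ℕ} (hN : 2 ≤ N) (f s : Ω → ℕ)
    (hfs : ∀ ω, f ω * s ω = N) (hs : ∀ ω, 2 ≤ s ω)
    (hsum : ∑ ω, f ω + 2 * (N - 1) = Fintype.card Ω * N) :
    ∃ ω, s ω = N ∨ N = 2 * s ω ∨ (N = 12 ∧ s ω = 3) ∨ (N = 24 ∧ s ω = 4) ∨
      (N = 60 ∧ s ω = 5) := by
  have hf1 : ∀ ω, 1 ≤ f ω := fun ω => Nat.pos_of_ne_zero fun h => by
    have := hfs ω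
    rw [h, zero_mul] at this
    omega
  -- Each orbit has at most `N/2` points, so `r` orbits satisfy `rN ≤ 4(N - 1)`, which gives `r <
  -- 4`.
  have hf2 : 2 * ∑ ω, f ω ≤ Fintype.card Ω * N := by
    rw [Finset.mul_sum, ← smul_eq_mul, ← Finset.card_univ, ← Finset.sum_const]
    refine Finset.sum_le_sum fun ω _ => ?_
    rw [← hfs ω, mul_comm]
    exact Nat.mul_le_mul_left _ (hs ω)
  have hcard : Fintype.card Ω < 4 := by
    by_contra! h
    have : 4 * N ≤ Fintype.card Ω * N := Nat.mul_le_mul_right N h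
    omega
  obtain ⟨e⟩ : Nonempty (Ω ≃ Fin (Fintype.card Ω)) := ⟨Fintype.equivFin Ω⟩
  rw [← e.symm.sum_comp] at hsum
  generalize Fintype.card Ω = r at *
  interval_cases r
  · simp at hsum
    omega
  · simp at hsum
    have := hf1 (e.symm 0)
    omega
  -- With two orbits the lengths add up to `2`, so each pole is fixed by the whole group.
  · rw [Fin.sum_univ_two] at hsum
    have h0 := hf1 (e.symm 0)
    have h1 := hf1 (e.symm 1)
    have h2 := hfs (e.symm 0)
    have : f (e.symm 0) = 1 := by omega
    rw [this, one_mul] at h2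
    exact ⟨_, Or.inl h2⟩
  · rw [Fin.sum_univ_three] at hsum
    obtain ⟨n, hn, h⟩ := pole_arithmetic (hfs (e.symm 0)) (hfs (e.symm 1)) (hfs (e.symm 2))
      (hs _) (hs _) (hs _) (by omega)
    rcases hn with rfl | rfl | rfl <;> exact ⟨_, Or.inr h⟩

theorem ne_neg_self_of_unit {v : Fin 3 → ℝ} (hv : v ⬝ᵥ v = 1) : v ≠ -v := by
  intro h
  have : v = 0 := self_eq_neg.1 h
  simp [this] at hv

theorem exists_unit_fixed_iff {g : O3} (hg : g ∈ rotations) (hg1 : g ≠ 1) :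
    ∃ v : Fin 3 → ℝ, v ⬝ᵥ v = 1 ∧ ∀ w : Fin 3 → ℝ, w ⬝ᵥ w = 1 → (g • w = w ↔ w = v ∨ w = -v) := by
  obtain ⟨v, hv, hgv⟩ := exists_unit_fixed hg
  refine ⟨v, hv, fun w hw => ⟨fun h => ?_, ?_⟩⟩
  · by_contra! hne
    exact hg1 (eq_one_of_fixed hg hv hw hne.1 hne.2 hgv h)
  · rintro (rfl | rfl)
    · exact hgv
    · rw [smul_neg, hgv]

instance subgroupAction (K : Subgroup O3) : MulAction K (Fin 3 → ℝ) :=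
  MulAction.compHom (Fin 3 → ℝ) K.subtype

instance subgroupSMul (K : Subgroup O3) : SMul K (Fin 3 → ℝ) := (subgroupAction K).toSMul

/-- The poles of a group: the unit vectors which are fixed by a nontrivial element. -/
def poles (K : Subgroup O3) : SubMulAction K (Fin 3 → ℝ) where
  carrier := {v | v ⬝ᵥ v = 1 ∧ ∃ k : K, k ≠ 1 ∧ k • v = v}
  smul_mem' := by
    rintro g v ⟨hv, k, hk, hkv⟩
    refine ⟨(O3.dotProduct_smul_smul (g : O3) v v).trans hv, g * k * g⁻¹, ?_, ?_⟩
    · rwa [Ne, conj_eq_one_iff]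
    · rw [mul_smul, inv_smul_smul, mul_smul, hkv]

instance polesAction (K : Subgroup O3) : MulAction K (poles K) :=
  SubMulAction.mulAction _

instance polesSMul (K : Subgroup O3) : SMul K (poles K) := (polesAction K).toSMul

theorem finite_poles {K : Subgroup O3} [Finite K] (hK : K ≤ rotations) : Finite (poles K) := by
  have h : ∀ k : K, {v : Fin 3 → ℝ | v ⬝ᵥ v = 1 ∧ k ≠ 1 ∧ k • v = v}.Finite := by
    intro k
    by_cases hk : k = 1
    · simp [hk]
    · obtain ⟨v, -, h⟩ := exists_unit_fixed_iff (hK k.2) (fun h => hk (Subtype.ext h))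
      refine (Set.toFinite {v, -v}).subset ?_
      rintro w ⟨hw, -, hkw⟩
      exact (h w hw).1 hkw
  refine Set.Finite.subset (Set.finite_iUnion h) ?_
  rintro v ⟨hv, k, hk, hkv⟩
  exact Set.mem_iUnion.2 ⟨k, hv, hk, hkv⟩

theorem card_fixedBy_poles {K : Subgroup O3} (hK : K ≤ rotations) {k : K} (hk : k ≠ 1) :
    Nat.card (MulAction.fixedBy (poles K) k) = 2 := by
  obtain ⟨v, hv, h⟩ := exists_unit_fixed_iff (hK k.2) (fun h => hk (Subtype.ext h))
  have hv1 : v ∈ poles K := ⟨hv, k, hk, (h v hv).2 (Or.inl rfl)⟩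
  have hv' : (-v) ⬝ᵥ (-v) = 1 := by simpa using hv
  have hv2 : -v ∈ poles K := ⟨hv', k, hk, (h _ hv').2 (Or.inr rfl)⟩
  have : MulAction.fixedBy (poles K) k = {⟨v, hv1⟩, ⟨-v, hv2⟩} := by
    ext ⟨w, hw⟩
    rw [MulAction.mem_fixedBy]
    simp only [Set.mem_insert_iff, Set.mem_singleton_iff, Subtype.mk.injEq]
    rw [← h w hw.1, Subtype.ext_iff]
    rfl
  rw [this, Nat.card_coe_set_eq, Set.ncard_pair]
  intro h
  exact ne_neg_self_of_unit hv (congrArg Subtype.val h)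

/-- Every nontrivial rotation fixes exactly two poles, so Burnside's formula reads `|P| + 2(N - 1) =
rN`, with `P` the set of poles and `r` the number of its orbits. Splitting `P` into orbits puts this
in the form of `exists_orbit_of_sum`. -/
theorem exists_pole {K : Subgroup O3} [Finite K] (hK : K ≤ rotations) (hN : 2 ≤ Nat.card K) :
    ∃ p : Fin 3 → ℝ, p ⬝ᵥ p = 1 ∧ 2 ≤ Nat.card (MulAction.stabilizer K p) ∧
      (Nat.card (MulAction.stabilizer K p) = Nat.card K ∨
      Nat.card K = 2 * Nat.card (MulAction.stabilizer K p) ∨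
      (Nat.card K = 12 ∧ Nat.card (MulAction.stabilizer K p) = 3) ∨
      (Nat.card K = 24 ∧ Nat.card (MulAction.stabilizer K p) = 4) ∨
      (Nat.card K = 60 ∧ Nat.card (MulAction.stabilizer K p) = 5)) := by
  classical
  have := finite_poles hK
  let _ := Fintype.ofFinite K
  let _ := Fintype.ofFinite (poles K)
  let _ := Fintype.ofFinite (Quotient (MulAction.orbitRel K (poles K)))
  have hburn := MulAction.sum_card_fixedBy_eq_card_orbits_mul_card_group K (poles K)
  rw [← Finset.add_sum_erase _ _ (Finset.mem_univ (1 : K))] at hburn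
  have h1 : Fintype.card (MulAction.fixedBy (poles K) (1 : K)) =
      ∑ ω : Quotient (MulAction.orbitRel K (poles K)), Nat.card (MulAction.orbit K ω.out) := by
    rw [← Nat.card_eq_fintype_card, MulAction.fixedBy_one_eq_univ, Nat.card_univ,
      Nat.card_congr (MulAction.selfEquivSigmaOrbits K (poles K)), Nat.card_sigma]
  have h2 : ∑ k ∈ Finset.univ.erase (1 : K), Fintype.card (MulAction.fixedBy (poles K) k) =
      2 * (Nat.card K - 1) := by
    rw [Finset.sum_congr rfl (g := fun _ => 2), Finset.sum_const,
      Finset.card_erase_of_mem (Finset.mem_univ _), Finset.card_univ, smul_eq_mul, mul_comm,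
      Nat.card_eq_fintype_card]
    intro k hk
    rw [← Nat.card_eq_fintype_card]
    exact card_fixedBy_poles hK (Finset.ne_of_mem_erase hk)
  rw [h1, h2, ← Nat.card_eq_fintype_card (α := K)] at hburn
  have hs : ∀ p : poles K, 2 ≤ Nat.card (MulAction.stabilizer K p) := by
    intro p
    obtain ⟨-, k, hk, hkp⟩ := p.2
    have hnt : Nontrivial (MulAction.stabilizer K p) :=
      ⟨⟨⟨k, Subtype.ext hkp⟩, 1, fun h => hk (congrArg Subtype.val h)⟩⟩
    exact Finite.one_lt_card
  obtain ⟨ω, hω⟩ := exists_orbit_of_sum hN _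
    (fun ω : Quotient (MulAction.orbitRel K (poles K)) => Nat.card (MulAction.stabilizer K ω.out))
    (fun ω => by
      simp only [Nat.card_eq_fintype_card]
      exact MulAction.card_orbit_mul_card_stabilizer_eq_card_group K ω.out)
    (fun ω => hs _) hburn
  have hstab : MulAction.stabilizer K (ω.out : Fin 3 → ℝ) = MulAction.stabilizer K ω.out := by
    ext k
    rw [MulAction.mem_stabilizer_iff, MulAction.mem_stabilizer_iff, Subtype.ext_iff]
    rfl
  refine ⟨ω.out, ω.out.2.1, ?_⟩
  rw [hstab]
  exact ⟨hs _, hω⟩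

/-! ### Stabilizers and orbits of the north pole -/

theorem zAxis_unit : zAxis ⬝ᵥ zAxis = 1 := by
  simp [zAxis]

theorem zAxis_dotProduct (v : Fin 3 → ℝ) : zAxis ⬝ᵥ v = v 2 := by
  simp [zAxis, dotProduct, Fin.sum_univ_three]

theorem rotZ_smul_zAxis (a : ℝ) : rotZ a • zAxis = zAxis := by
  rw [rotZ_smul]
  simp [zAxis]

theorem dotProduct_rotZ_smul {q : Fin 3 → ℝ} (hq : q ⬝ᵥ q = 1) (a : ℝ) :
    q ⬝ᵥ (rotZ a • q) = q 2 ^ 2 + (1 - q 2 ^ 2) * Real.cos a := by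
  rw [rotZ_smul]
  simp only [dotProduct, Fin.sum_univ_three, Matrix.cons_val] at hq ⊢
  linear_combination Real.cos a * hq

theorem sq_lt_one_of_unit {q : Fin 3 → ℝ} (hq : q ⬝ᵥ q = 1) (h1 : q ≠ zAxis) (h2 : q ≠ -zAxis) :
    q 2 ^ 2 < 1 := by
  simp only [dotProduct, Fin.sum_univ_three] at hq
  by_contra! h
  have z0 : q 0 = 0 := by nlinarith [mul_self_nonneg (q 0), mul_self_nonneg (q 1)]
  have z1 : q 1 = 0 := by nlinarith [mul_self_nonneg (q 0), mul_self_nonneg (q 1)]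
  have z2 : q 2 = 1 ∨ q 2 = -1 := mul_self_eq_one_iff.1 (by rw [z0, z1] at hq; linarith)
  rcases z2 with z2 | z2
  · exact h1 (by ext i; fin_cases i <;> simp [zAxis, z0, z1, z2])
  · exact h2 (by ext i; fin_cases i <;> simp [zAxis, z0, z1, z2])

/-- The elements of `K` which fix the north pole. -/
def northStabilizer (K : Subgroup O3) : Subgroup O3 := K ⊓ MulAction.stabilizer O3 zAxis

theorem mem_northStabilizer {K : Subgroup O3} {g : O3} :
    g ∈ northStabilizer K ↔ g ∈ K ∧ g • zAxis = zAxis := Iff.rfl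

theorem card_C_le {n : ℕ} (hn : 0 < n) : Nat.card (Schoenflies.C n).group ≤ n := by
  have hn0 : (n : ℝ) ≠ 0 := by positivity
  have h : (Schoenflies.C n).group = Subgroup.zpowers (rotZ (2 * Real.pi / n)) :=
    (Subgroup.zpowers_eq_closure _).symm
  rw [h, Nat.card_zpowers]
  refine orderOf_le_of_pow_eq_one hn ?_
  rw [rotZ_pow, rotZ_eq_one 1]
  field_simp
  simp

/-- In a stabilizer of order `m` every angle `a` satisfies `ma ∈ 2πℤ`, so the stabilizer is
contained in `C m`, which has at most `m` elements. -/
theorem northStabilizer_eq {K : Subgroup O3} [Finite K] (hK : K ≤ rotations) :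
    northStabilizer K = (Schoenflies.C (Nat.card (northStabilizer K))).group := by
  have hfin : Finite (northStabilizer K) :=
    .of_injective _ (Subgroup.inclusion_injective (inf_le_left : northStabilizer K ≤ K))
  have hpos : 0 < Nat.card (northStabilizer K) := Nat.card_pos
  have hCfin : Finite (Schoenflies.C (Nat.card (northStabilizer K))).group := (finite_axial hpos).1
  refine Subgroup.eq_of_le_of_card_ge (fun g hg => ?_) (card_C_le hpos)
  obtain ⟨a, rfl⟩ := exists_rotZ_of_smul_eq (hK hg.1) hg.2
  have h1 : rotZ a ^ Nat.card (northStabilizer K) = 1 :=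
    congrArg Subtype.val (pow_card_eq_one' (x := (⟨rotZ a, hg⟩ : northStabilizer K)))
  rw [rotZ_pow] at h1
  have h2 : Real.cos (Nat.card (northStabilizer K) * a) = 1 :=
    congrFun (congrFun (congrArg Subtype.val h1) 0) 0
  obtain ⟨k, hk⟩ := (Real.cos_eq_one_iff _).1 h2
  refine rotZ_mem (Schoenflies.rotZ_mem_C _) k 0 ?_
  have : (Nat.card (northStabilizer K) : ℝ) ≠ 0 := by positivity
  field_simp
  push_cast
  linarith

theorem smul_apply_two_of_mem_northStabilizer {K : Subgroup O3} (hK : K ≤ rotations) {g : O3}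
    (hg : g ∈ northStabilizer K) (v : Fin 3 → ℝ) : (g • v) 2 = v 2 := by
  obtain ⟨a, rfl⟩ := exists_rotZ_of_smul_eq (hK hg.1) hg.2
  rw [rotZ_smul]
  simp

theorem card_stabilizer {K : Subgroup O3} (p : Fin 3 → ℝ) : Nat.card (MulAction.stabilizer K p) =
    Nat.card (K ⊓ MulAction.stabilizer O3 p : Subgroup O3) :=
  Nat.card_congr
    { toFun := fun k => ⟨k.1.1, k.1.2, k.2⟩
      invFun := fun k => ⟨⟨k.1, k.2.1⟩, k.2.2⟩
      left_inv := fun _ => rfl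
      right_inv := fun _ => rfl }

theorem card_conjSubgroup (g : O3) (K : Subgroup O3) :
    Nat.card (conjSubgroup g K) = Nat.card K :=
  (Nat.card_congr (K.equivMapOfInjective _ (MulAut.conj g).injective).toEquiv).symm

theorem card_northStabilizer_conj {K : Subgroup O3} {Q : O3} {p : Fin 3 → ℝ}
    (h : Q • p = zAxis) :
    Nat.card (northStabilizer (conjSubgroup Q K)) = Nat.card (MulAction.stabilizer K p) := by
  have hp : p = Q⁻¹ • zAxis := by rw [← h, inv_smul_smul]
  rw [card_stabilizer, ← card_conjSubgroup Q (K ⊓ MulAction.stabilizer O3 p)]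
  congr 2
  ext x
  simp only [mem_northStabilizer, mem_conjSubgroup, Subgroup.mem_inf,
    MulAction.mem_stabilizer_iff, mul_smul]
  rw [hp, smul_inv_smul, smul_left_cancel_iff]

theorem ncard_orbit_mul {K : Subgroup O3} :
    (MulAction.orbit K zAxis).ncard * Nat.card (northStabilizer K) = Nat.card K := by
  have h := card_stabilizer (K := K) zAxis
  change _ = Nat.card (northStabilizer K) at h
  rw [← h, ← MulAction.index_stabilizer, mul_comm, Subgroup.card_mul_index]

theorem finite_orbit {K : Subgroup O3} [Finite K] (p : Fin 3 → ℝ) :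
    (MulAction.orbit K p).Finite := Set.finite_range _

theorem unit_of_mem_orbit {K : Subgroup O3} {x : Fin 3 → ℝ} (hx : x ∈ MulAction.orbit K zAxis) :
    x ⬝ᵥ x = 1 := by
  obtain ⟨k, rfl⟩ := hx
  exact (O3.dotProduct_smul_smul (k : O3) _ _).trans zAxis_unit

theorem smul_mem_orbit {K : Subgroup O3} {x : Fin 3 → ℝ} (hx : x ∈ MulAction.orbit K zAxis)
    {k : O3} (hk : k ∈ K) : k • x ∈ MulAction.orbit K zAxis := by
  obtain ⟨l, rfl⟩ := hx
  exact ⟨⟨k, hk⟩ * l, mul_smul _ _ _⟩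

/-- Carrying `x` back to the north pole turns the inner product into a height. Hence the heights in
the orbit control all of its inner products. -/
theorem exists_apply_two_eq_dotProduct {K : Subgroup O3} {x y : Fin 3 → ℝ}
    (hx : x ∈ MulAction.orbit K zAxis) (hy : y ∈ MulAction.orbit K zAxis) :
    ∃ y' ∈ MulAction.orbit K zAxis, x ⬝ᵥ y = y' 2 ∧ (y' = zAxis → y = x) ∧
      (y' = -zAxis → y = -x) := by
  obtain ⟨k, rfl⟩ := hx
  refine ⟨(k : O3)⁻¹ • y, smul_mem_orbit hy (inv_mem k.2), ?_, fun h => ?_, fun h => ?_⟩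
  · rw [← zAxis_dotProduct ((k : O3)⁻¹ • y), ← O3.dotProduct_smul_smul (k : O3) zAxis,
      smul_inv_smul]
    rfl
  · exact inv_smul_eq_iff.1 h
  · rw [inv_smul_eq_iff, smul_neg] at h
    exact h

theorem card_dvd_ncard_of_free {G X : Type*} [Group G] [MulAction G X] (Y : Set X)
    (hinv : ∀ g : G, ∀ y ∈ Y, g • y ∈ Y) (hfree : ∀ g : G, ∀ y ∈ Y, g • y = y → g = 1) :
    Nat.card G ∣ Y.ncard := by
  let S : SubMulAction G X := ⟨Y, fun g y hy => hinv g y hy⟩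
  have hS : ∀ b : S, MulAction.stabilizer G b = ⊥ := by
    intro b
    rw [Subgroup.eq_bot_iff_forall]
    intro g hg
    exact hfree g b b.2 (congrArg Subtype.val hg)
  have h := Nat.card_congr (MulAction.selfEquivOrbitsQuotientProd hS)
  rw [Nat.card_prod] at h
  exact ⟨_, (h.trans (mul_comm _ _))⟩

/-- The points of the orbit of the north pole other than the north and south pole. -/
def properOrbit (K : Subgroup O3) : Set (Fin 3 → ℝ) :=
  MulAction.orbit K zAxis \ {zAxis, -zAxis}

theorem mem_properOrbit {K : Subgroup O3} {q : Fin 3 → ℝ} : q ∈ properOrbit K ↔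
    q ∈ MulAction.orbit K zAxis ∧ q ≠ zAxis ∧ q ≠ -zAxis := by
  simp [properOrbit]

theorem smul_mem_properOrbit {K : Subgroup O3} {q : Fin 3 → ℝ} (hq : q ∈ properOrbit K) {g : O3}
    (hg : g ∈ northStabilizer K) : g • q ∈ properOrbit K := by
  rw [mem_properOrbit] at hq ⊢
  obtain ⟨h, h1, h2⟩ := hq
  have hz : g⁻¹ • zAxis = zAxis := by rw [inv_smul_eq_iff, hg.2]
  refine ⟨smul_mem_orbit h hg.1, fun h3 => h1 ?_, fun h3 => h2 ?_⟩
  · rw [← hz, ← h3, inv_smul_smul]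
  · rw [← hz, ← smul_neg, ← h3, inv_smul_smul]

theorem eq_one_of_smul_properOrbit {K : Subgroup O3} (hK : K ≤ rotations) {q : Fin 3 → ℝ}
    (hq : q ∈ properOrbit K) {g : O3} (hg : g ∈ northStabilizer K) (h : g • q = q) : g = 1 := by
  rw [mem_properOrbit] at hq
  exact eq_one_of_fixed (hK hg.1) zAxis_unit (unit_of_mem_orbit hq.1) hq.2.1 hq.2.2 hg.2 h

theorem card_dvd_ncard_properOrbit {K : Subgroup O3} (hK : K ≤ rotations) :
    Nat.card (northStabilizer K) ∣ (properOrbit K).ncard :=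
  card_dvd_ncard_of_free (G := northStabilizer K) _ (fun g _ hy => smul_mem_properOrbit hy g.2)
    fun g _ hy h => Subtype.ext (eq_one_of_smul_properOrbit hK hy g.2 h)

theorem ncard_orbit_northStabilizer {K : Subgroup O3} (hK : K ≤ rotations) {q : Fin 3 → ℝ}
    (hq : q ∈ properOrbit K) :
    (MulAction.orbit (northStabilizer K) q).ncard = Nat.card (northStabilizer K) := by
  have h : MulAction.stabilizer (northStabilizer K) q = ⊥ := by
    rw [Subgroup.eq_bot_iff_forall]
    intro g hg
    exact Subtype.ext (eq_one_of_smul_properOrbit hK hq g.2 hg)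
  rw [← MulAction.index_stabilizer, h, Subgroup.index_bot]

theorem orbit_northStabilizer_subset {K : Subgroup O3} {q : Fin 3 → ℝ}
    (hq : q ∈ properOrbit K) : MulAction.orbit (northStabilizer K) q ⊆ properOrbit K := by
  rintro _ ⟨g, rfl⟩
  exact smul_mem_properOrbit hq g.2

theorem zAxis_mem_orbit (K : Subgroup O3) : zAxis ∈ MulAction.orbit K zAxis :=
  MulAction.mem_orbit_self _

/-- Together with the divisibility in `card_dvd_ncard_properOrbit`, the count decides in every case
needed below whether the south pole belongs to the orbit. -/
theorem ncard_properOrbit {K : Subgroup O3} [Finite K] :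
    (-zAxis ∈ MulAction.orbit K zAxis ∧
      (properOrbit K).ncard + 2 = (MulAction.orbit K zAxis).ncard) ∨
    (-zAxis ∉ MulAction.orbit K zAxis ∧
      (properOrbit K).ncard + 1 = (MulAction.orbit K zAxis).ncard) := by
  by_cases h : -zAxis ∈ MulAction.orbit K zAxis
  · refine Or.inl ⟨h, ?_⟩
    rw [← Set.ncard_pair (ne_neg_self_of_unit zAxis_unit)]
    exact Set.ncard_sdiff_add_ncard_of_subset (Set.insert_subset (zAxis_mem_orbit K)
      (Set.singleton_subset_iff.2 h)) (finite_orbit _)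
  · refine Or.inr ⟨h, ?_⟩
    have : properOrbit K = MulAction.orbit K zAxis \ {zAxis} := by
      ext x
      rw [mem_properOrbit]
      simp only [Set.mem_sdiff, Set.mem_singleton_iff]
      refine ⟨fun hx => ⟨hx.1, hx.2.1⟩, fun hx => ⟨hx.1, hx.2, ?_⟩⟩
      rintro rfl
      exact h hx.1
    rw [this]
    exact Set.ncard_sdiff_singleton_add_one (zAxis_mem_orbit K) (finite_orbit _)

theorem neg_mem_orbit {K : Subgroup O3} (h : -zAxis ∈ MulAction.orbit K zAxis) {x : Fin 3 → ℝ}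
    (hx : x ∈ MulAction.orbit K zAxis) : -x ∈ MulAction.orbit K zAxis := by
  obtain ⟨k, rfl⟩ := hx
  have := smul_mem_orbit h k.2
  rwa [smul_neg] at this

theorem neg_mem_properOrbit {K : Subgroup O3} (h : -zAxis ∈ MulAction.orbit K zAxis)
    {q : Fin 3 → ℝ} (hq : q ∈ properOrbit K) : -q ∈ properOrbit K := by
  rw [mem_properOrbit] at *
  refine ⟨neg_mem_orbit h hq.1, fun h1 => hq.2.2 ?_, fun h1 => hq.2.1 (neg_injective h1)⟩
  rw [← h1, neg_neg]

/-! ### Recognizing the polyhedral groups -/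

/-- The vectors `u` and `w` are independent, so a rotation is determined by its values on them:
count the images of `u`, times the images of `w` under the stabilizer of `u`. -/
theorem card_le_of_orbit {L : Subgroup O3} [Finite L] (hL : L ≤ rotations)
    {S N : Set (Fin 3 → ℝ)} (hS : S.Finite) (hN : N.Finite) {u w : Fin 3 → ℝ} {r : ℝ}
    (hr : 0 < r) (hu : u ⬝ᵥ u = r) (hw : w ⬝ᵥ w = r) (h1 : w ≠ u) (h2 : w ≠ -u)
    (huS : ∀ g ∈ L, g • u ∈ S) (hwN : ∀ g ∈ L, g • u = u → g • w ∈ N) :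
    Nat.card L ≤ S.ncard * N.ncard := by
  rw [← Subgroup.card_mul_index (MulAction.stabilizer L u), MulAction.index_stabilizer, mul_comm]
  refine Nat.mul_le_mul (Set.ncard_le_ncard ?_ hS) ?_
  · rintro _ ⟨g, rfl⟩
    exact huS g g.2
  · have : Finite N := hN
    rw [← Nat.card_coe_set_eq]
    refine Nat.card_le_card_of_injective
      (fun g : MulAction.stabilizer L u => (⟨g.1.1 • w, hwN g.1.1 g.1.2 g.2⟩ : N)) ?_
    intro g g' h
    have h3 : g.1.1 • w = g'.1.1 • w := congrArg Subtype.val h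
    have hgu : g.1.1 • u = u := g.2
    have hgu' : g'.1.1 • u = u := g'.2
    apply Subtype.ext
    apply Subtype.ext
    rw [← inv_mul_eq_one]
    refine eq_one_of_fixed_of_norm (mul_mem (inv_mem (hL g.1.2)) (hL g'.1.2)) hr hu hw h1 h2 ?_ ?_
    · rw [mul_smul, hgu', inv_smul_eq_iff, hgu]
    · rw [mul_smul, ← h3, inv_smul_smul]

/-- By cardinality the moved and rescaled orbit is all of `S`, so the conjugate of `K` preserves
`S`; the bound on orders then excludes a proper inclusion. -/
theorem conjSubgroup_eq_of_orbit {K : Subgroup O3} [Finite K] (hK : K ≤ rotations)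
    {S : Set (Fin 3 → ℝ)} (hS : S.Finite) {c : ℝ} (hc : c ≠ 0) {g : O3}
    (hg : ∀ x ∈ MulAction.orbit K zAxis, c • (g • x) ∈ S)
    (hcard : S.ncard ≤ (MulAction.orbit K zAxis).ncard)
    (hfin : Finite (setSymmetries S ⊓ rotations : Subgroup O3))
    (hle : Nat.card (setSymmetries S ⊓ rotations : Subgroup O3) ≤ Nat.card K) :
    conjSubgroup g K = setSymmetries S ⊓ rotations := by
  have himage : (fun x => c • (g • x)) '' MulAction.orbit K zAxis = S := by
    refine Set.eq_of_subset_of_ncard_le (Set.image_subset_iff.2 hg) ?_ hS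
    rwa [Set.ncard_image_of_injective]
    exact (smul_right_injective _ hc).comp (MulAction.injective g)
  refine Subgroup.eq_of_le_of_card_ge (le_inf ?_ (conjSubgroup_le_rotations hK))
    (by rwa [card_conjSubgroup])
  rintro _ ⟨k, hk, rfl⟩
  refine mem_setSymmetries_of_finite hS fun v hv => ?_
  rw [← himage] at hv ⊢
  obtain ⟨x, hx, rfl⟩ := hv
  refine ⟨k • x, smul_mem_orbit hx hk, ?_⟩
  change c • (g • k • x) = (g * k * g⁻¹) • c • g • x
  rw [smul_comm (g * k * g⁻¹) c (g • x), mul_smul, inv_smul_smul, mul_smul]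

/-! ### The orders of the polyhedral groups -/

namespace Schoenflies

theorem finite_T : Finite T.group := by
  have : Finite (setSymmetries tetrahedron) := finite_Td
  exact .of_injective _ (Subgroup.inclusion_injective inf_le_left)

theorem finite_O : Finite O.group := by
  have : Finite (setSymmetries octahedron) := finite_Oh
  exact .of_injective _ (Subgroup.inclusion_injective inf_le_left)

theorem finite_I : Finite I.group := by
  have : Finite (setSymmetries icosahedron) := finite_Ih
  exact .of_injective _ (Subgroup.inclusion_injective inf_le_left)

theorem ncard_triple_le {α : Type*} (a b c : α) : ({a, b, c} : Set α).ncard ≤ 3 :=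
  (Set.ncard_insert_le _ _).trans (Nat.succ_le_succ (ncard_pair_le _ _))

theorem ncard_tetrahedron_le : tetrahedron.ncard ≤ 4 :=
  (Set.ncard_insert_le _ _).trans (Nat.succ_le_succ (ncard_triple_le _ _ _))

theorem ncard_octahedron_le : octahedron.ncard ≤ 6 :=
  (Set.ncard_insert_le _ _).trans (Nat.succ_le_succ ((Set.ncard_insert_le _ _).trans
    (Nat.succ_le_succ ((Set.ncard_insert_le _ _).trans (Nat.succ_le_succ
      (ncard_triple_le _ _ _))))))

theorem card_T_le : Nat.card T.group ≤ 12 := by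
  have := finite_T
  have hb : ({![1, -1, -1], ![-1, 1, -1], ![-1, -1, 1]} : Set (Fin 3 → ℝ)).ncard ≤ 3 :=
    ncard_triple_le _ _ _
  refine (card_le_of_orbit T_le_rotations tetrahedron_finite
    (Set.toFinite {![1, -1, -1], ![-1, 1, -1], ![-1, -1, 1]}) (u := ![1, 1, 1])
    (w := ![1, -1, -1]) (r := 3) (by norm_num) (by norm_num) (by norm_num) ?_ ?_ ?_ ?_).trans
    (Nat.mul_le_mul ncard_tetrahedron_le hb)
  · intro h
    have := congrFun h 1
    norm_num at this
  · intro h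
    have := congrFun h 0
    norm_num at this
  · intro g hg
    exact (mem_setSymmetries.1 hg.1 _).2 (Or.inl rfl)
  · intro g hg hgu
    have h1 : g • ![1, -1, -1] ∈ tetrahedron :=
      (mem_setSymmetries.1 hg.1 _).2 (Or.inr (Or.inl rfl))
    rcases h1 with h1 | h1
    · have h2 := MulAction.injective g (h1.trans hgu.symm)
      have := congrFun h2 1
      norm_num at this
    · exact h1

theorem card_O_le : Nat.card O.group ≤ 24 := by
  have := finite_O
  have hb : ({![1, 0, 0], ![-1, 0, 0], ![0, 1, 0], ![0, -1, 0]} : Set (Fin 3 → ℝ)).ncard ≤ 4 :=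
    (Set.ncard_insert_le _ _).trans (Nat.succ_le_succ (ncard_triple_le _ _ _))
  refine (card_le_of_orbit O_le_rotations octahedron_finite
    (Set.toFinite {![1, 0, 0], ![-1, 0, 0], ![0, 1, 0], ![0, -1, 0]}) (u := ![0, 0, 1])
    (w := ![1, 0, 0]) (r := 1) (by norm_num) (by norm_num) (by norm_num) ?_ ?_ ?_ ?_).trans
    (Nat.mul_le_mul ncard_octahedron_le hb)
  · intro h
    have := congrFun h 0
    norm_num at this
  · intro h
    have := congrFun h 0
    norm_num at this
  · intro g hg
    exact (mem_setSymmetries.1 hg.1 _).2 (by simp [octahedron])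
  · intro g hg hgu
    have h1 : g • ![1, 0, 0] ∈ octahedron := (mem_setSymmetries.1 hg.1 _).2 (Or.inl rfl)
    have h2 := O3.dotProduct_smul_smul g ![1, 0, 0] ![0, 0, 1]
    rw [hgu] at h2
    rcases h1 with h1 | h1 | h1 | h1 | h1 | h1 <;> rw [h1] at h2 ⊢ <;> simp at h2 ⊢

theorem goldenRatio_pos' : (0 : ℝ) < Real.goldenRatio + 2 := by
  have := Real.goldenRatio_pos
  linarith

theorem card_I_le : Nat.card I.group ≤ 60 := by
  have := finite_I
  have hsq := Real.goldenRatio_sq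
  have h1φ := Real.one_lt_goldenRatio
  have hb : ({![0, -1, Real.goldenRatio], ![1, Real.goldenRatio, 0], ![-1, Real.goldenRatio, 0],
      ![Real.goldenRatio, 0, 1], ![-Real.goldenRatio, 0, 1]} : Set (Fin 3 → ℝ)).ncard ≤ 5 :=
    (Set.ncard_insert_le _ _).trans (Nat.succ_le_succ ((Set.ncard_insert_le _ _).trans
      (Nat.succ_le_succ (ncard_triple_le _ _ _))))
  refine (card_le_of_orbit I_le_rotations icosahedron_finite
    (Set.toFinite {![0, -1, Real.goldenRatio], ![1, Real.goldenRatio, 0],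
      ![-1, Real.goldenRatio, 0], ![Real.goldenRatio, 0, 1], ![-Real.goldenRatio, 0, 1]})
    (u := ![0, 1, Real.goldenRatio]) (w := ![0, -1, Real.goldenRatio])
    (r := Real.goldenRatio + 2) goldenRatio_pos' ?_ ?_ ?_ ?_ ?_ ?_).trans
    (Nat.mul_le_mul ncard_icosahedron_le hb)
  · simp only [dotProduct, Fin.sum_univ_three, Matrix.cons_val]
    linarith
  · simp only [dotProduct, Fin.sum_univ_three, Matrix.cons_val]
    linarith
  · intro h
    have := congrFun h 1
    norm_num at this
  · intro h
    have := congrFun h 2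
    simp only [Pi.neg_apply, Matrix.cons_val] at this
    linarith
  · intro g hg
    exact (mem_setSymmetries.1 hg.1 _).2 ⟨1, _, Or.inl rfl, Or.inl rfl, Or.inl rfl⟩
  · intro g hg hgu
    have h1 : g • ![0, -1, Real.goldenRatio] ∈ icosahedron :=
      (mem_setSymmetries.1 hg.1 _).2 ⟨-1, _, Or.inr rfl, Or.inl rfl, Or.inl rfl⟩
    -- Adjacent vertices have inner product `φ² - 1 = φ`, which singles out the five neighbours of
    -- `(0, 1, φ)`.
    have h2 := O3.dotProduct_smul_smul g ![0, -1, Real.goldenRatio] ![0, 1, Real.goldenRatio]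
    rw [hgu] at h2
    obtain ⟨a, b, rfl | rfl, rfl | rfl, h | h | h⟩ := h1 <;> rw [h] at h2 ⊢ <;>
      first
      | (simp; done)
      | (exfalso
         simp only [dotProduct, Fin.sum_univ_three, Matrix.cons_val] at h2
         nlinarith)

end Schoenflies

/-! ### Identifying the rotation groups -/

theorem unit_of_mem_properOrbit {K : Subgroup O3} {q : Fin 3 → ℝ} (hq : q ∈ properOrbit K) :
    q ⬝ᵥ q = 1 := unit_of_mem_orbit (mem_properOrbit.1 hq).1

theorem sq_lt_one_of_mem_properOrbit {K : Subgroup O3} {q : Fin 3 → ℝ} (hq : q ∈ properOrbit K) :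
    q 2 ^ 2 < 1 := by
  have h := mem_properOrbit.1 hq
  exact sq_lt_one_of_unit (unit_of_mem_orbit h.1) h.2.1 h.2.2

theorem rotZ_mem_northStabilizer {K : Subgroup O3} [Finite K] (hK : K ≤ rotations) {n : ℕ}
    (hn : Nat.card (northStabilizer K) = n) : rotZ (2 * Real.pi / n) ∈ northStabilizer K := by
  rw [northStabilizer_eq hK, hn]
  exact rotZ_mem_C n

theorem eq_C_of_card {K : Subgroup O3} [Finite K] (hK : K ≤ rotations)
    (h : Nat.card (northStabilizer K) = Nat.card K) : K = (C (Nat.card K)).group := by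
  have h1 : northStabilizer K = K := Subgroup.eq_of_le_of_card_ge inf_le_left h.ge
  have h2 := northStabilizer_eq hK
  rwa [h1] at h2

/-- The orbit consists of the two poles. An element exchanging them is the half-turn about a
horizontal axis at some angle `a/2`, and turning by `-a/2` makes it `halfTurnX` without changing the
rotations about the `z`-axis. -/
theorem conj_eq_D_of_card {K : Subgroup O3} [Finite K] (hK : K ≤ rotations)
    (hn : 2 ≤ Nat.card (northStabilizer K))
    (h : Nat.card K = 2 * Nat.card (northStabilizer K)) :
    ∃ g, conjSubgroup g K = (D (Nat.card (northStabilizer K))).group := by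
  have horb := ncard_orbit_mul (K := K)
  rw [h] at horb
  have h2 : (MulAction.orbit K zAxis).ncard = 2 := Nat.eq_of_mul_eq_mul_right (by omega) horb
  have hdvd := card_dvd_ncard_properOrbit hK
  have hneg : -zAxis ∈ MulAction.orbit K zAxis := by
    rcases ncard_properOrbit (K := K) with h3 | h3
    · exact h3.1
    · rw [h2] at h3
      rw [show (properOrbit K).ncard = 1 by omega, Nat.dvd_one] at hdvd
      omega
  have horbit : MulAction.orbit K zAxis = {zAxis, -zAxis} := by
    refine (Set.eq_of_subset_of_ncard_le (Set.insert_subset (zAxis_mem_orbit K)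
      (Set.singleton_subset_iff.2 hneg)) ?_ (finite_orbit _)).symm
    rw [h2, Set.ncard_pair (ne_neg_self_of_unit zAxis_unit)]
  obtain ⟨s, hs⟩ := hneg
  change (s : O3) • zAxis = -zAxis at hs
  obtain ⟨a, ha⟩ := exists_rotZ_mul_halfTurnX (hK s.2) hs
  have hsK : rotZ a * halfTurnX ∈ K := ha ▸ s.2
  have hC := northStabilizer_eq hK
  have hcomm : ∀ b, rotZ (-(a / 2)) * rotZ b * (rotZ (-(a / 2)))⁻¹ = rotZ b := by
    intro b
    rw [← rotZ_neg, ← rotZ_add, ← rotZ_add]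
    ring_nf
  have hflip : rotZ (-(a / 2)) * (rotZ a * halfTurnX) * (rotZ (-(a / 2)))⁻¹ = halfTurnX := by
    rw [← rotZ_neg, mul_assoc, mul_assoc, halfTurnX_mul_rotZ, ← mul_assoc, ← mul_assoc,
      ← rotZ_add, ← rotZ_add]
    rw [rotZ_eq_one 0 (by push_cast; ring), one_mul]
  refine ⟨rotZ (-(a / 2)), le_antisymm ?_ (D_le ?_ ?_)⟩
  · have hrot : ∀ k ∈ northStabilizer K, rotZ (-(a / 2)) * k * (rotZ (-(a / 2)))⁻¹ ∈
        (D (Nat.card (northStabilizer K))).group := by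
      intro k hk
      obtain ⟨b, rfl⟩ := exists_rotZ_of_smul_eq (hK hk.1) hk.2
      rw [hcomm]
      rw [hC] at hk
      exact C_le (rotZ_mem_D _) hk
    rintro _ ⟨k, hk, rfl⟩
    change rotZ (-(a / 2)) * k * (rotZ (-(a / 2)))⁻¹ ∈ _
    have hkz : k • zAxis ∈ MulAction.orbit K zAxis := smul_mem_orbit (zAxis_mem_orbit K) hk
    rw [horbit] at hkz
    rcases hkz with hkz | hkz
    · exact hrot k ⟨hk, hkz⟩
    · have h3 : k * (rotZ a * halfTurnX) ∈ northStabilizer K := by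
        refine ⟨mul_mem hk hsK, ?_⟩
        change (k * (rotZ a * halfTurnX)) • zAxis = zAxis
        rw [mul_smul, ← ha, hs, smul_neg, hkz, neg_neg]
      have h4 := mul_mem (hrot _ h3) (inv_mem (halfTurnX_mem_D (Nat.card (northStabilizer K))))
      nth_rewrite 2 [← hflip] at h4
      simpa [mul_assoc] using h4
  · rw [← hcomm (2 * Real.pi / _)]
    exact ⟨_, (rotZ_mem_northStabilizer hK rfl).1, rfl⟩
  · rw [← hflip]
    exact ⟨_, hsK, rfl⟩

/-- The points of the orbit at the same height as `q` are exhausted by the orbit of `q` under the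
stabilizer of the north pole. -/
theorem apply_two_eq_of_card {K : Subgroup O3} [Finite K] (hK : K ≤ rotations) {q x : Fin 3 → ℝ}
    (hq : q ∈ properOrbit K) (hcard : (properOrbit K).ncard ≤ Nat.card (northStabilizer K))
    (hx : x ∈ properOrbit K) : ∃ a ∈ northStabilizer K, x = a • q := by
  have h : MulAction.orbit (northStabilizer K) q = properOrbit K :=
    Set.eq_of_subset_of_ncard_le (orbit_northStabilizer_subset hq)
      (by rwa [ncard_orbit_northStabilizer hK hq]) ((finite_orbit zAxis).subset Set.sdiff_subset)
  rw [← h] at hx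
  obtain ⟨a, rfl⟩ := hx
  exact ⟨a, a.2, rfl⟩

theorem exists_mem_properOrbit {K : Subgroup O3} (h : 0 < (properOrbit K).ncard) :
    ∃ q, q ∈ properOrbit K := by
  by_contra! h1
  rw [Set.eq_empty_of_forall_notMem h1, Set.ncard_empty] at h
  exact lt_irrefl _ h

theorem cos_two_pi_div_three : Real.cos (2 * Real.pi / 3) = -1 / 2 := by
  rw [show 2 * Real.pi / 3 = Real.pi - Real.pi / 3 by ring, Real.cos_pi_sub, Real.cos_pi_div_three]
  norm_num

theorem conj_eq_T_of_card {K : Subgroup O3} [Finite K] (hK : K ≤ rotations)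
    (hN : Nat.card K = 12) (hn : Nat.card (northStabilizer K) = 3) :
    ∃ g, conjSubgroup g K = T.group := by
  have horb := ncard_orbit_mul (K := K)
  rw [hN, hn] at horb
  have hm : (MulAction.orbit K zAxis).ncard = 4 := by omega
  have hdvd := card_dvd_ncard_properOrbit hK
  rw [hn] at hdvd
  obtain ⟨hneg, hY⟩ : -zAxis ∉ MulAction.orbit K zAxis ∧ (properOrbit K).ncard = 3 := by
    rcases ncard_properOrbit (K := K) with h | h
    · omega
    · exact ⟨h.1, by omega⟩
  obtain ⟨q, hq⟩ := exists_mem_properOrbit (K := K) (by omega)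
  have hq1 := unit_of_mem_properOrbit hq
  have hlt := sq_lt_one_of_mem_properOrbit hq
  have hheight : ∀ x ∈ properOrbit K, x 2 = q 2 := by
    intro x hx
    obtain ⟨a, ha, rfl⟩ := apply_two_eq_of_card hK hq (by omega) hx
    exact smul_apply_two_of_mem_northStabilizer hK ha q
  have hdot : ∀ x ∈ MulAction.orbit K zAxis, ∀ y ∈ MulAction.orbit K zAxis, y ≠ x →
      x ⬝ᵥ y = q 2 := by
    intro x hx y hy hne
    obtain ⟨y', hy', h1, h2, h3⟩ := exists_apply_two_eq_dotProduct hx hy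
    rw [h1]
    refine hheight y' (mem_properOrbit.2 ⟨hy', fun h => hne (h2 h), ?_⟩)
    rintro rfl
    exact hneg hy'
  have hR := rotZ_mem_northStabilizer hK hn
  have hRq := smul_mem_properOrbit hq hR
  have hR' := dotProduct_rotZ_smul hq1 (2 * Real.pi / (3 : ℕ))
  generalize rotZ (2 * Real.pi / (3 : ℕ)) • q = q' at *
  have hcos : Real.cos (2 * Real.pi / (3 : ℕ)) = -1 / 2 := cos_two_pi_div_three
  rw [hcos] at hR'
  have hne : q' ≠ q := by
    rintro rfl
    rw [hq1] at hR'
    linarith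
  rw [mem_properOrbit] at hq hRq
  rw [hdot q hq.1 q' hRq.1 hne] at hR'
  -- The three points off the axis form one orbit of the stabilizer, so any two points of the full
  -- orbit have inner product `t = q 2`. Comparing with the rotation by `2π/3` gives `(t - 1)(3t +
  -- 1) = 0`.
  have ht : q 2 = -1 / 3 := by
    have : (q 2 - 1) * (3 * q 2 + 1) = 0 := by linear_combination -2 * hR'
    rcases mul_eq_zero.1 this with h | h
    · have : q 2 = 1 := by linarith
      rw [this] at hlt
      norm_num at hlt
    · linarith
  have hq'1 := unit_of_mem_orbit hRq.1
  have hz := zAxis_mem_orbit K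
  have hsq : Real.sqrt 3 * Real.sqrt 3 = 3 := Real.mul_self_sqrt (by norm_num)
  have hs0 : Real.sqrt 3 ≠ 0 := by positivity
  have hscale : ∀ x y : Fin 3 → ℝ, (Real.sqrt 3 • x) ⬝ᵥ (Real.sqrt 3 • y) = 3 * (x ⬝ᵥ y) := by
    intro x y
    rw [smul_dotProduct, dotProduct_smul, smul_eq_mul, smul_eq_mul, ← mul_assoc, hsq]
  obtain ⟨g, hg⟩ := exists_smul_eq_of_gram
    (x := ![Real.sqrt 3 • zAxis, Real.sqrt 3 • q, Real.sqrt 3 • q'])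
    (y := ![![1, 1, 1], ![1, -1, -1], ![-1, 1, -1]])
    (by rw [Matrix.det_fin_three]; simp; norm_num) (by
      have e1 := hdot _ hz _ hq.1 hq.2.1
      have e2 := hdot _ hz _ hRq.1 hRq.2.1
      have e3 := hdot _ hq.1 _ hRq.1 hne
      have e1' := hdot _ hq.1 _ hz hq.2.1.symm
      have e2' := hdot _ hRq.1 _ hz hRq.2.1.symm
      have e3' := hdot _ hRq.1 _ hq.1 hne.symm
      intro i j
      fin_cases i <;> fin_cases j <;> simp only [Fin.zero_eta, Fin.mk_one, Fin.reduceFinMk,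
        Matrix.cons_val, hscale, zAxis_unit, hq1, hq'1, e1, e2, e3, e1', e2', e3', ht] <;> norm_num)
  have g0 : Real.sqrt 3 • (g • zAxis) = ![1, 1, 1] := by
    rw [← smul_comm]
    exact hg 0
  have g1 : Real.sqrt 3 • (g • q) = ![1, -1, -1] := by
    rw [← smul_comm]
    exact hg 1
  have g2 : Real.sqrt 3 • (g • q') = ![-1, 1, -1] := by
    rw [← smul_comm]
    exact hg 2
  refine ⟨g, conjSubgroup_eq_of_orbit hK tetrahedron_finite hs0 (g := g) (fun x hx => ?_)
    (hm ▸ ncard_tetrahedron_le) finite_T (hN ▸ card_T_le)⟩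
  by_cases h0 : x = zAxis
  · rw [h0, g0]
    exact Or.inl rfl
  by_cases h1 : x = q
  · rw [h1, g1]
    exact Or.inr (Or.inl rfl)
  by_cases h2 : x = q'
  · rw [h2, g2]
    exact Or.inr (Or.inr (Or.inl rfl))
  -- The fourth point has inner product `-1` with three independent vertices; this linear system has
  -- the fourth vertex as its only solution.
  have d : ∀ y ∈ MulAction.orbit K zAxis, x ≠ y →
      (Real.sqrt 3 • (g • y)) ⬝ᵥ (Real.sqrt 3 • (g • x)) = -1 := by
    intro y hy hne
    rw [hscale, O3.dotProduct_smul_smul, hdot y hy x hx hne, ht]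
    norm_num
  have d0 := d _ hz h0
  have d1 := d _ hq.1 h1
  have d2 := d _ hRq.1 h2
  rw [g0] at d0
  rw [g1] at d1
  rw [g2] at d2
  generalize Real.sqrt 3 • (g • x) = v at *
  simp only [dotProduct, Fin.sum_univ_three, Matrix.cons_val] at d0 d1 d2
  have v0 : v 0 = -1 := by linarith
  have v1 : v 1 = -1 := by linarith
  have v2 : v 2 = 1 := by linarith
  rw [vec_eta v, v0, v1, v2]
  simp [tetrahedron]

theorem circlePoint_arg {q : Fin 3 → ℝ} (hq : q ⬝ᵥ q = 1) (h2 : q 2 = 0) :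
    ∃ b, q = circlePoint b 0 := by
  simp only [dotProduct, Fin.sum_univ_three, h2, mul_zero, add_zero] at hq
  obtain ⟨b, h0, h1⟩ := exists_cos_sin_eq hq
  exact ⟨b, by rw [circlePoint, h0, h1, ← h2]; exact vec_eta q⟩

theorem conj_eq_O_of_card {K : Subgroup O3} [Finite K] (hK : K ≤ rotations)
    (hN : Nat.card K = 24) (hn : Nat.card (northStabilizer K) = 4) :
    ∃ g, conjSubgroup g K = O.group := by
  have horb := ncard_orbit_mul (K := K)
  rw [hN, hn] at horb
  have hm : (MulAction.orbit K zAxis).ncard = 6 := by omega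
  have hdvd := card_dvd_ncard_properOrbit hK
  rw [hn] at hdvd
  obtain ⟨hneg, hY⟩ : -zAxis ∈ MulAction.orbit K zAxis ∧ (properOrbit K).ncard = 4 := by
    rcases ncard_properOrbit (K := K) with h | h
    · exact ⟨h.1, by omega⟩
    · omega
  obtain ⟨q, hq⟩ := exists_mem_properOrbit (K := K) (by omega)
  have hq1 := unit_of_mem_properOrbit hq
  -- The four points off the axis form a single orbit of the stabilizer, containing `q` and `-q`, so
  -- these have equal heights.
  have hq2 : q 2 = 0 := by
    obtain ⟨a, ha, h⟩ := apply_two_eq_of_card hK hq (by omega) (neg_mem_properOrbit hneg hq)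
    have := smul_apply_two_of_mem_northStabilizer hK ha q
    rw [← h, Pi.neg_apply] at this
    linarith
  obtain ⟨b, hb⟩ := circlePoint_arg hq1 hq2
  have hgq : rotZ (-b) • q = ![1, 0, 0] := by
    rw [hb, rotZ_smul_circlePoint, neg_add_cancel]
    simp [circlePoint]
  have hquarter : rotZ (2 * Real.pi / (4 : ℕ)) ∈ setSymmetries octahedron := by
    refine mem_setSymmetries_of_finite octahedron_finite fun v hv => ?_
    have h4 : 2 * Real.pi / (4 : ℕ) = Real.pi / 2 := by push_cast; ring
    rw [mem_octahedron] at hv ⊢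
    rw [O3.dotProduct_smul_smul, h4, rotZ_smul, Real.cos_pi_div_two, Real.sin_pi_div_two]
    simp only [Matrix.cons_val]
    grind
  refine ⟨rotZ (-b), conjSubgroup_eq_of_orbit hK octahedron_finite one_ne_zero (g := rotZ (-b))
    (fun x hx => ?_) (hm ▸ ncard_octahedron_le) finite_O (hN ▸ card_O_le)⟩
  rw [one_smul]
  by_cases h0 : x = zAxis
  · rw [h0, rotZ_smul_zAxis]
    simp [octahedron, zAxis]
  by_cases h1 : x = -zAxis
  · rw [h1, smul_neg, rotZ_smul_zAxis]
    simp [octahedron, zAxis]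
  obtain ⟨a, ha, rfl⟩ := apply_two_eq_of_card hK hq (by omega) (mem_properOrbit.2 ⟨hx, h0, h1⟩)
  have ha' : a ∈ setSymmetries octahedron := by
    rw [northStabilizer_eq hK, hn] at ha
    exact C_le hquarter ha
  obtain ⟨c, rfl⟩ := exists_rotZ_of_smul_eq (hK ha.1) ha.2
  rw [← mul_smul, ← rotZ_add, add_comm, rotZ_add, mul_smul, hgq]
  exact (mem_setSymmetries.1 ha' _).2 (Or.inl rfl)

/-! ### The icosahedral rotation group -/

/-- Inner products `±φ` with three independent vertices leave eight sign patterns. Six of them give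
vertices; the other two, excluded by `hbad`, have the wrong norm. -/
theorem mem_icosahedron_of_dotProduct {v : Fin 3 → ℝ} (hv : v ⬝ᵥ v = Real.goldenRatio + 2)
    (h0 : v 1 + Real.goldenRatio * v 2 = Real.goldenRatio ∨
      v 1 + Real.goldenRatio * v 2 = -Real.goldenRatio)
    (h1 : -v 1 + Real.goldenRatio * v 2 = Real.goldenRatio ∨
      -v 1 + Real.goldenRatio * v 2 = -Real.goldenRatio)
    (h2 : Real.goldenRatio * v 0 + v 2 = Real.goldenRatio ∨
      Real.goldenRatio * v 0 + v 2 = -Real.goldenRatio) : v ∈ icosahedron := by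
  have hsq := Real.goldenRatio_sq
  have h1φ := Real.one_lt_goldenRatio
  have hbad : ¬ (v 0 ^ 2 = Real.goldenRatio + 1 ∧
      (Real.goldenRatio * v 0) ^ 2 = (Real.goldenRatio - 1) ^ 2) := by
    rintro ⟨ha, hb⟩
    rw [mul_pow, ha] at hb
    nlinarith
  change ∃ a b : ℝ, (a = 1 ∨ a = -1) ∧ (b = Real.goldenRatio ∨ b = -Real.goldenRatio) ∧
    (v = ![0, a, b] ∨ v = ![a, b, 0] ∨ v = ![b, 0, a])
  generalize Real.goldenRatio = φ at *
  have hφ0 : φ ≠ 0 := by positivity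
  rw [vec_eta v]
  simp only [dotProduct, Fin.sum_univ_three] at hv
  rcases h0 with h0 | h0 <;> rcases h1 with h1 | h1
  · have e1 : v 1 = 0 := by linarith
    have e2 : v 2 = 1 := mul_left_cancel₀ hφ0 (by linarith)
    rw [e1, e2] at hv
    rw [e2] at h2
    rcases h2 with h2 | h2
    · exact absurd ⟨by linarith, by rw [show φ * v 0 = φ - 1 by linarith]⟩ hbad
    · have e0 : v 0 = -φ := mul_left_cancel₀ hφ0 (by linarith)
      exact ⟨1, -φ, Or.inl rfl, Or.inr rfl, Or.inr (Or.inr (by rw [e0, e1, e2]))⟩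
  · have e2 : v 2 = 0 := mul_left_cancel₀ hφ0 (by linarith)
    have e1 : v 1 = φ := by rw [e2] at h0; linarith
    rw [e2, add_zero] at h2
    rcases h2 with h2 | h2
    · have e0 : v 0 = 1 := mul_left_cancel₀ hφ0 (by linarith)
      exact ⟨1, φ, Or.inl rfl, Or.inl rfl, Or.inr (Or.inl (by rw [e0, e1, e2]))⟩
    · have e0 : v 0 = -1 := mul_left_cancel₀ hφ0 (by linarith)
      exact ⟨-1, φ, Or.inr rfl, Or.inl rfl, Or.inr (Or.inl (by rw [e0, e1, e2]))⟩
  · have e2 : v 2 = 0 := mul_left_cancel₀ hφ0 (by linarith)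
    have e1 : v 1 = -φ := by rw [e2] at h0; linarith
    rw [e2, add_zero] at h2
    rcases h2 with h2 | h2
    · have e0 : v 0 = 1 := mul_left_cancel₀ hφ0 (by linarith)
      exact ⟨1, -φ, Or.inl rfl, Or.inr rfl, Or.inr (Or.inl (by rw [e0, e1, e2]))⟩
    · have e0 : v 0 = -1 := mul_left_cancel₀ hφ0 (by linarith)
      exact ⟨-1, -φ, Or.inr rfl, Or.inr rfl, Or.inr (Or.inl (by rw [e0, e1, e2]))⟩
  · have e1 : v 1 = 0 := by linarith
    have e2 : v 2 = -1 := mul_left_cancel₀ hφ0 (by linarith)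
    rw [e1, e2] at hv
    rw [e2] at h2
    rcases h2 with h2 | h2
    · have e0 : v 0 = φ := mul_left_cancel₀ hφ0 (by linarith)
      exact ⟨-1, φ, Or.inr rfl, Or.inl rfl, Or.inr (Or.inr (by rw [e0, e1, e2]))⟩
    · exact absurd ⟨by linarith, by rw [show φ * v 0 = -(φ - 1) by linarith, neg_sq]⟩ hbad

theorem cos_two_pi_div_five : Real.cos (2 * Real.pi / 5) = (Real.sqrt 5 - 1) / 4 := by
  have h5 : Real.sqrt 5 ^ 2 = 5 := Real.sq_sqrt (by norm_num)
  rw [show 2 * Real.pi / 5 = 2 * (Real.pi / 5) by ring, Real.cos_two_mul, Real.cos_pi_div_five]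
  linear_combination h5 / 8

theorem cos_four_pi_div_five : Real.cos (4 * Real.pi / 5) = -(Real.sqrt 5 + 1) / 4 := by
  rw [show 4 * Real.pi / 5 = Real.pi - Real.pi / 5 by ring, Real.cos_pi_sub, Real.cos_pi_div_five]
  ring

/-- If the orbit of the north pole is symmetric about the origin, and the stabilizer of the north
pole has odd order, then no point off the axis is carried to its antipode by the stabilizer. -/
theorem neg_ne_smul_of_odd {K : Subgroup O3} [Finite K] (hK : K ≤ rotations) {q : Fin 3 → ℝ}
    (hq : q ∈ properOrbit K) (hodd : Odd (Nat.card (northStabilizer K))) {g : O3}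
    (hg : g ∈ northStabilizer K) : g • q ≠ -q := by
  intro h
  have h2 : g ^ 2 = 1 := by
    refine eq_one_of_smul_properOrbit hK hq (pow_mem hg 2) ?_
    rw [sq, mul_smul, h, smul_neg, h, neg_neg]
  have hcard : g ^ Nat.card (northStabilizer K) = 1 :=
    congrArg Subtype.val (pow_card_eq_one' (x := (⟨g, hg⟩ : northStabilizer K)))
  obtain ⟨k, hk⟩ := hodd
  rw [hk, pow_succ, pow_mul, h2, one_pow, one_mul] at hcard
  rw [hcard, one_smul] at h
  exact ne_neg_self_of_unit (unit_of_mem_properOrbit hq) h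

/-- The orbits of `q` and `-q` under the stabilizer are disjoint because its order is odd, and by
cardinality they exhaust the points off the axis. -/
theorem apply_two_eq_or_of_card {K : Subgroup O3} [Finite K] (hK : K ≤ rotations)
    (hneg : -zAxis ∈ MulAction.orbit K zAxis) {q x : Fin 3 → ℝ} (hq : q ∈ properOrbit K)
    (hodd : Odd (Nat.card (northStabilizer K)))
    (hcard : (properOrbit K).ncard ≤ 2 * Nat.card (northStabilizer K))
    (hx : x ∈ properOrbit K) : x 2 = q 2 ∨ x 2 = -q 2 := by
  have hq' := neg_mem_properOrbit hneg hq
  have hfin : (properOrbit K).Finite := (finite_orbit zAxis).subset Set.sdiff_subset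
  have h1 := orbit_northStabilizer_subset hq
  have h2 := orbit_northStabilizer_subset hq'
  have hdisj : Disjoint (MulAction.orbit (northStabilizer K) q)
      (MulAction.orbit (northStabilizer K) (-q)) := by
    rw [Set.disjoint_left]
    rintro _ ⟨g, rfl⟩ ⟨g', h⟩
    change (g' : O3) • (-q) = (g : O3) • q at h
    refine neg_ne_smul_of_odd hK hq hodd (mul_mem (inv_mem g'.2) g.2) ?_
    rw [mul_smul, ← h, inv_smul_smul]
  have h : MulAction.orbit (northStabilizer K) q ∪ MulAction.orbit (northStabilizer K) (-q) =
      properOrbit K := by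
    refine Set.eq_of_subset_of_ncard_le (Set.union_subset h1 h2) ?_ hfin
    rw [Set.ncard_union_eq hdisj (hfin.subset h1) (hfin.subset h2),
      ncard_orbit_northStabilizer hK hq, ncard_orbit_northStabilizer hK hq', ← two_mul]
    exact hcard
  rw [← h] at hx
  rcases hx with ⟨g, rfl⟩ | ⟨g, rfl⟩
  · exact Or.inl (smul_apply_two_of_mem_northStabilizer hK g.2 q)
  · exact Or.inr (smul_apply_two_of_mem_northStabilizer hK g.2 (-q))

/-- The first left side exceeds the second by `(1 - t²)s/2 > 0`, so for `t ≥ 0` their values are `t`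
and `-t`. Adding the equations gives `5t² = 1`. -/
theorem golden_height {t s : ℝ} (ht0 : 0 ≤ t) (ht1 : t ^ 2 < 1) (hs : s ^ 2 = 5) (hs0 : 0 < s)
    (h1 : t ^ 2 + (1 - t ^ 2) * ((s - 1) / 4) = t ∨ t ^ 2 + (1 - t ^ 2) * ((s - 1) / 4) = -t)
    (h2 : t ^ 2 + (1 - t ^ 2) * (-(s + 1) / 4) = t ∨
      t ^ 2 + (1 - t ^ 2) * (-(s + 1) / 4) = -t) :
    t * s = 1 ∧ t ^ 2 + (1 - t ^ 2) * ((s - 1) / 4) = t := by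
  have hpos : 0 < (1 - t ^ 2) * s := mul_pos (by linarith) hs0
  have h1' : t ^ 2 + (1 - t ^ 2) * ((s - 1) / 4) = t := by
    rcases h1 with h1 | h1
    · exact h1
    · rcases h2 with h2 | h2 <;> nlinarith
  have h2' : t ^ 2 + (1 - t ^ 2) * (-(s + 1) / 4) = -t := by
    rcases h2 with h2 | h2
    · nlinarith
    · exact h2
  refine ⟨?_, h1'⟩
  have h3 : (t * s - 1) * (t * s + 1) = 0 := by
    linear_combination 2 * h1' + 2 * h2' + t ^ 2 * hs
  rcases mul_eq_zero.1 h3 with h | h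
  · linarith
  · have := mul_nonneg ht0 hs0.le
    linarith

theorem conj_eq_I_of_card {K : Subgroup O3} [Finite K] (hK : K ≤ rotations)
    (hN : Nat.card K = 60) (hn : Nat.card (northStabilizer K) = 5) :
    ∃ g, conjSubgroup g K = I.group := by
  have horb := ncard_orbit_mul (K := K)
  rw [hN, hn] at horb
  have hm : (MulAction.orbit K zAxis).ncard = 12 := by omega
  have hdvd := card_dvd_ncard_properOrbit hK
  rw [hn] at hdvd
  obtain ⟨hneg, hY⟩ : -zAxis ∈ MulAction.orbit K zAxis ∧ (properOrbit K).ncard = 10 := by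
    rcases ncard_properOrbit (K := K) with h | h
    · exact ⟨h.1, by omega⟩
    · omega
  have hodd : Odd (Nat.card (northStabilizer K)) := by
    rw [hn]
    decide
  obtain ⟨q, hq, hq0⟩ : ∃ q ∈ properOrbit K, 0 ≤ q 2 := by
    obtain ⟨q, hq⟩ := exists_mem_properOrbit (K := K) (by omega)
    rcases le_total 0 (q 2) with h | h
    · exact ⟨q, hq, h⟩
    · exact ⟨-q, neg_mem_properOrbit hneg hq, by simpa using h⟩
  have hq1 := unit_of_mem_properOrbit hq
  have hlt := sq_lt_one_of_mem_properOrbit hq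
  have hdot : ∀ x ∈ MulAction.orbit K zAxis, ∀ y ∈ MulAction.orbit K zAxis, y ≠ x → y ≠ -x →
      x ⬝ᵥ y = q 2 ∨ x ⬝ᵥ y = -q 2 := by
    intro x hx y hy hne hne'
    obtain ⟨y', hy', h1, h2, h3⟩ := exists_apply_two_eq_dotProduct hx hy
    rw [h1]
    exact apply_two_eq_or_of_card hK hneg hq hodd (by omega)
      (mem_properOrbit.2 ⟨hy', fun h => hne (h2 h), fun h => hne' (h3 h)⟩)
  have hs : Real.sqrt 5 ^ 2 = 5 := Real.sq_sqrt (by norm_num)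
  have hs0 : 0 < Real.sqrt 5 := by positivity
  have hs3 : Real.sqrt 5 < 3 := by nlinarith
  have hR : rotZ (2 * Real.pi / 5) ∈ northStabilizer K := by
    exact_mod_cast rotZ_mem_northStabilizer hK hn
  have hR2 : rotZ (4 * Real.pi / 5) ∈ northStabilizer K :=
    rotZ_mem hR 2 0 (by push_cast; ring)
  have hq' := mem_properOrbit.1 hq
  have hrot : ∀ a, rotZ a ∈ northStabilizer K → Real.cos a < 1 →
      q ⬝ᵥ (rotZ a • q) = q 2 ∨ q ⬝ᵥ (rotZ a • q) = -q 2 := by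
    intro a ha hcos
    refine hdot q hq'.1 _ (smul_mem_orbit hq'.1 ha.1) (fun h => ?_)
      (neg_ne_smul_of_odd hK hq hodd ha)
    have h1 := dotProduct_rotZ_smul hq1 a
    rw [h, hq1] at h1
    nlinarith
  have hR' := hrot _ hR (by rw [cos_two_pi_div_five]; linarith)
  have hR2' := hrot _ hR2 (by rw [cos_four_pi_div_five]; linarith)
  rw [dotProduct_rotZ_smul hq1, cos_two_pi_div_five] at hR'
  rw [dotProduct_rotZ_smul hq1, cos_four_pi_div_five] at hR2'
  obtain ⟨hts, hs1⟩ := golden_height hq0 hlt hs hs0 hR' hR2'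
  have hqR : q ⬝ᵥ (rotZ (2 * Real.pi / 5) • q) = q 2 := by
    rw [dotProduct_rotZ_smul hq1, cos_two_pi_div_five, hs1]
  have hRq := mem_properOrbit.1 (smul_mem_properOrbit hq hR)
  have hz2 := smul_apply_two_of_mem_northStabilizer hK hR q
  generalize rotZ (2 * Real.pi / 5) • q = q' at *
  have hq'1 := unit_of_mem_orbit hRq.1
  have hz := zAxis_mem_orbit K
  -- The length of the vertices of the icosahedron, as `1 + φ² = φ + 2`.
  set c := Real.sqrt (Real.goldenRatio + 2) with hc
  have hcsq : c * c = Real.goldenRatio + 2 := Real.mul_self_sqrt goldenRatio_pos'.le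
  have hc0 : c ≠ 0 := by
    intro h
    rw [h] at hcsq
    linarith [goldenRatio_pos']
  -- With `q 2 = 1/√5`, the rescaled inner product becomes that of adjacent vertices.
  have hct : c * c * q 2 = Real.goldenRatio := by
    have hgr : Real.goldenRatio = (1 + Real.sqrt 5) / 2 := rfl
    rw [hcsq, hgr]
    have : q 2 = Real.sqrt 5 / 5 := by
      apply mul_right_cancel₀ hs0.ne'
      linear_combination hts - hs / 5
    rw [this]
    linear_combination hs / 10
  have hct' : (Real.goldenRatio + 2) * q 2 = Real.goldenRatio := by rw [← hcsq, hct]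
  have hscale : ∀ x y : Fin 3 → ℝ, (c • x) ⬝ᵥ (c • y) = c * c * (x ⬝ᵥ y) := by
    intro x y
    rw [smul_dotProduct, dotProduct_smul, smul_eq_mul, smul_eq_mul, ← mul_assoc]
  have hsqφ := Real.goldenRatio_sq
  obtain ⟨g, hg⟩ := exists_smul_eq_of_gram (x := ![c • zAxis, c • q, c • q'])
    (y := ![![0, 1, Real.goldenRatio], ![0, -1, Real.goldenRatio], ![Real.goldenRatio, 0, 1]])
    det_icosahedron_basis (by
      have e1 : zAxis ⬝ᵥ q = q 2 := zAxis_dotProduct q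
      have e2 : zAxis ⬝ᵥ q' = q 2 := (zAxis_dotProduct q').trans hz2
      have e1' := (dotProduct_comm q zAxis).trans e1
      have e2' := (dotProduct_comm q' zAxis).trans e2
      have e3' := (dotProduct_comm q' q).trans hqR
      intro i j
      fin_cases i <;> fin_cases j <;> simp only [Fin.zero_eta, Fin.mk_one, Fin.reduceFinMk,
        Matrix.cons_val, hscale, zAxis_unit, hq1, hq'1, e1, e2, hqR, e1', e2', e3', hcsq, mul_one,
        hct'] <;> simp only [dotProduct, Fin.sum_univ_three, Matrix.cons_val] <;> linarith [hsqφ, sq Real.goldenRatio])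
  have g0 : c • (g • zAxis) = ![0, 1, Real.goldenRatio] := by
    rw [← smul_comm]
    exact hg 0
  have g1 : c • (g • q) = ![0, -1, Real.goldenRatio] := by
    rw [← smul_comm]
    exact hg 1
  have g2 : c • (g • q') = ![Real.goldenRatio, 0, 1] := by
    rw [← smul_comm]
    exact hg 2
  have i0 : c • (g • zAxis) ∈ icosahedron := g0 ▸ ⟨1, _, Or.inl rfl, Or.inl rfl, Or.inl rfl⟩
  have i1 : c • (g • q) ∈ icosahedron := g1 ▸ ⟨-1, _, Or.inr rfl, Or.inl rfl, Or.inl rfl⟩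
  have i2 : c • (g • q') ∈ icosahedron :=
    g2 ▸ ⟨1, _, Or.inl rfl, Or.inl rfl, Or.inr (Or.inr rfl)⟩
  have ineg : ∀ x, c • (g • x) ∈ icosahedron → c • (g • -x) ∈ icosahedron := by
    intro x hx
    rw [smul_neg, smul_neg, ← one_smul O3 (c • g • x), ← O3.neg_smul]
    exact (mem_setSymmetries.1 neg_one_mem_icosahedral _).2 hx
  refine ⟨g, conjSubgroup_eq_of_orbit hK icosahedron_finite hc0 (g := g) (fun x hx => ?_)
    (hm ▸ ncard_icosahedron_le) finite_I (hN ▸ card_I_le)⟩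
  have key : ∀ y ∈ MulAction.orbit K zAxis, c • (g • y) ∈ icosahedron →
      c • (g • x) ∈ icosahedron ∨ (c • (g • y)) ⬝ᵥ (c • (g • x)) = Real.goldenRatio ∨
        (c • (g • y)) ⬝ᵥ (c • (g • x)) = -Real.goldenRatio := by
    intro y hy hyi
    by_cases h1 : x = y
    · exact Or.inl (h1 ▸ hyi)
    by_cases h2 : x = -y
    · exact Or.inl (h2 ▸ ineg y hyi)
    right
    rw [hscale, O3.dotProduct_smul_smul]
    rcases hdot y hy x hx h1 h2 with h | h
    · exact Or.inl (by rw [h, hct])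
    · exact Or.inr (by rw [h, mul_neg, hct])
  rcases key _ hz i0 with h | d0
  · exact h
  rcases key _ hq'.1 i1 with h | d1
  · exact h
  rcases key _ hRq.1 i2 with h | d2
  · exact h
  have dv : (c • (g • x)) ⬝ᵥ (c • (g • x)) = Real.goldenRatio + 2 := by
    rw [hscale, O3.dotProduct_smul_smul, unit_of_mem_orbit hx, mul_one, hcsq]
  rw [g0] at d0
  rw [g1] at d1
  rw [g2] at d2
  refine mem_icosahedron_of_dotProduct dv ?_ ?_ ?_
  · simpa [dotProduct, Fin.sum_univ_three] using d0
  · simpa [dotProduct, Fin.sum_univ_three] using d1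
  · simpa [dotProduct, Fin.sum_univ_three] using d2

/-! ### Finite groups without inversion -/

/-- The finite rotation groups, up to conjugation. -/
theorem finite_rotation_group_classification {K : Subgroup O3} [Finite K] (hK : K ≤ rotations) :
    ∃ g, (∃ n, 0 < n ∧ conjSubgroup g K = (C n).group) ∨
      (∃ n, 0 < n ∧ conjSubgroup g K = (D n).group) ∨ conjSubgroup g K = T.group ∨
      conjSubgroup g K = O.group ∨ (conjSubgroup g K = I.group ∧ Nat.card I.group = 60) := by
  rcases Nat.lt_or_ge (Nat.card K) 2 with h1 | h2
  · have hpos : 0 < Nat.card K := Nat.card_pos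
    have hbot : K = ⊥ := Subgroup.card_eq_one.1 (by omega)
    refine ⟨1, Or.inl ⟨1, one_pos, ?_⟩⟩
    rw [conjSubgroup_one, hbot, eq_comm, eq_bot_iff]
    exact C_le (by rw [rotZ_eq_one 1 (by simp)]; exact one_mem _)
  obtain ⟨p, hp, hp2, hcases⟩ := exists_pole hK h2
  obtain ⟨Q, hQ⟩ := exists_smul_eq_north hp
  have hfin : Finite (conjSubgroup Q K) :=
    Nat.finite_of_card_ne_zero (by rw [card_conjSubgroup]; omega)
  have hrot : conjSubgroup Q K ≤ rotations := conjSubgroup_le_rotations hK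
  rw [← card_northStabilizer_conj hQ] at hp2 hcases
  rw [← card_conjSubgroup Q K] at hcases h2
  rcases hcases with h | h | h | h | h
  · exact ⟨Q, Or.inl ⟨_, by omega, eq_C_of_card hrot h⟩⟩
  · obtain ⟨g, hg⟩ := conj_eq_D_of_card hrot hp2 h
    rw [conjSubgroup_conjSubgroup] at hg
    exact ⟨_, Or.inr (Or.inl ⟨_, by omega, hg⟩)⟩
  · obtain ⟨g, hg⟩ := conj_eq_T_of_card hrot h.1 h.2
    rw [conjSubgroup_conjSubgroup] at hg
    exact ⟨_, Or.inr (Or.inr (Or.inl hg))⟩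
  · obtain ⟨g, hg⟩ := conj_eq_O_of_card hrot h.1 h.2
    rw [conjSubgroup_conjSubgroup] at hg
    exact ⟨_, Or.inr (Or.inr (Or.inr (Or.inl hg)))⟩
  · obtain ⟨g, hg⟩ := conj_eq_I_of_card hrot h.1 h.2
    -- Only the upper bound on the order of `I` was proved beforehand; the exact order is read off
    -- from the conjugate of `K`.
    have hcard : Nat.card I.group = 60 := by rw [← hg, card_conjSubgroup, h.1]
    rw [conjSubgroup_conjSubgroup] at hg
    exact ⟨_, Or.inr (Or.inr (Or.inr (Or.inr ⟨hg, hcard⟩)))⟩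

theorem withInversion_inf_rotations_conj (g : O3) (G : Subgroup O3) :
    withInversion (conjSubgroup g G) ⊓ rotations =
      conjSubgroup g (withInversion G ⊓ rotations) := by
  rw [withInversion_conjSubgroup]
  ext x
  simp only [Subgroup.mem_inf, mem_conjSubgroup]
  refine and_congr_right fun _ => ⟨fun h => ?_, fun h => ?_⟩
  · have := conj_mem_rotations g⁻¹ h
    rwa [inv_inv] at this
  · have := conj_mem_rotations g h
    simpa [mul_assoc] using this

/-- The classification is applied to the rotations in `G ∪ -G`, and `G` is then recovered from the
signs of their generators. -/
theorem exists_listedPairing {G : Subgroup O3} [Finite G] (h : -1 ∉ G) :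
    ∃ s t, ListedPairing s t ∧ ∃ g, G = conjSubgroup g s.group := by
  have hfin : Finite (withInversion G ⊓ rotations : Subgroup O3) := by
    have h1 : (G : Set O3).Finite := ‹Finite G›
    refine Set.Finite.subset (h1.union (h1.image fun x => -x)) ?_
    rintro x ⟨hx | hx, -⟩
    · exact Or.inl hx
    · exact Or.inr ⟨-x, hx, neg_neg x⟩
  suffices H : ∃ s : Schoenflies, s.IsListed ∧ ∃ g, conjSubgroup g G = s.group by
    obtain ⟨s, ⟨t, hst⟩, g, hg⟩ := H
    exact ⟨s, t, hst, g⁻¹, by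
      rw [← hg, conjSubgroup_conjSubgroup, inv_mul_cancel, conjSubgroup_one]⟩
  obtain ⟨g, hg⟩ := finite_rotation_group_classification
    (inf_le_right : withInversion G ⊓ rotations ≤ rotations)
  rw [← withInversion_inf_rotations_conj] at hg
  have hg1 : -1 ∉ conjSubgroup g G := by
    rw [mem_conjSubgroup]
    simpa using h
  rcases hg with ⟨n, hn, hg⟩ | ⟨n, hn, hg⟩ | hg | hg | ⟨hg, hcard⟩
  · obtain ⟨s, hs, h2⟩ := isListed_of_rotations_eq_C hg1 hn hg
    exact ⟨s, hs, g, h2⟩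
  · obtain ⟨s, hs, g', h2⟩ := isListed_of_rotations_eq_D hg1 hn hg
    rw [conjSubgroup_conjSubgroup] at h2
    exact ⟨s, hs, _, h2⟩
  · exact ⟨_, ⟨_, .T_Th⟩, g, isListed_of_rotations_eq_T hg1 hg⟩
  · rcases isListed_of_rotations_eq_O hg1 hg with h2 | h2
    · exact ⟨_, ⟨_, .O_Oh⟩, g, h2⟩
    · exact ⟨_, ⟨_, .Td_Oh⟩, g, h2⟩
  · exact ⟨_, ⟨_, .I_Ih⟩, g, isListed_of_rotations_eq_I hg1 hg hcard⟩

/-! ### Double covers of frameworks -/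

namespace SymFramework

variable {V Γ : Type*} [Group Γ]

theorem smul_p (F : SymFramework V Γ) (γ : Γ) (i : V) : F.τ γ • F.p i = F.p (F.θ γ i) :=
  F.symmetric γ i

theorem nonempty (F : SymFramework V Γ) : Nonempty V := by
  by_contra h
  have := not_nonempty_iff.1 h
  have h1 := F.span_eq_top
  rw [Set.range_eq_empty, Submodule.span_empty] at h1
  have h2 : (zAxis : Fin 3 → ℝ) ∈ (⊥ : Submodule ℝ (Fin 3 → ℝ)) := h1 ▸ Submodule.mem_top
  have h3 := congrFun ((Submodule.mem_bot ℝ).1 h2) 2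
  simp [zAxis] at h3

/-- The points span `ℝ³`, so there is a vertex, and a free action embeds the group in its orbit. -/
theorem finite_group [Finite V] (F : SymFramework V Γ) : Finite Γ := by
  obtain ⟨i⟩ := F.nonempty
  refine Finite.of_injective (fun γ => F.θ γ i) fun γ δ h => ?_
  have h1 : F.θ (δ⁻¹ * γ) i = i := by
    rw [map_mul, RelIso.mul_apply]
    change F.θ γ i = F.θ δ i at h
    rw [h, ← RelIso.mul_apply, ← map_mul, inv_mul_cancel, map_one]
    rfl
  exact (inv_mul_eq_one.1 (F.θ_free _ _ h1)).symm

/-- The automorphism of `G ⊕ G` which acts as `f` on both copies, and interchanges them unless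
`ε = 1`. -/
def sumAut {G : SimpleGraph V} (f : G ≃g G) (ε : ℤˣ) : G.sum G ≃g G.sum G where
  toFun := if ε = 1 then Sum.map f f else fun x => (Sum.map f f x).swap
  invFun := if ε = 1 then Sum.map f.symm f.symm else fun x => (Sum.map f.symm f.symm x).swap
  left_inv := by
    intro x
    split_ifs <;> rcases x with x | x <;> simp
  right_inv := by
    intro x
    split_ifs <;> rcases x with x | x <;> simp
  map_rel_iff' := by
    intro x y
    simp only [Equiv.coe_fn_mk]
    split_ifs <;> rcases x with x | x <;> rcases y with y | y <;>
      simp [SimpleGraph.sum, SimpleGraph.Iso.map_adj_iff]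

theorem sumAut_one {G : SimpleGraph V} (f : G ≃g G) (x : V ⊕ V) :
    sumAut f 1 x = Sum.map f f x := rfl

theorem sumAut_neg_one {G : SimpleGraph V} (f : G ≃g G) (x : V ⊕ V) :
    sumAut f (-1) x = (Sum.map f f x).swap := rfl

/-- The sign homomorphism `ℤˣ → {±1} ⊆ O(ℝ³)`. -/
def signHom : ℤˣ →* O3 where
  toFun ε := if ε = 1 then 1 else -1
  map_one' := rfl
  map_mul' a b := by
    rcases Int.units_eq_one_or a with rfl | rfl <;> rcases Int.units_eq_one_or b with rfl | rfl <;>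
      simp

theorem signHom_one : signHom 1 = 1 := rfl

theorem signHom_neg_one : signHom (-1) = -1 := rfl

/-- The double cover of a framework, with symmetry group `Γ × ℤ/2`. -/
def doubleCover (F : SymFramework V Γ) : SymFramework (V ⊕ V) (Γ × ℤˣ) where
  graph := F.graph.sum F.graph
  θ :=
    { toFun := fun g => sumAut (F.θ g.1) g.2
      map_one' := by
        ext x
        rcases x with x | x <;> simp [sumAut_one]
      map_mul' := by
        rintro ⟨γ, a⟩ ⟨δ, b⟩
        ext x
        rcases Int.units_eq_one_or a with rfl | rfl <;>
          rcases Int.units_eq_one_or b with rfl | rfl <;> rcases x with x | x <;>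
          simp [sumAut_one, sumAut_neg_one, RelIso.mul_apply] }
  θ_free := by
    rintro ⟨γ, a⟩ x h
    change sumAut (F.θ γ) a x = x at h
    rcases Int.units_eq_one_or a with rfl | rfl <;> rcases x with x | x <;>
      simp [sumAut_one, sumAut_neg_one] at h <;> simp [F.θ_free _ _ h]
  τ :=
    { toFun := fun g => F.τ g.1 * signHom g.2
      map_one' := by simp
      map_mul' := by
        rintro ⟨γ, a⟩ ⟨δ, b⟩
        rcases Int.units_eq_one_or a with rfl | rfl <;>
          rcases Int.units_eq_one_or b with rfl | rfl <;>
          simp [signHom_neg_one] }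
  p := Sum.elim F.p fun i => -F.p i
  mem_sphere := by
    rintro (i | i) <;> simp [F.mem_sphere]
  span_eq_top := by
    rw [eq_top_iff, ← F.span_eq_top]
    refine Submodule.span_mono ?_
    rintro _ ⟨i, rfl⟩
    exact ⟨Sum.inl i, rfl⟩
  symmetric := by
    rintro ⟨γ, a⟩ i
    change (F.τ γ * signHom a) • _ = Sum.elim F.p _ (sumAut (F.θ γ) a i)
    rcases Int.units_eq_one_or a with rfl | rfl <;> rcases i with i | i <;>
      simp only [signHom_one, signHom_neg_one, mul_one, mul_neg, O3.neg_smul, sumAut_one,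
        sumAut_neg_one, Sum.map_inl, Sum.map_inr, Sum.swap_inl, Sum.swap_inr, Sum.elim_inl,
        Sum.elim_inr, smul_neg, smul_p, neg_neg]

theorem isDoubleCover_doubleCover (F : SymFramework V Γ) : IsDoubleCover F F.doubleCover := by
  refine ⟨rfl, fun _ => rfl, fun _ => rfl, MonoidHom.inl Γ ℤˣ, (1, -1), fun _ _ => rfl,
    fun _ _ => rfl, fun γ => ?_, fun i => ?_, fun i => ?_, ?_, ?_⟩
  · exact mul_one _
  · change sumAut (F.θ 1) (-1) _ = _
    simp [sumAut_neg_one]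
  · change sumAut (F.θ 1) (-1) _ = _
    simp [sumAut_neg_one]
  · change F.τ 1 * -1 = -1
    simp
  · rintro ⟨γ, a⟩
    refine ⟨γ, ?_⟩
    rcases Int.units_eq_one_or a with rfl | rfl
    · exact Or.inl rfl
    · exact Or.inr (by simp)

theorem injective_doubleCover (F : SymFramework V Γ) (h : Function.Injective F.τ)
    (h' : F.InversionFree) : Function.Injective F.doubleCover.τ := by
  rw [injective_iff_map_eq_one] at h ⊢
  rintro ⟨γ, a⟩ hg
  change F.τ γ * signHom a = 1 at hg
  rcases Int.units_eq_one_or a with rfl | rfl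
  · rw [signHom_one, mul_one] at hg
    rw [h γ hg]
    rfl
  · rw [signHom_neg_one, mul_neg, mul_one, neg_eq_iff_eq_neg] at hg
    exact absurd ⟨γ, hg⟩ h'

end SymFramework

/-! ### The symmetry group and the rigidity of a double cover. -/

section

variable {V Γ Γ' : Type*} [Group Γ] [Group Γ'] {F : SymFramework V Γ}
  {F' : SymFramework (V ⊕ V) Γ'}

theorem IsDoubleCover.range_eq (h : IsDoubleCover F F') :
    F'.τ.range = withInversion F.τ.range := by
  obtain ⟨-, -, -, j, ι, -, -, hj, -, -, hι, hΓ⟩ := h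
  rw [inversion_eq] at hι
  refine le_antisymm ?_ (withInversion_le ?_ ⟨ι, hι⟩)
  · rintro _ ⟨g, rfl⟩
    obtain ⟨γ, rfl | rfl⟩ := hΓ g
    · exact Or.inl ⟨γ, (hj γ).symm⟩
    · exact Or.inr ⟨γ, by rw [map_mul, hι, hj, neg_one_mul, neg_neg]⟩
  · rintro _ ⟨γ, rfl⟩
    exact ⟨j γ, hj γ⟩

/-- Invariance under `ι` forces the velocity at `-p` to be minus that at `p`. No edges join the two
copies, and the edge conditions are unchanged when points and velocities both change sign, so
restriction and odd extension match the symmetric motions; `A(-p) = -Ap` matches the trivial ones.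
-/
theorem IsDoubleCover.forcedRigid_iff (h : IsDoubleCover F F') :
    F.ForcedRigid ↔ F'.ForcedRigid := by
  obtain ⟨hG, hl, hr, j, ι, hjl, hjr, hj, hιl, hιr, hι, hΓ⟩ := h
  rw [inversion_eq] at hι
  have hadj : ∀ x y, F'.graph.Adj x y ↔ (F.graph.sum F.graph).Adj x y := by
    rw [hG]
    exact fun _ _ => Iff.rfl
  constructor
  · intro hF u hu hs
    have hur : ∀ i, u (Sum.inr i) = -u (Sum.inl i) := by
      intro i
      rw [← hιl, ← hs]
      change F'.τ ι • u (Sum.inl i) = _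
      rw [hι, O3.neg_smul, one_smul]
    obtain ⟨A, hA, hAu⟩ := hF (fun i => u (Sum.inl i))
      ⟨fun i k hik => by
        have := hu.1 (Sum.inl i) (Sum.inl k) ((hadj _ _).2 hik)
        rwa [hl, hl] at this, fun i => by
        have := hu.2 (Sum.inl i)
        rwa [hl] at this⟩
      (fun γ i => by rw [← hj, hs, hjl])
    refine ⟨A, hA, ?_⟩
    rintro (i | i)
    · rw [hl]
      exact hAu i
    · rw [hr, hur, Matrix.mulVec_neg]
      exact congrArg _ (hAu i)
  · intro hF u hu hs
    have hs' : ∀ γ i, F.τ γ • u i = u (F.θ γ i) := hs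
    have hm : F'.IsInfinitesimalMotion (Sum.elim u fun i => -u i) := by
      constructor
      · rintro (i | i) (k | k) hik <;> rw [hadj] at hik
        · rw [hl, hl]
          exact hu.1 i k hik
        · simp [SimpleGraph.sum] at hik
        · simp [SimpleGraph.sum] at hik
        · rw [hr, hr]
          simpa using hu.1 i k hik
      · rintro (i | i)
        · rw [hl]
          exact hu.2 i
        · rw [hr]
          simpa using hu.2 i
    have hsym : F'.IsSymmetricMotion (Sum.elim u fun i => -u i) := by
      intro g x
      change F'.τ g • (Sum.elim u fun i => -u i) x = _
      obtain ⟨γ, rfl | rfl⟩ := hΓ g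
      · rcases x with i | i
        · rw [hj, hjl, Sum.elim_inl, Sum.elim_inl, hs']
        · rw [hj, hjr, Sum.elim_inr, Sum.elim_inr, smul_neg, hs']
      · rw [map_mul, map_mul, hι, hj, neg_one_mul, O3.neg_smul, RelIso.mul_apply]
        rcases x with i | i
        · rw [hjl, hιl, Sum.elim_inl, Sum.elim_inr, hs']
        · rw [hjr, hιr, Sum.elim_inl, Sum.elim_inr, smul_neg, hs', neg_neg]
    obtain ⟨A, hA, hAu⟩ := hF _ hm hsym
    exact ⟨A, hA, fun i => by rw [← hl, ← hAu, Sum.elim_inl]⟩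

end

/-- The framework without edges whose points are the images under `G` of the coordinate axes. -/
def orbitFramework (G : Subgroup O3) : SymFramework (G × Fin 3) G where
  graph := ⊥
  θ :=
    { toFun := fun g =>
        { toEquiv := (Equiv.mulLeft g).prodCongr (Equiv.refl _)
          map_rel_iff' := by simp }
      map_one' := by
        ext x <;> simp
      map_mul' := by
        intro a b
        ext x <;> simp [RelIso.mul_apply, mul_assoc] }
  θ_free := by
    rintro g ⟨x, i⟩ h
    exact mul_eq_right.1 (congrArg Prod.fst h)
  τ := G.subtype
  -- Different vertices may share a point; indexing by `G × Fin 3` keeps the action free even where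
  -- an axis vector has a nontrivial stabilizer.
  p x := (x.1 : O3) • Pi.single x.2 1
  mem_sphere := by
    intro x
    rw [O3.dotProduct_smul_smul]
    simp
  span_eq_top := by
    rw [eq_top_iff, ← (Pi.basisFun ℝ (Fin 3)).span_eq]
    refine Submodule.span_mono ?_
    rintro _ ⟨i, rfl⟩
    exact ⟨(1, i), by simp⟩
  symmetric := by
    rintro g ⟨x, i⟩
    exact (mul_smul (g : O3) (x : O3) (Pi.single i 1 : Fin 3 → ℝ)).symm

theorem doubleCoverPairing_iff {G H : Subgroup O3} :
    DoubleCoverPairing G H ↔ Finite G ∧ -1 ∉ G ∧ H = withInversion G := by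
  constructor
  · rintro ⟨V, Γ, Γ', _, _, _, F, F', -, rfl, hF, -, rfl, h⟩
    have := F.finite_group
    exact ⟨Set.finite_range F.τ, hF, h.range_eq⟩
  · rintro ⟨hG, hinv, rfl⟩
    have hr : (orbitFramework G).τ.range = G := G.range_subtype
    have hf : (orbitFramework G).InversionFree := by
      rw [SymFramework.InversionFree, hr]
      exact hinv
    have hinj : Function.Injective (orbitFramework G).τ := Subtype.val_injective
    have hd := (orbitFramework G).isDoubleCover_doubleCover
    exact ⟨G × Fin 3, G, G × ℤˣ, inferInstance, inferInstance, inferInstance, orbitFramework G,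
      (orbitFramework G).doubleCover, hinj, hr, hf,
      SymFramework.injective_doubleCover _ hinj hf, by rw [hd.range_eq, hr], hd⟩

/-- In every row the second group is determined by the first, and adjoining `-1` commutes with
conjugation, so only the first group needs to be classified. -/
theorem isListedPairing_withInversion_iff {G H : Subgroup O3} : IsListedPairing G H ↔
    H = withInversion G ∧ ∃ s t, ListedPairing s t ∧ ∃ g, G = conjSubgroup g s.group := by
  constructor
  · rintro ⟨s, t, h, g, rfl, rfl⟩
    refine ⟨?_, s, t, h, g, rfl⟩
    rw [withInversion_conjSubgroup, h.properties.1]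
  · rintro ⟨rfl, s, t, h, g, rfl⟩
    refine ⟨s, t, h, g, rfl, ?_⟩
    rw [withInversion_conjSubgroup, h.properties.1]

theorem doubleCoverPairing_iff_isListedPairing (G H : Subgroup O3) :
    DoubleCoverPairing G H ↔ IsListedPairing G H := by
  rw [doubleCoverPairing_iff, isListedPairing_withInversion_iff]
  constructor
  · rintro ⟨hG, hinv, rfl⟩
    exact ⟨rfl, exists_listedPairing hinv⟩
  · rintro ⟨rfl, s, t, h, g, rfl⟩
    obtain ⟨-, hfin, hinv⟩ := h.properties
    refine ⟨Set.Finite.image _ (show (s.group : Set O3).Finite from hfin), fun h1 => hinv ?_, rfl⟩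
    rw [mem_conjSubgroup] at h1
    simpa using h1

theorem mainTheorem8 :
    (∀ 𝒢 ℋ : Subgroup O3, DoubleCoverPairing 𝒢 ℋ ↔ IsListedPairing 𝒢 ℋ) ∧
    (∀ (V Γ : Type*) [Finite V] [Group Γ] (F : SymFramework V Γ), F.InversionFree →
      ∃ F' : SymFramework (V ⊕ V) (Γ × ℤˣ), IsDoubleCover F F') ∧
    (∀ (V Γ Γ' : Type*) [Finite V] [Group Γ] [Group Γ']
      (F : SymFramework V Γ) (F' : SymFramework (V ⊕ V) Γ'),
      F.InversionFree → IsDoubleCover F F' →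
        DoubleCoverPairing F.τ.range F'.τ.range ∧
        IsListedPairing F.τ.range F'.τ.range ∧
        (F.ForcedRigid ↔ F'.ForcedRigid)) := by
  refine ⟨doubleCoverPairing_iff_isListedPairing,
    fun V Γ _ _ F _ => ⟨_, F.isDoubleCover_doubleCover⟩, ?_⟩
  intro V Γ Γ' _ _ _ F F' hF h
  have := F.finite_group
  have hp : DoubleCoverPairing F.τ.range F'.τ.range :=
    doubleCoverPairing_iff.2 ⟨Set.finite_range F.τ, hF, h.range_eq⟩
  exact ⟨hp, (doubleCoverPairing_iff_isListedPairing _ _).1 hp, h.forcedRigid_iff⟩
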